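/- Let $d,K\ge 1$. There are $K$ items and $K$ positions, all items are displayed in every round $t=1,\dots,T$, and only their order $\sigma_t\in S_K$ is chosen (item $j$ is put in position $\sigma_t(j)$). Position $k$ is encoded as $k/K-\tfrac12$, and $z(k,x)=(k/K-\tfrac12,\;x)\in\mathbb R^{d+1}$ is the feature of an item in position $k$ for a user with context $x\in\mathbb R^d$. **Environment.** The contexts $X_t$ are i.i.d. with law $P_X$, each one independent of the past, with $\|X_t\|\le\sqrt3/2$ a.s. and $\mathbb E[X_tX_t^\top]\succeq c_xI$ for some $c_x>0$. Item $j$ has an unknown parameter $\theta_j\in\mathbb R^{d+1}$. The potential outcomes $Y_{t,j,k}$ of item $j$ in position $k$ lie in $[0,R_0]$, where $R_0>0$; conditionally on the past, on $X_t$ and on $\sigma_t$ they have mean $\mu_j(X_t,k)$, where $\mu_j(x,k)=A'(\theta_j^\top z(k,x))$, and $Y_{t,j,k}-\mu_j(X_t,k)$ is $\bar\sigma^2$-sub-Gaussian, $\bar\sigma>0$. Only $Y_{t,j}:=Y_{t,j,\sigma_t(j)}$, $j\in[K]$, are observed. The expected reward of a ranking is $r(x,\sigma)=H\big(\sum_{j=1}^K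 g_j(\mu_j(x,\sigma(j)))\big)$, and the regret is $R_T=\sum_{t=1}^T\{\max_{\sigma\in S_K} r(X_t,\sigma)-r(X_t,\sigma_t)\}$. **Regularity.** $A$ is three times differentiable; $A'$ and $H$ are nondecreasing on $\mathbb R$, and each $g_j$ is nondecreasing on the range of $A'$; $A''\le M_1$ and $A'''\le M_2$; $\kappa>0$ satisfies $A''(\theta^\top z)\ge\kappa$ whenever $\|z\|\le1$ and $\|\theta-\theta_j\|\le1$ for some $j$; and, for every $k$, $H(\sum_{i} g_i(\mu_i))$ is $c_k$-Lipschitz in $\mu_k$ when $\mu_1,\dots,\mu_K\ge0$ range over values of $A'$. Put $c_H=\sum_{k=1}^K c_k$ and $c_1=\min\{\tfrac1{2K},c_x\}$. **Algorithm (Upper Confidence Ranking).** In the rounds $t<T_0$ the ranking $\sigma_t$ is uniform on $S_K$ and independent of the past and of $X_t$. In the rounds $T_0\le t\le T$, let $\hat\theta_{t,j}$ be a maximizer over $\theta$ of $\sum_{\tau<t}\{Y_{\tau,j}\,\theta^\top Z_{\tau,j}-A(\theta^\top Z_{\tau,j})\}$ (arbitrary if there is none), where $Z_{\tau,j}=z(\sigma_\tau(j),X_\tau)$,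 and let $V_j^{(t)}=\sum_{\tau<t}Z_{\tau,j}Z_{\tau,j}^\top$; then $\sigma_t$ is any maximizer over $\sigma\in S_K$ of $$H\Big(\sum_{j=1}^K g_j\big(A'(\hat\theta_{t,j}^\top z_j+\xi\,\|z_j\|_{(V_j^{(t)})^{-1}})\big)\Big),\qquad z_j=z(\sigma(j),X_t),$$ with $\|z\|_{V^{-1}}=(z^\top V^{-1}z)^{1/2}$ and $\xi=\frac{\sqrt3\,\bar\sigma}{\kappa}\sqrt{(d+1)\log(1+2T/d)+\log(2/\delta)}$. **Claim.** Let $\delta\in(0,\tfrac12)$, and let $T_0\le T$ be integers with $$T_0\ge\max\Big\{\Big(\frac{32}{3c_1}+\frac{256}{c_1^2}\Big)\log\frac{4d+4}{\delta},\ \frac{6\bar\sigma^2}{c_1\kappa^2}\Big((d+1)\log(1+2T/d)+\log\frac2\delta\Big)\Big\}.$$ Then, with probability at least $1-\delta$, $$R_T\le c_H R_0T_0+\frac{5\bar\sigma}{\kappa}\,M_1\,c_H\,d\sqrt T\,\log\frac{T}{d\delta}.$$ If moreover $R_0$ also bounds the regret of a single round, that is, $r(x,\sigma)-r(x,\sigma')\le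 R_0$ for $P_X$-almost every $x$ and all $\sigma,\sigma'\in S_K$, then, with probability at least $1-\delta$, $$R_T\le R_0T_0+\frac{5\bar\sigma}{\kappa}\,M_1\,c_H\,d\sqrt T\,\log\frac{T}{d\delta}.$$ -/

import Mathlib

open MeasureTheory ProbabilityTheory

noncomputable section

namespace UCR

/-- The feature `z = (position, x)` of an item shown at position `k` to a user with context `x`.
Positions `1, …, K` are modelled by `Fin K` and rescaled to `k / K - 1 / 2`. -/
def feature {d K : ℕ} (k : Fin K) (x : EuclideanSpace ℝ (Fin d)) :
    EuclideanSpace ℝ (Fin (d + 1)) :=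
  WithLp.toLp 2 (Fin.cons (((k : ℕ) + 1 : ℝ) / (K : ℝ) - 1 / 2) (fun i => x i))

/-- The data of the ranking model with `K` items and `K` positions: `A` is the log-partition
function of the generalized linear model, `H` and `g j` are the aggregation functions of the list
reward, and `θ j = (α j, β j)` is the unknown parameter of item `j`. -/
structure Model (d K : ℕ) where
  A : ℝ → ℝ
  H : ℝ → ℝ
  g : Fin K → ℝ → ℝ
  θ : Fin K → EuclideanSpace ℝ (Fin (d + 1))

variable {d K : ℕ}

/-- Mean satisfaction with item `j` at position `k` under context `x`. -/
def Model.mean (M : Model d K) (j k : Fin K) (x : EuclideanSpace ℝ (Fin d)) : ℝ :=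
  deriv M.A (inner ℝ (M.θ j) (feature k x))

/-- Expected reward of the ranking `π` (item `j` is shown at position `π j`) under context `x`. -/
def Model.reward (M : Model d K) (x : EuclideanSpace ℝ (Fin d)) (π : Equiv.Perm (Fin K)) : ℝ :=
  M.H (∑ j, M.g j (M.mean j (π j) x))

/-- Regularity of the link function and of the list reward. The functions `g j` and the list reward
are only constrained at arguments that are values of `A'`, the only ones at which they are ever
evaluated; the click-through reward with `g j u = - log (1 - u)` on `(0, 1)` is thus included. -/
structure Model.Regular (M : Model d K) (M₁ M₂ κ : ℝ) (c : Fin K → NNReal) : Prop where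
  differentiable_A : Differentiable ℝ M.A
  differentiable_A' : Differentiable ℝ (deriv M.A)
  differentiable_A'' : Differentiable ℝ (deriv (deriv M.A))
  monotone_A' : Monotone (deriv M.A)
  monotone_H : Monotone M.H
  monotone_g : ∀ j, MonotoneOn (M.g j) (Set.range (deriv M.A))
  A''_le : ∀ u, deriv (deriv M.A) u ≤ M₁
  A'''_le : ∀ u, deriv (deriv (deriv M.A)) u ≤ M₂
  κ_pos : 0 < κ
  κ_le : ∀ (j : Fin K) (ϑ z : EuclideanSpace ℝ (Fin (d + 1))), ‖z‖ ≤ 1 → ‖ϑ - M.θ j‖ ≤ 1 →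
    κ ≤ deriv (deriv M.A) (inner ℝ ϑ z)
  /-- As a function of the `k`-th nonnegative mean alone, the list reward is `c k`-Lipschitz. -/
  lipschitz : ∀ (k : Fin K) (u : Fin K → ℝ),
    (∀ i, u i ∈ Set.range (deriv M.A) ∩ Set.Ici 0) →
      LipschitzOnWith (c k) (fun v => M.H (∑ i, M.g i (Function.update u k v i)))
        (Set.range (deriv M.A) ∩ Set.Ici 0)

/-- Context variation: contexts lie in the ball of radius `√3 / 2`, and `E[X Xᵀ] ⪰ c_x I`. -/
structure ContextVariation (PX : Measure (EuclideanSpace ℝ (Fin d))) (cx : ℝ) : Prop where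
  pos : 0 < cx
  norm_le : ∀ᵐ x ∂PX, ‖x‖ ≤ √3 / 2
  posSemidef : ((Matrix.of fun i j : Fin d => ∫ x, x i * x j ∂PX) -
    cx • (1 : Matrix (Fin d) (Fin d) ℝ)).PosSemidef

variable {Ω : Type*}

/-- A run of the platform: contexts `X t`, displayed rankings `ρ t`
(item `j` is at position `ρ t ω j`), and potential outcomes `Y t j k` of item `j` at position `k`,
for the rounds `t = 1, 2, …`. -/
structure Run (d K : ℕ) (Ω : Type*) where
  X : ℕ → Ω → EuclideanSpace ℝ (Fin d)
  ρ : ℕ → Ω → Equiv.Perm (Fin K)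
  Y : ℕ → Fin K → Fin K → Ω → ℝ

/-- The feature `Z_{t,j}` of item `j` displayed in round `t`. -/
def Run.Z (S : Run d K Ω) (t : ℕ) (j : Fin K) (ω : Ω) : EuclideanSpace ℝ (Fin (d + 1)) :=
  feature (S.ρ t ω j) (S.X t ω)

/-- The observed outcome of item `j` in round `t`. -/
def Run.obs (S : Run d K Ω) (t : ℕ) (j : Fin K) (ω : Ω) : ℝ :=
  S.Y t j (S.ρ t ω j) ω

/-- The σ-algebra of everything observed in the rounds `1, …, t - 1`. -/
def Run.history (S : Run d K Ω) (t : ℕ) : MeasurableSpace Ω :=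
  ⨆ s ∈ Finset.Ico 1 t,
    (MeasurableSpace.comap (S.X s) inferInstance ⊔ MeasurableSpace.comap (S.ρ s) ⊤ ⊔
      ⨆ j, MeasurableSpace.comap (S.obs s j) inferInstance)

/-- The past together with the context of round `t`. -/
def Run.contextInfo (S : Run d K Ω) (t : ℕ) : MeasurableSpace Ω :=
  S.history t ⊔ MeasurableSpace.comap (S.X t) inferInstance

/-- The past together with the context and the displayed ranking of round `t`. -/
def Run.decisionInfo (S : Run d K Ω) (t : ℕ) : MeasurableSpace Ω :=
  S.contextInfo t ⊔ MeasurableSpace.comap (S.ρ t) ⊤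

/-- The covariance matrix `V_j^{(t)}` of the features of item `j` in the rounds before `t`. -/
def Run.V (S : Run d K Ω) (t : ℕ) (j : Fin K) (ω : Ω) :
    Matrix (Fin (d + 1)) (Fin (d + 1)) ℝ :=
  ∑ s ∈ Finset.Ico 1 t, Matrix.vecMulVec (S.Z s j ω).ofLp (S.Z s j ω).ofLp

/-- The log-likelihood (up to scale and constants) of the parameter `ϑ` of item `j`, from the
rounds before `t`. -/
def Run.logLik (S : Run d K Ω) (A : ℝ → ℝ) (t : ℕ) (j : Fin K) (ω : Ω)
    (ϑ : EuclideanSpace ℝ (Fin (d + 1))) : ℝ :=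
  ∑ s ∈ Finset.Ico 1 t,
    (S.obs s j ω * inner ℝ ϑ (S.Z s j ω) - A (inner ℝ ϑ (S.Z s j ω)))

/-- The norm `‖z‖_{W⁻¹} = (zᵀ W⁻¹ z)^{1/2}`. -/
def invNorm (W : Matrix (Fin (d + 1)) (Fin (d + 1)) ℝ) (z : EuclideanSpace ℝ (Fin (d + 1))) : ℝ :=
  √(z.ofLp ⬝ᵥ W⁻¹.mulVec z.ofLp)

/-- The upper confidence bound `U_t(x, π)` of the list reward, built from the estimates `θhat` and
the tuning parameter `ξ`. -/
def Run.upper (S : Run d K Ω) (M : Model d K)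
    (θhat : ℕ → Fin K → Ω → EuclideanSpace ℝ (Fin (d + 1))) (ξ : ℝ) (t : ℕ) (ω : Ω)
    (x : EuclideanSpace ℝ (Fin d)) (π : Equiv.Perm (Fin K)) : ℝ :=
  M.H (∑ j, M.g j (deriv M.A
    (inner ℝ (θhat t j ω) (feature (π j) x) + ξ * invNorm (S.V t j ω) (feature (π j) x))))

/-- The cumulative regret over the rounds `1, …, T`. -/
def Run.regret (S : Run d K Ω) (M : Model d K) (T : ℕ) (ω : Ω) : ℝ :=
  ∑ t ∈ Finset.Icc 1 T,
    (Finset.univ.sup' Finset.univ_nonempty (fun π => M.reward (S.X t ω) π) -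
      M.reward (S.X t ω) (S.ρ t ω))

/-- The environment in the rounds `1, …, T`: the contexts are i.i.d. with law `PX` (each one is
independent of the past), and the outcomes lie in `[0, R₀]`, have the means of the model and
`σbar²`-sub-Gaussian deviations from them, conditionally on the past, the context and the
ranking. -/
structure Run.InEnvironment [MeasurableSpace Ω] (S : Run d K Ω) (P : Measure Ω)
    (M : Model d K) (PX : Measure (EuclideanSpace ℝ (Fin d))) (R₀ σbar : ℝ) (T : ℕ) : Prop where
  measurable_X : ∀ t ∈ Finset.Icc 1 T, Measurable (S.X t)
  measurable_ρ : ∀ t ∈ Finset.Icc 1 T, ∀ π, MeasurableSet {ω | S.ρ t ω = π}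
  measurable_Y : ∀ t ∈ Finset.Icc 1 T, ∀ j k, Measurable (S.Y t j k)
  law_X : ∀ t ∈ Finset.Icc 1 T, P.map (S.X t) = PX
  indep_X : ∀ t ∈ Finset.Icc 1 T,
    Indep (MeasurableSpace.comap (S.X t) inferInstance) (S.history t) P
  bounded_Y : ∀ t ∈ Finset.Icc 1 T, ∀ j k, ∀ᵐ ω ∂P, S.Y t j k ω ∈ Set.Icc 0 R₀
  mean_Y : ∀ t ∈ Finset.Icc 1 T, ∀ j k,
    P[S.Y t j k | S.decisionInfo t] =ᵐ[P] fun ω => M.mean j k (S.X t ω)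
  subgaussian_Y : ∀ t ∈ Finset.Icc 1 T, ∀ j k, ∀ l : ℝ,
    P[fun ω => Real.exp (l * (S.Y t j k ω - M.mean j k (S.X t ω))) | S.decisionInfo t]
      ≤ᵐ[P] fun _ => Real.exp (σbar ^ 2 * l ^ 2 / 2)

/-- The rankings are those of Upper Confidence Ranking with tuning parameter `ξ`, estimates `θhat`,
randomization horizon `T₀` and horizon `T`, all `K` items being displayed.
The estimate is a maximum likelihood estimate whenever one exists, and arbitrary otherwise. Ties in
the maximization of the upper confidence bound may be broken in any way. -/
structure Run.FollowsUCR [MeasurableSpace Ω] (S : Run d K Ω) (P : Measure Ω)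
    (M : Model d K) (θhat : ℕ → Fin K → Ω → EuclideanSpace ℝ (Fin (d + 1))) (ξ : ℝ)
    (T₀ T : ℕ) : Prop where
  uniform : ∀ t ∈ Finset.Ico 1 T₀, ∀ π,
    P.real {ω | S.ρ t ω = π} = 1 / (Nat.factorial K : ℝ)
  indep : ∀ t ∈ Finset.Ico 1 T₀,
    Indep (MeasurableSpace.comap (S.ρ t) ⊤) (S.contextInfo t) P
  mle : ∀ t ∈ Finset.Icc T₀ T, ∀ j, ∀ᵐ ω ∂P,
    (∃ ϑ, IsMaxOn (S.logLik M.A t j ω) Set.univ ϑ) →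
      IsMaxOn (S.logLik M.A t j ω) Set.univ (θhat t j ω)
  optimistic : ∀ t ∈ Finset.Icc T₀ T, ∀ᵐ ω ∂P, ∀ π,
    S.upper M θhat ξ t ω (S.X t ω) π ≤ S.upper M θhat ξ t ω (S.X t ω) (S.ρ t ω)

/-- The tuning parameter
`ξ = (√3 σbar / κ) ((d + 1) log (1 + 2 T / d) + log (2 / δ))^{1/2}`. -/
def tuning (d : ℕ) (σbar κ δ : ℝ) (T : ℕ) : ℝ :=
  √3 * σbar / κ * √((d + 1) * Real.log (1 + 2 * T / d) + Real.log (2 / δ))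

/-- The lower bound on the randomization horizon. -/
def threshold (d : ℕ) (c₁ σbar κ δ : ℝ) (T : ℕ) : ℝ :=
  max ((32 / (3 * c₁) + 256 / c₁ ^ 2) * Real.log ((4 * d + 4) / δ))
    (6 * σbar ^ 2 / (c₁ * κ ^ 2) *
      ((d + 1) * Real.log (1 + 2 * T / d) + Real.log (2 / δ)))

end UCR

end

/-! A single item leaves no choice and no regret. With at least two items the regret is paid in two
parts: each of the `N = T₀ - 1` randomized rounds costs at most the trivial one-round bound, and the
later rounds are treated by optimism. Suppose each linear predictor is known up to `β ‖z‖_{V⁻¹}`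
with `β ≤ ξ`. By monotonicity of `A'`, `g j` and `H`, the maximized index dominates the best reward,
so the regret of the round is at most the gap between index and true reward at the displayed
ranking, hence at most `∑ c_j M₁ (ξ + β) ‖Z_j‖_{V_j⁻¹}` (`Model.Regular.optimistic_regret_le`).
Cauchy–Schwarz and the elliptical potential (`sum_inv_form_le`) bound the sum of the widths by the
growth of `log det V_j`.

Accuracy rests on two facts. The noise is controlled uniformly in time by the method of mixtures:
Ville's inequality for a Gaussian mixture of exponential supermartingales (`self_normalized`). The
curvature of the likelihood is at least `κ` on a bounded range only, so a round in which the
predictor is off by `y` contributes `κ min (y², |y|)` instead of `κ y²`. If these minima sum to at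
least 41/50 of the sum of the `y²` for all parameters in the ellipsoid of radius `ξ`, then the
concave likelihood decreases outwards on the boundary; a maximizer exists, lies inside, and its
error is at most 50/41 times the noise radius over `κ` (`mle_accuracy`). Since `2 (50/41)² < 3`, the
factor `√3` in `ξ` leaves `β < ξ`.

The Huber inequality and the conditioning of `V_j` come from the randomized rounds
(`GoodExploration`). Averaging over the positions, of mean `m` and variance `v`, turns the Gram form
at `(α, b)` into the energy `v α² N + ∑ (b·x_s + α m)²`, and the true form is at least 91/100 of it.
The cross term between positions and contexts is a martingale, again handled by `self_normalized`.
The lower tail of the quadratic form of the contexts is uniform over directions because exponential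
moments are integrated over a ball, which replaces a net (`quadratic_lower_tail`).

The constant 5 in front of `d` leaves room for `d + 1` when `d ≥ 2`. For `d = 1` the generic bound
on the log-determinant is too large. After about `T / 1000` rounds, however, the context entry of
the Gram matrix is already of order `T`, so that only the position direction still grows and half of
the log-determinant is saved. -/

namespace UCR

open scoped ENNReal

/-! ### Exponential supermartingales and Ville's inequality. -/

section Supermartingale

variable {Ω : Type*}

/-- `D` has conditional expectation at most one given `G`. -/
def CondLeOne (G : MeasurableSpace Ω) [m0 : MeasurableSpace Ω] (P : Measure Ω) (D : Ω → ℝ≥0∞) : Prop :=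
  ∀ f : Ω → ℝ≥0∞, Measurable[G] f → ∫⁻ ω, f ω * D ω ∂P ≤ ∫⁻ ω, f ω ∂P

/-- Testing on sets of `G` compares the measure of density `D` with `P` after restriction to `G`; an
inequality of measures passes to integrals of nonnegative `G`-measurable functions. -/
theorem CondLeOne.of_setLIntegral_le {G : MeasurableSpace Ω} [m0 : MeasurableSpace Ω]
    {P : Measure Ω} (hG : G ≤ m0) {D : Ω → ℝ≥0∞}
    (hD : Measurable D) (h : ∀ A, MeasurableSet[G] A → ∫⁻ ω in A, D ω ∂P ≤ P A) :
    CondLeOne G P D := by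
  intro f hf
  have hle : (P.withDensity D).trim hG ≤ P.trim hG := by
    refine Measure.le_iff.2 fun A hA => ?_
    rw [trim_measurableSet_eq hG hA, trim_measurableSet_eq hG hA, withDensity_apply _ (hG _ hA)]
    exact h A hA
  have h1 : ∫⁻ ω, f ω * D ω ∂P = ∫⁻ ω, f ω ∂(P.withDensity D) := by
    rw [lintegral_withDensity_eq_lintegral_mul _ hD (hf.mono hG le_rfl)]
    simp only [Pi.mul_apply, mul_comm]
  rw [h1, ← lintegral_trim hG hf, ← lintegral_trim hG hf]
  exact lintegral_mono' hle le_rfl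

/-- Conditionally sub-Gaussian noise may be multiplied by a predictable factor. -/
theorem CondLeOne.exp_mul {G : MeasurableSpace Ω} [m0 : MeasurableSpace Ω] {P : Measure Ω}
    (hG : G ≤ m0) {η : Ω → ℝ} (hη : Measurable η)
    {v : ℝ} (h : ∀ l : ℝ, CondLeOne G P fun ω => ENNReal.ofReal (Real.exp (l * η ω - v * l ^ 2)))
    {l : Ω → ℝ} (hl : Measurable[G] l) :
    CondLeOne G P fun ω => ENNReal.ofReal (Real.exp (l ω * η ω - v * l ω ^ 2)) := by
  -- A simple predictable factor is constant on each of its fibres, which belong to `G`, so the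
  -- hypothesis applies fibre by fibre with a fixed `l`. Fatou's lemma then covers general factors.
  have key : ∀ φ : @SimpleFunc Ω G ℝ, CondLeOne G P fun ω =>
      ENNReal.ofReal (Real.exp (φ ω * η ω - v * φ ω ^ 2)) := by
    intro φ f hf
    have hs : ∀ x, MeasurableSet[G] (φ ⁻¹' {x}) := fun x => @SimpleFunc.measurableSet_fiber _ _ G φ x
    set D : ℝ → Ω → ℝ≥0∞ := fun x ω => ENNReal.ofReal (Real.exp (x * η ω - v * x ^ 2)) with hD
    have e : ∀ g : Ω → ℝ → ℝ≥0∞, ∀ ω,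
        g ω (φ ω) = ∑ x ∈ @SimpleFunc.range _ _ G φ, (φ ⁻¹' {x}).indicator (fun ω => g ω x) ω := by
      intro g ω
      rw [Finset.sum_eq_single (φ ω)]
      · simp
      · intro b _ hb
        simp [Set.indicator, Ne.symm hb]
      · intro hn
        exact absurd (@SimpleFunc.mem_range_self _ _ G φ ω) hn
    have hDm : ∀ x, Measurable (D x) := fun x => by
      simp only [hD]; fun_prop
    have hfm : Measurable f := hf.mono hG le_rfl
    calc ∫⁻ ω, f ω * ENNReal.ofReal (Real.exp (φ ω * η ω - v * φ ω ^ 2)) ∂P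
        = ∫⁻ ω, ∑ x ∈ @SimpleFunc.range _ _ G φ,
            (φ ⁻¹' {x}).indicator (fun ω => f ω * D x ω) ω ∂P := by
          refine lintegral_congr fun ω => ?_
          exact e (fun ω x => f ω * D x ω) ω
      _ = ∑ x ∈ @SimpleFunc.range _ _ G φ,
            ∫⁻ ω, (φ ⁻¹' {x}).indicator f ω * D x ω ∂P := by
          rw [lintegral_finsetSum]
          · refine Finset.sum_congr rfl fun x _ => lintegral_congr fun ω => ?_
            simp only [Set.indicator]; split_ifs <;> simp
          · intro x _
            exact (hfm.mul (hDm x)).indicator (hG _ (hs x))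
      _ ≤ ∑ x ∈ @SimpleFunc.range _ _ G φ, ∫⁻ ω, (φ ⁻¹' {x}).indicator f ω ∂P :=
          Finset.sum_le_sum fun x _ => h x _ (hf.indicator (hs x))
      _ = ∫⁻ ω, f ω ∂P := by
          rw [← lintegral_finsetSum _ fun x _ => hfm.indicator (hG _ (hs x))]
          refine lintegral_congr fun ω => ?_
          exact (e (fun ω _ => f ω) ω).symm
  have hsm : @StronglyMeasurable Ω ℝ _ G l := hl.stronglyMeasurable
  intro f hf
  have hlim : ∀ ω, Filter.Tendsto (fun n => f ω * ENNReal.ofReal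
      (Real.exp (hsm.approx n ω * η ω - v * hsm.approx n ω ^ 2))) Filter.atTop
      (nhds (f ω * ENNReal.ofReal (Real.exp (l ω * η ω - v * l ω ^ 2)))) := by
    intro ω
    have ht := hsm.tendsto_approx ω
    refine ENNReal.Tendsto.const_mul ?_ (Or.inl ?_)
    · refine ENNReal.tendsto_ofReal ?_
      exact ((Real.continuous_exp.comp (by fun_prop : Continuous fun y : ℝ => y * η ω - v * y ^ 2)).tendsto
        (l ω)).comp ht
    · exact (ENNReal.ofReal_pos.2 (Real.exp_pos _)).ne'
  calc ∫⁻ ω, f ω * ENNReal.ofReal (Real.exp (l ω * η ω - v * l ω ^ 2)) ∂P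
      = ∫⁻ ω, Filter.liminf (fun n => f ω * ENNReal.ofReal
      (Real.exp (hsm.approx n ω * η ω - v * hsm.approx n ω ^ 2))) Filter.atTop ∂P :=
        lintegral_congr fun ω => (hlim ω).liminf_eq.symm
    _ ≤ Filter.liminf (fun n => ∫⁻ ω, f ω * ENNReal.ofReal
      (Real.exp (hsm.approx n ω * η ω - v * hsm.approx n ω ^ 2)) ∂P) Filter.atTop := by
        refine lintegral_liminf_le fun n => ?_
        have h1 : Measurable (hsm.approx n) :=
          (@SimpleFunc.measurable _ _ G _ (hsm.approx n)).mono hG le_rfl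
        have := hf.mono hG le_rfl
        fun_prop
    _ ≤ ∫⁻ ω, f ω ∂P := by
        refine Filter.liminf_le_of_le (by isBoundedDefault) fun b hb => ?_
        obtain ⟨n, hn⟩ := hb.exists
        exact hn.trans (key (hsm.approx n) f hf)

/-- Ville's maximal inequality for nonnegative supermartingales indexed by `1, …, N + 1`. -/
theorem ville [m0 : MeasurableSpace Ω] {P : Measure Ω} {G : ℕ → MeasurableSpace Ω} {N : ℕ}
    (hG : ∀ t ∈ Finset.Icc 1 (N + 1), G t ≤ m0)
    (hmono : ∀ s t, s ≤ t → G s ≤ G t) {M : ℕ → Ω → ℝ≥0∞}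
    (hM : ∀ t ∈ Finset.Icc 1 (N + 1), Measurable[G t] (M t))
    (hstep : ∀ t ∈ Finset.Icc 1 N, ∀ A, MeasurableSet[G t] A →
      ∫⁻ ω in A, M (t + 1) ω ∂P ≤ ∫⁻ ω in A, M t ω ∂P) (c : ℝ≥0∞) :
    c * P {ω | ∃ t ∈ Finset.Icc 1 (N + 1), c ≤ M t ω} ≤ ∫⁻ ω, M 1 ω ∂P := by
  set A : ℕ → Set Ω := fun t => {ω | ∃ r ∈ Finset.Icc 1 t, c ≤ M r ω} with hA
  have hAeq : ∀ t, A t = ⋃ r ∈ Finset.Icc 1 t, {ω | c ≤ M r ω} := by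
    intro t; ext ω; simp [hA]
  have hAm : ∀ t ∈ Finset.Icc 1 (N + 1), MeasurableSet[G t] (A t) := by
    intro t ht
    rw [hAeq]
    refine @Finset.measurableSet_biUnion _ _ (G t) _ _ fun r hr => ?_
    simp only [Finset.mem_Icc] at hr ht
    refine hmono r t hr.2 _ ?_
    exact hM r (by simp; omega) measurableSet_Ici
  -- Induction on the value of the process stopped on reaching `c`: the stopped part is worth at
  -- least `c`, and the part not yet stopped can only lose mass.
  have main : ∀ t, t ≤ N →
      c * P (A (t + 1)) + ∫⁻ ω in (A (t + 1))ᶜ, M (t + 1) ω ∂P ≤ ∫⁻ ω, M 1 ω ∂P := by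
    have hsplit : ∀ t, ∀ B : Set Ω, B ⊆ {ω | c ≤ M t ω} → MeasurableSet B →
        c * P B ≤ ∫⁻ ω in B, M t ω ∂P := by
      intro t B hB hBm
      calc c * P B = ∫⁻ _ in B, c ∂P := by simp
        _ ≤ _ := setLIntegral_mono' hBm fun ω hω => hB hω
    intro t
    induction t with
    | zero =>
      intro _
      have h1 : MeasurableSet (A 1) := hG 1 (by simp) _ (hAm 1 (by simp))
      refine le_trans (add_le_add ?_ le_rfl) (lintegral_add_compl (M 1) h1).le
      refine hsplit 1 _ ?_ h1
      rintro ω ⟨r, hr, h⟩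
      simp only [Nat.zero_add, Finset.mem_Icc] at hr
      have : r = 1 := by omega
      exact this ▸ h
    | succ t ih =>
      intro ht
      have ih := ih (by omega)
      have hm1 : MeasurableSet[G (t + 1)] (A (t + 1)) := hAm (t + 1) (by simp; omega)
      have hm1' : MeasurableSet (A (t + 1)) := hG (t + 1) (by simp; omega) _ hm1
      have hm2 : MeasurableSet (A (t + 1 + 1)) :=
        hG (t + 1 + 1) (by simp; omega) _ (hAm (t + 1 + 1) (by simp; omega))
      have hsub : A (t + 1) ⊆ A (t + 1 + 1) := by
        rintro ω ⟨r, hr, h⟩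
        exact ⟨r, by simp only [Finset.mem_Icc] at hr ⊢; omega, h⟩
      have hB : A (t + 1 + 1) \ A (t + 1) ⊆ {ω | c ≤ M (t + 1 + 1) ω} := by
        rintro ω ⟨⟨r, hr, h⟩, hn⟩
        rcases Nat.lt_or_ge r (t + 1 + 1) with h' | h'
        · exact absurd ⟨r, by simp only [Finset.mem_Icc] at hr ⊢; omega, h⟩ hn
        · have : r = t + 1 + 1 := by simp only [Finset.mem_Icc] at hr; omega
          exact this ▸ h
      have e1 : P (A (t + 1 + 1)) = P (A (t + 1)) + P (A (t + 1 + 1) \ A (t + 1)) := by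
        rw [← measure_union (Set.disjoint_sdiff_right) (hm2.diff hm1'), Set.union_sdiff_cancel hsub]
      have e2 : ∫⁻ ω in (A (t + 1))ᶜ, M (t + 1 + 1) ω ∂P =
          ∫⁻ ω in (A (t + 1 + 1) \ A (t + 1)), M (t + 1 + 1) ω ∂P +
            ∫⁻ ω in (A (t + 1 + 1))ᶜ, M (t + 1 + 1) ω ∂P := by
        rw [← lintegral_union hm2.compl]
        · congr 2
          ext ω
          refine ⟨fun h2 => ?_, ?_⟩
          · by_cases h1 : ω ∈ A (t + 1 + 1)
            exacts [Or.inl ⟨h1, h2⟩, Or.inr h1]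
          · rintro (h | h)
            exacts [h.2, fun h' => h (hsub h')]
        · exact Set.disjoint_left.2 fun ω h1 h2 => h2 h1.1
      calc c * P (A (t + 1 + 1)) + ∫⁻ ω in (A (t + 1 + 1))ᶜ, M (t + 1 + 1) ω ∂P
          = c * P (A (t + 1)) + (c * P (A (t + 1 + 1) \ A (t + 1)) +
            ∫⁻ ω in (A (t + 1 + 1))ᶜ, M (t + 1 + 1) ω ∂P) := by
            rw [e1, mul_add, add_assoc]
        _ ≤ c * P (A (t + 1)) + ∫⁻ ω in (A (t + 1))ᶜ, M (t + 1 + 1) ω ∂P := by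
            rw [e2]
            refine add_le_add le_rfl (add_le_add ?_ le_rfl)
            exact hsplit (t + 1 + 1) _ hB
              (hm2.diff hm1')
        _ ≤ c * P (A (t + 1)) + ∫⁻ ω in (A (t + 1))ᶜ, M (t + 1) ω ∂P := by
            refine add_le_add le_rfl ?_
            exact hstep (t + 1) (by simp; omega) _ hm1.compl
        _ ≤ _ := ih
  exact le_trans le_self_add (main N le_rfl)

/-- Ville's inequality for the mixture, over a parameter `u`, of products of factors with
conditional expectation at most one. -/
theorem ville_mixture [m0 : MeasurableSpace Ω] {P : Measure Ω} [SFinite P] {E : Type*} [mE : MeasurableSpace E] {ν : Measure E} [SFinite ν]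
    {G : ℕ → MeasurableSpace Ω} {N : ℕ} (hG : ∀ t ∈ Finset.Icc 1 (N + 1), G t ≤ m0)
    (hmono : ∀ s t, s ≤ t → G s ≤ G t) {D : ℕ → E → Ω → ℝ≥0∞}
    (hD : ∀ s ∈ Finset.Icc 1 N, Measurable[mE.prod (G (s + 1))] (Function.uncurry (D s)))
    (hc : ∀ s ∈ Finset.Icc 1 N, ∀ u, CondLeOne (G s) P (D s u)) (c : ℝ≥0∞) :
    c * P {ω | ∃ t ∈ Finset.Icc 1 (N + 1), c ≤ ∫⁻ u, ∏ s ∈ Finset.Ico 1 t, D s u ω ∂ν} ≤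
      ν Set.univ * P Set.univ := by
  have hprod : ∀ t ∈ Finset.Icc 1 (N + 1), Measurable[mE.prod (G t)]
      fun p : E × Ω => ∏ s ∈ Finset.Ico 1 t, D s p.1 p.2 := by
    intro t ht
    refine @Finset.measurable_fun_prod _ _ _ _ _ _ (mE.prod (G t)) _ _ fun s hs => ?_
    simp only [Finset.mem_Icc, Finset.mem_Ico] at ht hs
    refine (hD s (by simp; omega)).mono ?_ le_rfl
    exact sup_le_sup le_rfl (MeasurableSpace.comap_mono (hmono _ _ (by omega)))
  have hprod0 : ∀ t ∈ Finset.Icc 1 (N + 1), Measurable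
      fun p : E × Ω => ∏ s ∈ Finset.Ico 1 t, D s p.1 p.2 := fun t ht =>
    (hprod t ht).mono (sup_le_sup le_rfl (MeasurableSpace.comap_mono (hG t ht))) le_rfl
  have h := ville (P := P) (N := N) hG hmono
    (M := fun t ω => ∫⁻ u, ∏ s ∈ Finset.Ico 1 t, D s u ω ∂ν) ?_ ?_ c
  · simpa using h
  · intro t ht
    exact @Measurable.lintegral_prod_left' _ _ _ (G t) _ _ _ (hprod t ht)
  · intro t ht A hA
    simp only [Finset.mem_Icc] at ht
    have ht1 : t + 1 ∈ Finset.Icc 1 (N + 1) := by simp; omega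
    have ht0 : t ∈ Finset.Icc 1 (N + 1) := by simp; omega
    -- Tonelli reduces the supermartingale property of the mixture to that of the product at each
    -- fixed `u`.
    have e : ∀ t ∈ Finset.Icc 1 (N + 1),
        ∫⁻ ω in A, ∫⁻ u, ∏ s ∈ Finset.Ico 1 t, D s u ω ∂ν ∂P =
        ∫⁻ u, ∫⁻ ω in A, ∏ s ∈ Finset.Ico 1 t, D s u ω ∂P ∂ν := by
      intro t ht
      rw [lintegral_lintegral_swap]
      exact ((hprod0 t ht).comp measurable_swap).aemeasurable
    rw [e _ ht1, e _ ht0]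
    refine lintegral_mono fun u => ?_
    have hA0 : MeasurableSet A := hG t ht0 _ hA
    rw [← lintegral_indicator hA0, ← lintegral_indicator hA0]
    have hmeas : Measurable[G t] fun ω => ∏ s ∈ Finset.Ico 1 t, D s u ω :=
      (hprod t ht0).comp (@measurable_prodMk_left _ _ _ (G t) u)
    have := hc t (by simp; omega) u (A.indicator fun ω => ∏ s ∈ Finset.Ico 1 t, D s u ω)
      (hmeas.indicator hA)
    refine le_trans (le_of_eq (lintegral_congr fun ω => ?_)) this
    simp only [Set.indicator]
    split_ifs
    · rw [Finset.prod_Ico_succ_top (by omega)]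
    · simp

end Supermartingale

end UCR

namespace UCR

open scoped ENNReal

/-! ### Quadratic forms and determinants of positive definite matrices. -/

section MatrixFacts

open Matrix

variable {n : ℕ}

/-- Cauchy–Schwarz for the form `W`: the nonnegative quadratic polynomial `x ↦ (a + x b)ᵀ W (a + x
b)` has nonpositive discriminant. -/
theorem posSemidef_mul_le {W : Matrix (Fin n) (Fin n) ℝ} (hW : W.PosSemidef) (a b : Fin n → ℝ) :
    (a ⬝ᵥ W *ᵥ b) ^ 2 ≤ (a ⬝ᵥ W *ᵥ a) * (b ⬝ᵥ W *ᵥ b) := by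
  have hsymm : b ⬝ᵥ W *ᵥ a = a ⬝ᵥ W *ᵥ b := by
    rw [dotProduct_mulVec, ← mulVec_transpose, dotProduct_comm]
    have := hW.isHermitian.eq
    rw [conjTranspose_eq_transpose_of_trivial] at this
    rw [this]
  have h : ∀ x : ℝ, 0 ≤ (b ⬝ᵥ W *ᵥ b) * (x * x) + 2 * (a ⬝ᵥ W *ᵥ b) * x + a ⬝ᵥ W *ᵥ a := by
    intro x
    have := hW.dotProduct_mulVec_nonneg (a + x • b)
    simp only [star_trivial, mulVec_add, add_dotProduct, dotProduct_add, mulVec_smul,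
      dotProduct_smul, smul_dotProduct, smul_eq_mul, hsymm] at this
    linarith
  have := discrim_le_zero h
  rw [discrim] at this
  nlinarith

theorem dotProduct_sq_le_of_posDef {W : Matrix (Fin n) (Fin n) ℝ} (hW : W.PosDef)
    (a b : Fin n → ℝ) : (a ⬝ᵥ b) ^ 2 ≤ (a ⬝ᵥ W *ᵥ a) * (b ⬝ᵥ W⁻¹ *ᵥ b) := by
  have h := posSemidef_mul_le hW.posSemidef a (W⁻¹ *ᵥ b)
  have hu : IsUnit W.det := hW.isUnit.map detMonoidHom
  rw [mulVec_mulVec, mul_nonsing_inv _ hu, one_mulVec] at h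
  rwa [dotProduct_comm (W⁻¹ *ᵥ b) b] at h

/-- The arithmetic–geometric mean inequality for the eigenvalues, as Jensen's inequality for the
logarithm. -/
theorem log_det_le_of_posDef (hn : 0 < n) {W : Matrix (Fin n) (Fin n) ℝ} (hW : W.PosDef) :
    Real.log W.det ≤ n * Real.log (W.trace / n) := by
  have hdet := hW.isHermitian.det_eq_prod_eigenvalues
  have htr := hW.isHermitian.trace_eq_sum_eigenvalues
  simp only [RCLike.ofReal_real_eq_id, id_eq] at hdet htr
  have hpos := hW.eigenvalues_pos
  have hn' : (0 : ℝ) < n := by exact_mod_cast hn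
  rw [hdet, Real.log_prod fun i _ => (hpos i).ne']
  have hc := strictConcaveOn_log_Ioi.concaveOn.le_map_sum (t := Finset.univ)
    (w := fun _ : Fin n => (1 / n : ℝ)) (p := hW.isHermitian.eigenvalues)
    (fun _ _ => by positivity) (by simp [hn'.ne']) (fun i _ => hpos i)
  simp only [smul_eq_mul, ← Finset.mul_sum] at hc
  rw [← htr] at hc
  calc _ = n * (1 / n * ∑ i, Real.log (hW.isHermitian.eigenvalues i)) := by field_simp
    _ ≤ n * Real.log (1 / n * W.trace) := by gcongr
    _ = _ := by ring_nf

theorem le_log_det_of_le {W : Matrix (Fin n) (Fin n) ℝ} (hW : W.PosDef) {r : ℝ} (hr : 0 < r)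
    (h : ∀ a : Fin n → ℝ, r * (a ⬝ᵥ a) ≤ a ⬝ᵥ W *ᵥ a) : n * Real.log r ≤ Real.log W.det := by
  have hdet := hW.isHermitian.det_eq_prod_eigenvalues
  simp only [RCLike.ofReal_real_eq_id, id_eq] at hdet
  have hpos := hW.eigenvalues_pos
  rw [hdet, Real.log_prod fun i _ => (hpos i).ne']
  have : ∀ i ∈ Finset.univ, Real.log r ≤ Real.log (hW.isHermitian.eigenvalues i) := by
    intro i _
    refine Real.log_le_log hr ?_
    set v := hW.isHermitian.eigenvectorBasis i
    have h1 := h v.ofLp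
    have h2 := hW.isHermitian.mulVec_eigenvectorBasis i
    have h3 : v.ofLp ⬝ᵥ v.ofLp = 1 := by
      have := hW.isHermitian.eigenvectorBasis.norm_eq_one i
      have h4 : ‖v‖ ^ 2 = 1 := by rw [this]; norm_num
      rw [EuclideanSpace.real_norm_sq_eq] at h4
      simpa [dotProduct, sq] using h4
    rw [h2, dotProduct_smul, h3] at h1
    simpa using h1
  simpa using Finset.card_nsmul_le_sum _ _ _ this

/-- The matrix determinant lemma. It makes the squared width of a new feature visible as a growth
factor of the determinant. -/
theorem det_add_vecMulVec {W : Matrix (Fin n) (Fin n) ℝ} (hW : W.PosDef) (z : Fin n → ℝ) :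
    (W + vecMulVec z z).det = W.det * (1 + z ⬝ᵥ W⁻¹ *ᵥ z) := by
  have hu : IsUnit W.det := hW.isUnit.map detMonoidHom
  have := det_add_replicateCol_mul_replicateRow (ι := Unit) hu z z
  rw [← vecMulVec_eq] at this
  rw [this, det_unique (n := Unit), Matrix.mul_assoc, ← replicateCol_mulVec]
  simp [Matrix.mul_apply, dotProduct]

end MatrixFacts

/-! ### Gaussian integrals. -/

section GaussianMixture

open Matrix

variable {n : ℕ}

/-- The total mass of the standard Gaussian density without normalization. -/
noncomputable def gaussMass (n : ℕ) : ℝ≥0∞ := ∫⁻ u : Fin n → ℝ, ENNReal.ofReal (Real.exp (-(u ⬝ᵥ u) / 2))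

/-- The value of this mass is never needed: it appears both in the mixture and in its total mass and
cancels, provided that it is neither zero nor infinite. -/
theorem gaussMass_ne_zero : gaussMass n ≠ 0 := by
  rw [gaussMass, ← pos_iff_ne_zero, lintegral_pos_iff_support (by fun_prop)]
  have : (Function.support fun u : Fin n → ℝ => ENNReal.ofReal (Real.exp (-(u ⬝ᵥ u) / 2))) =
      Set.univ := by
    ext u; simp [Real.exp_pos]
  rw [this]
  exact isOpen_univ.measure_pos _ Set.univ_nonempty

theorem gaussMass_ne_top : gaussMass n ≠ ∞ := by
  have h : Integrable fun u : Fin n → ℝ => ∏ i, Real.exp (-(1 / 2) * u i ^ 2) :=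
    Integrable.fintype_prod fun _ => integrable_exp_neg_mul_sq (by norm_num)
  have h2 := h.lintegral_lt_top
  refine ne_of_lt (lt_of_le_of_lt (le_of_eq ?_) h2)
  refine lintegral_congr fun u => ?_
  rw [← Real.exp_sum]
  congr 2
  simp only [dotProduct, ← Finset.mul_sum, sq]
  ring

theorem lintegral_exp_neg_mulVec {B : Matrix (Fin n) (Fin n) ℝ} (hB : B.det ≠ 0)
    (m : Fin n → ℝ) :
    ∫⁻ u : Fin n → ℝ, ENNReal.ofReal (Real.exp (-(B *ᵥ (u - m) ⬝ᵥ B *ᵥ (u - m)) / 2)) =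
      ENNReal.ofReal |B.det|⁻¹ * gaussMass n := by
  rw [lintegral_sub_right_eq_self (μ := volume)
    (fun u : Fin n → ℝ => ENNReal.ofReal (Real.exp (-(B *ᵥ u ⬝ᵥ B *ᵥ u) / 2))) m]
  have h := Real.map_matrix_volume_pi_eq_smul_volume_pi hB
  have h2 : ∫⁻ u : Fin n → ℝ, ENNReal.ofReal (Real.exp (-(B *ᵥ u ⬝ᵥ B *ᵥ u) / 2)) =
      ∫⁻ u, ENNReal.ofReal (Real.exp (-(u ⬝ᵥ u) / 2)) ∂(Measure.map (toLin' B) volume) := by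
    rw [lintegral_map (by fun_prop)]
    · simp
    · exact (LinearMap.continuous_of_finiteDimensional _).measurable
  rw [h2, h, lintegral_smul_measure, gaussMass, abs_inv, smul_eq_mul]

open scoped MatrixOrder in
theorem exists_transpose_mul_self {W : Matrix (Fin n) (Fin n) ℝ} (hW : W.PosSemidef) :
    ∃ B : Matrix (Fin n) (Fin n) ℝ, W = Bᵀ * B := by
  obtain ⟨X, hX, -, h⟩ := CFC.exists_sqrt_of_isSelfAdjoint_of_quasispectrumRestricts hW.isHermitian
    (QuasispectrumRestricts.nnreal_of_nonneg hW.nonneg)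
  refine ⟨X, ?_⟩
  have h2 : Xᵀ = X := by
    have := hX.star_eq
    rwa [star_eq_conjTranspose, conjTranspose_eq_transpose_of_trivial] at this
  rw [h2, h]

/-- Complete the square around `m = W⁻¹ S`, factor `W = Bᵀ B` and substitute `B (u - m)`; the
Jacobian is `|det B| = √(det W)`. -/
theorem lintegral_exp_quadratic {W : Matrix (Fin n) (Fin n) ℝ} (hW : W.PosDef) (S : Fin n → ℝ) :
    ∫⁻ u : Fin n → ℝ, ENNReal.ofReal (Real.exp (u ⬝ᵥ S - u ⬝ᵥ W *ᵥ u / 2)) =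
      ENNReal.ofReal (Real.exp (S ⬝ᵥ W⁻¹ *ᵥ S / 2) / √W.det) * gaussMass n := by
  obtain ⟨B, hB⟩ := exists_transpose_mul_self hW.posSemidef
  have hdet : W.det = B.det ^ 2 := by rw [hB, det_mul, det_transpose, sq]
  have hB0 : B.det ≠ 0 := by
    intro h
    have := hW.det_pos
    rw [hdet, h] at this
    norm_num at this
  have hu : IsUnit W.det := hW.isUnit.map detMonoidHom
  have hsymm : Wᵀ = W := by
    have := hW.isHermitian.eq
    rwa [conjTranspose_eq_transpose_of_trivial] at this
  set m := W⁻¹ *ᵥ S with hm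
  have hWm : W *ᵥ m = S := by rw [hm, mulVec_mulVec, mul_nonsing_inv _ hu, one_mulVec]
  have hBB : ∀ x : Fin n → ℝ, B *ᵥ x ⬝ᵥ B *ᵥ x = x ⬝ᵥ W *ᵥ x := by
    intro x
    rw [hB, ← mulVec_mulVec, dotProduct_mulVec x, vecMul_transpose]
  have hexp : ∀ u : Fin n → ℝ, ENNReal.ofReal (Real.exp (u ⬝ᵥ S - u ⬝ᵥ W *ᵥ u / 2)) =
      ENNReal.ofReal (Real.exp (S ⬝ᵥ m / 2)) *
        ENNReal.ofReal (Real.exp (-(B *ᵥ (u - m) ⬝ᵥ B *ᵥ (u - m)) / 2)) := by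
    intro u
    rw [← ENNReal.ofReal_mul (Real.exp_pos _).le, ← Real.exp_add, hBB]
    congr 2
    have h1 : m ⬝ᵥ W *ᵥ u = u ⬝ᵥ S := by
      rw [dotProduct_mulVec, ← mulVec_transpose, hsymm, hWm, dotProduct_comm]
    simp only [mulVec_sub, dotProduct_sub, sub_dotProduct, h1, hWm]
    rw [dotProduct_comm S m]
    ring
  simp_rw [hexp]
  rw [lintegral_const_mul _ (by fun_prop), lintegral_exp_neg_mulVec hB0, ← mul_assoc,
    ← ENNReal.ofReal_mul (Real.exp_pos _).le, hdet, Real.sqrt_sq_eq_abs,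
    ← div_eq_mul_inv (Real.exp (S ⬝ᵥ m / 2))]

end GaussianMixture

/-! ### Self-normalized concentration by the method of mixtures. -/

section SelfNormalized

open Matrix

variable {n : ℕ} {Ω : Type*}

theorem measurable_exp_factor [MeasurableSpace Ω] {Φ : Ω → Fin n → ℝ} {η : Ω → ℝ}
    (hΦ : Measurable Φ) (hη : Measurable η) (v : ℝ) :
    Measurable (Function.uncurry fun (u : Fin n → ℝ) (ω : Ω) =>
      ENNReal.ofReal (Real.exp ((u ⬝ᵥ Φ ω) * η ω - v * (u ⬝ᵥ Φ ω) ^ 2))) := by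
  simp only [dotProduct, Function.uncurry_def]
  fun_prop

/-- Regularized Gram matrix of finitely many vectors. -/
def regGram (lam : ℝ) (I : Finset ℕ) (Φ : ℕ → Fin n → ℝ) : Matrix (Fin n) (Fin n) ℝ :=
  lam • (1 : Matrix (Fin n) (Fin n) ℝ) + ∑ s ∈ I, vecMulVec (Φ s) (Φ s)

theorem regGram_form (lam : ℝ) (I : Finset ℕ) (Φ : ℕ → Fin n → ℝ) (a : Fin n → ℝ) :
    a ⬝ᵥ regGram lam I Φ *ᵥ a = lam * (a ⬝ᵥ a) + ∑ s ∈ I, (a ⬝ᵥ Φ s) ^ 2 := by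
  rw [regGram, add_mulVec, dotProduct_add, smul_mulVec, one_mulVec, dotProduct_smul, smul_eq_mul,
    sum_mulVec, dotProduct_sum]
  congr 1
  refine Finset.sum_congr rfl fun s _ => ?_
  rw [vecMulVec_mulVec, dotProduct_smul]
  simp [dotProduct_comm (Φ s) a, sq]

theorem regGram_isHermitian (lam : ℝ) (I : Finset ℕ) (Φ : ℕ → Fin n → ℝ) :
    (regGram lam I Φ).IsHermitian := by
  rw [IsHermitian, conjTranspose_eq_transpose_of_trivial, regGram]
  simp [transpose_add, transpose_sum, transpose_vecMulVec]

theorem regGram_posDef {lam : ℝ} {I : Finset ℕ} {Φ : ℕ → Fin n → ℝ}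
    (h : ∀ a : Fin n → ℝ, a ≠ 0 → 0 < lam * (a ⬝ᵥ a) + ∑ s ∈ I, (a ⬝ᵥ Φ s) ^ 2) :
    (regGram lam I Φ).PosDef := by
  refine PosDef.of_dotProduct_mulVec_pos (regGram_isHermitian _ _ _) fun a ha => ?_
  rw [star_trivial, regGram_form]
  exact h a ha

theorem dotProduct_self_pos' {a : Fin n → ℝ} (ha : a ≠ 0) : 0 < a ⬝ᵥ a :=
  lt_of_le_of_ne (by simpa [dotProduct] using Finset.sum_nonneg fun i _ => mul_self_nonneg (a i))
    fun h => ha (dotProduct_self_eq_zero.1 h.symm)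

theorem regGram_trace (lam : ℝ) (I : Finset ℕ) (Φ : ℕ → Fin n → ℝ) :
    (regGram lam I Φ).trace = lam * n + ∑ s ∈ I, Φ s ⬝ᵥ Φ s := by
  simp [regGram, trace_add, trace_sum, trace_vecMulVec]

/-- Self-normalized concentration, uniformly in time, of the martingale `∑ η_s Φ_s`. -/
theorem self_normalized [m0 : MeasurableSpace Ω] {P : Measure Ω} [IsProbabilityMeasure P]
    (hn : 0 < n) {G : ℕ → MeasurableSpace Ω} {N : ℕ}
    (hG : ∀ t ∈ Finset.Icc 1 (N + 1), G t ≤ m0) (hmono : ∀ s t, s ≤ t → G s ≤ G t)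
    {Φ : ℕ → Ω → Fin n → ℝ} {η : ℕ → Ω → ℝ} {σ lam δ : ℝ} (hσ : 0 < σ) (hlam : 0 < lam)
    (hδ : 0 < δ) (hΦ : ∀ s ∈ Finset.Icc 1 N, Measurable[G s] (Φ s))
    (hη : ∀ s ∈ Finset.Icc 1 N, Measurable[G (s + 1)] (η s))
    (hsub : ∀ s ∈ Finset.Icc 1 N, ∀ l : ℝ, CondLeOne (G s) P
      fun ω => ENNReal.ofReal (Real.exp (l * η s ω - σ ^ 2 / 2 * l ^ 2)))
    (hbd : ∀ s ∈ Finset.Icc 1 N, ∀ᵐ ω ∂P, Φ s ω ⬝ᵥ Φ s ω ≤ 1) :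
    P {ω | ¬ ∀ t ∈ Finset.Icc 1 (N + 1), ∀ a : Fin n → ℝ,
        (∑ s ∈ Finset.Ico 1 t, (a ⬝ᵥ Φ s ω) * η s ω) ^ 2 ≤
          σ ^ 2 * (∑ s ∈ Finset.Ico 1 t, (a ⬝ᵥ Φ s ω) ^ 2 + lam * (a ⬝ᵥ a)) *
            (n * Real.log (1 + N / (n * lam)) + 2 * Real.log (1 / δ))} ≤ ENNReal.ofReal δ := by
  have hn' : (0 : ℝ) < n := by exact_mod_cast hn
  set D : ℕ → (Fin n → ℝ) → Ω → ℝ≥0∞ := fun s u ω =>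
    ENNReal.ofReal (Real.exp ((u ⬝ᵥ Φ s ω) * η s ω - σ ^ 2 / 2 * (u ⬝ᵥ Φ s ω) ^ 2)) with hD
  -- Unnormalized Gaussian prior of precision `σ² lam`. With it the exponent of the mixture is `u·S
  -- - uᵀ W u / 2`, where `W` is `σ²` times the regularized Gram matrix.
  set ρ : (Fin n → ℝ) → ℝ≥0∞ := fun u => ENNReal.ofReal (Real.exp (-(σ ^ 2 * lam / 2 * (u ⬝ᵥ u))))
    with hρ
  have hρm : Measurable ρ := by
    simp only [hρ, dotProduct]; fun_prop
  set ν : Measure (Fin n → ℝ) := volume.withDensity ρ with hν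
  set W0 : Matrix (Fin n) (Fin n) ℝ := (σ ^ 2 * lam) • (1 : Matrix (Fin n) (Fin n) ℝ) with hW0
  have hW0p : W0.PosDef := PosDef.one.smul (by positivity)
  have hW0d : W0.det = (σ ^ 2 * lam) ^ n := by simp [hW0]
  have hνu : ν Set.univ = ENNReal.ofReal (1 / √W0.det) * gaussMass n := by
    have := lintegral_exp_quadratic hW0p 0
    rw [hν, withDensity_apply _ MeasurableSet.univ, Measure.restrict_univ]
    simp only [mulVec_zero, dotProduct_zero, zero_div, Real.exp_zero] at this
    rw [← this]
    refine lintegral_congr fun u => ?_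
    simp only [hρ, hW0, smul_mulVec, one_mulVec, dotProduct_smul, smul_eq_mul]
    congr 2; ring
  have hvpos : 0 < σ ^ 2 * lam := by positivity
  have hdetpos : 0 < √W0.det := Real.sqrt_pos.2 (by rw [hW0d]; positivity)
  have hν0 : ν Set.univ ≠ 0 := by
    rw [hνu]
    exact mul_ne_zero (ENNReal.ofReal_pos.2 (by positivity)).ne' gaussMass_ne_zero
  have hνt : ν Set.univ ≠ ∞ := by
    rw [hνu]
    exact ENNReal.mul_ne_top ENNReal.ofReal_ne_top gaussMass_ne_top
  -- Ville's inequality at this level gives probability `δ` exactly, whatever the total mass of the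
  -- prior.
  set c : ℝ≥0∞ := ν Set.univ / ENNReal.ofReal δ with hc
  have hδ' : ENNReal.ofReal δ ≠ 0 := (ENNReal.ofReal_pos.2 hδ).ne'
  have hville := ville_mixture (P := P) (ν := ν) hG hmono (D := D) (N := N)
    (fun s hs => @measurable_exp_factor _ _ (G (s + 1)) _ _
      ((hΦ s hs).mono (hmono _ _ (Nat.le_succ s)) le_rfl) (hη s hs) _)
    (fun s hs u => by
      have hs' : s ∈ Finset.Icc 1 (N + 1) := by simp only [Finset.mem_Icc] at hs ⊢; omega
      have hs'' : s + 1 ∈ Finset.Icc 1 (N + 1) := by simp only [Finset.mem_Icc] at hs ⊢; omega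
      refine CondLeOne.exp_mul (hG s hs') ((hη s hs).mono (hG _ hs'') le_rfl) (hsub s hs) ?_
      have := hΦ s hs
      simp only [dotProduct]
      fun_prop) c
  set bad : Set Ω := {ω | ∃ t ∈ Finset.Icc 1 (N + 1),
    c ≤ ∫⁻ u, ∏ s ∈ Finset.Ico 1 t, D s u ω ∂ν} with hbad
  have hbadP : P bad ≤ ENNReal.ofReal δ := by
    rw [measure_univ (μ := P), mul_one] at hville
    have hc0 : c ≠ 0 := ENNReal.div_ne_zero.2 ⟨hν0, ENNReal.ofReal_ne_top⟩
    have hct : c ≠ ∞ := ENNReal.div_ne_top hνt hδ'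
    calc P bad = c⁻¹ * (c * P bad) := by
          rw [← mul_assoc, ENNReal.inv_mul_cancel hc0 hct, one_mul]
      _ ≤ c⁻¹ * ν Set.univ := by gcongr
      _ = ENNReal.ofReal δ := by
          rw [hc, ENNReal.inv_div (Or.inl ENNReal.ofReal_ne_top) (Or.inl hδ'), ENNReal.div_mul_cancel hν0 hνt]
  have hae : ∀ᵐ ω ∂P, ∀ s ∈ Finset.Icc 1 N, Φ s ω ⬝ᵥ Φ s ω ≤ 1 :=
    (ae_ball_iff (Finset.Icc 1 N).countable_toSet).2 hbd
  refine le_trans (measure_mono_ae ?_) hbadP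
  filter_upwards [hae] with ω hω hnot
  by_contra hgood
  refine hnot fun t ht a => ?_
  have hgood : ∫⁻ u, ∏ s ∈ Finset.Ico 1 t, D s u ω ∂ν < c := by
    by_contra hcon
    exact hgood ⟨t, ht, not_lt.1 hcon⟩
  simp only [Finset.mem_Icc] at ht
  set S : Fin n → ℝ := ∑ s ∈ Finset.Ico 1 t, η s ω • Φ s ω with hS
  have haS : ∀ a : Fin n → ℝ, a ⬝ᵥ S = ∑ s ∈ Finset.Ico 1 t, (a ⬝ᵥ Φ s ω) * η s ω := by
    intro a
    rw [hS, dotProduct_sum]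
    exact Finset.sum_congr rfl fun s _ => by rw [dotProduct_smul, smul_eq_mul, mul_comm]
  set R := regGram lam (Finset.Ico 1 t) (fun s => Φ s ω) with hR
  have hRp : R.PosDef := regGram_posDef fun a ha => by
    have := dotProduct_self_pos' ha
    have : 0 ≤ ∑ s ∈ Finset.Ico 1 t, (a ⬝ᵥ Φ s ω) ^ 2 := Finset.sum_nonneg fun _ _ => sq_nonneg _
    positivity
  set W := σ ^ 2 • R with hW
  have hWp : W.PosDef := hRp.smul (by positivity)
  have hWform : ∀ a : Fin n → ℝ, a ⬝ᵥ W *ᵥ a =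
      σ ^ 2 * (∑ s ∈ Finset.Ico 1 t, (a ⬝ᵥ Φ s ω) ^ 2 + lam * (a ⬝ᵥ a)) := by
    intro a
    rw [hW, smul_mulVec, dotProduct_smul, hR, regGram_form, smul_eq_mul]
    ring
  have hmix : ∫⁻ u, ∏ s ∈ Finset.Ico 1 t, D s u ω ∂ν =
      ENNReal.ofReal (Real.exp (S ⬝ᵥ W⁻¹ *ᵥ S / 2) / √W.det) * gaussMass n := by
    rw [← lintegral_exp_quadratic hWp S, hν, lintegral_withDensity_eq_lintegral_mul _ hρm]
    · refine lintegral_congr fun u => ?_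
      simp only [Pi.mul_apply, hρ, hD]
      rw [← ENNReal.ofReal_prod_of_nonneg fun _ _ => (Real.exp_pos _).le, ← Real.exp_sum,
        ← ENNReal.ofReal_mul (Real.exp_pos _).le, ← Real.exp_add, hWform, haS,
        Finset.sum_sub_distrib, ← Finset.mul_sum]
      congr 2; ring
    · simp only [hD, dotProduct]; fun_prop
  have hWdet : 0 < W.det := hWp.det_pos
  have hlt : Real.exp (S ⬝ᵥ W⁻¹ *ᵥ S / 2) / √W.det < 1 / √W0.det / δ := by
    rw [hmix, hc, hνu, mul_comm, mul_comm (ENNReal.ofReal (1 / √W0.det)), mul_div_assoc,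
      ← ENNReal.ofReal_div_of_pos hδ] at hgood
    have := lt_of_mul_lt_mul_left' hgood
    exact (ENNReal.ofReal_lt_ofReal_iff (by positivity)).1 this
  -- Logarithms of `hlt` give `Sᵀ W⁻¹ S < log det W - log det W0 + 2 log (1/δ)`. The trace bounds
  -- `log det W`, and the powers of `σ² lam` cancel.
  have hlog : S ⬝ᵥ W⁻¹ *ᵥ S ≤ n * Real.log (1 + N / (n * lam)) + 2 * Real.log (1 / δ) := by
    have h1 := Real.log_lt_log (by positivity) hlt
    rw [Real.log_div (Real.exp_pos _).ne' (by positivity), Real.log_exp,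
      Real.log_div (by positivity) hδ.ne', Real.log_div one_ne_zero hdetpos.ne', Real.log_one,
      Real.log_sqrt hWdet.le, Real.log_sqrt (by rw [hW0d]; positivity), hW0d, Real.log_pow] at h1
    have h2 := log_det_le_of_posDef hn hWp
    have h3 : W.trace / n ≤ (σ ^ 2 * lam) * (1 + N / (n * lam)) := by
      have : ∑ s ∈ Finset.Ico 1 t, Φ s ω ⬝ᵥ Φ s ω ≤ N := by
        calc _ ≤ ∑ s ∈ Finset.Ico 1 t, (1 : ℝ) := Finset.sum_le_sum fun s hs => hω s (by
              simp only [Finset.mem_Icc, Finset.mem_Ico] at hs ⊢; omega)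
          _ = ((t - 1 : ℕ) : ℝ) := by simp
          _ ≤ N := by exact_mod_cast (by omega : t - 1 ≤ N)
      rw [hW, trace_smul, hR, regGram_trace, smul_eq_mul, div_le_iff₀ hn']
      have e : σ ^ 2 * lam * (1 + N / (n * lam)) * n = σ ^ 2 * (lam * n + N) := by
        field_simp
      rw [e]
      gcongr
    have htr : 0 < W.trace / n := by
      have : Nonempty (Fin n) := ⟨⟨0, hn⟩⟩
      exact div_pos hWp.trace_pos hn'
    have h4 := Real.log_le_log htr h3
    rw [Real.log_mul hvpos.ne' (by positivity)] at h4
    have h5 : (n : ℝ) * Real.log (W.trace / n) ≤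
      n * (Real.log (σ ^ 2 * lam) + Real.log (1 + N / (n * lam))) := by gcongr
    rw [Real.log_div one_ne_zero hδ.ne', Real.log_one]
    linarith
  have hcs := dotProduct_sq_le_of_posDef hWp a S
  rw [hWform, haS] at hcs
  refine hcs.trans ?_
  have : 0 ≤ a ⬝ᵥ a := by simpa [dotProduct] using Finset.sum_nonneg fun i _ => mul_self_nonneg (a i)
  have : 0 ≤ ∑ s ∈ Finset.Ico 1 t, (a ⬝ᵥ Φ s ω) ^ 2 := Finset.sum_nonneg fun _ _ => sq_nonneg _
  gcongr

end SelfNormalized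

end UCR

namespace UCR

open scoped ENNReal

/-! ### Tail bounds from conditional exponential moments. -/

section Tails

variable {Ω : Type*}

theorem CondLeOne.of_indep {G m' : MeasurableSpace Ω} [m0 : MeasurableSpace Ω] {P : Measure Ω}
    (hG : G ≤ m0) (hm' : m' ≤ m0) (h : Indep G m' P) {D : Ω → ℝ≥0∞} (hD : Measurable[m'] D)
    (h1 : ∫⁻ ω, D ω ∂P ≤ 1) : CondLeOne G P D := by
  intro f hf
  rw [lintegral_mul_eq_lintegral_mul_lintegral_of_independent_measurableSpace hG hm' h hf hD]
  exact mul_le_of_le_one_right' h1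

/-- Exponential Markov inequality for sums of increments with conditional exponential moments at
most one. -/
theorem exp_tail [m0 : MeasurableSpace Ω] {P : Measure Ω} [IsProbabilityMeasure P]
    {G : ℕ → MeasurableSpace Ω} {N : ℕ} (hG : ∀ t ∈ Finset.Icc 1 (N + 1), G t ≤ m0)
    (hmono : ∀ s t, s ≤ t → G s ≤ G t) {ψ : ℕ → Ω → ℝ}
    (hψ : ∀ s ∈ Finset.Icc 1 N, Measurable[G (s + 1)] (ψ s))
    (hc : ∀ s ∈ Finset.Icc 1 N, CondLeOne (G s) P fun ω => ENNReal.ofReal (Real.exp (ψ s ω)))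
    (x : ℝ) : P {ω | x ≤ ∑ s ∈ Finset.Ico 1 (N + 1), ψ s ω} ≤ ENNReal.ofReal (Real.exp (-x)) := by
  -- No mixing is needed here; a point mass makes the mixture a plain product, of which only the
  -- final time is used.
  have h := ville_mixture (P := P) (ν := Measure.dirac ()) hG hmono
    (D := fun s _ ω => ENNReal.ofReal (Real.exp (ψ s ω)))
    (fun s hs => by
      have h1 := hψ s hs
      have h2 : Measurable[G (s + 1)] fun ω => ENNReal.ofReal (Real.exp (ψ s ω)) :=
        ENNReal.measurable_ofReal.comp (Real.measurable_exp.comp h1)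
      exact h2.comp (@measurable_snd _ _ _ (G (s + 1))))
    (fun s hs _ => hc s hs) (ENNReal.ofReal (Real.exp x))
  simp only [measure_univ, mul_one, lintegral_dirac] at h
  have h2 : P {ω | x ≤ ∑ s ∈ Finset.Ico 1 (N + 1), ψ s ω} ≤
      P {ω | ∃ t ∈ Finset.Icc 1 (N + 1), ENNReal.ofReal (Real.exp x) ≤
        ∏ s ∈ Finset.Ico 1 t, ENNReal.ofReal (Real.exp (ψ s ω))} := by
    refine measure_mono fun ω hω => ⟨N + 1, by simp, ?_⟩
    rw [← ENNReal.ofReal_prod_of_nonneg fun _ _ => (Real.exp_pos _).le, ← Real.exp_sum]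
    exact ENNReal.ofReal_le_ofReal (Real.exp_le_exp.2 hω)
  have hx : ENNReal.ofReal (Real.exp x) ≠ 0 := (ENNReal.ofReal_pos.2 (Real.exp_pos _)).ne'
  rw [Real.exp_neg, ENNReal.ofReal_inv_of_pos (Real.exp_pos _)]
  refine h2.trans ?_
  rw [← ENNReal.div_self hx ENNReal.ofReal_ne_top] at h
  rw [← one_div]
  rw [ENNReal.le_div_iff_mul_le (Or.inl hx) (Or.inl ENNReal.ofReal_ne_top), mul_comm]
  rwa [ENNReal.div_self hx ENNReal.ofReal_ne_top] at h

theorem measurable_clipped_factor {d : ℕ} [MeasurableSpace Ω] {Φ : Ω → EuclideanSpace ℝ (Fin d)}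
    (hΦ : Measurable Φ) (R r k : ℝ) :
    Measurable (Function.uncurry fun (u : EuclideanSpace ℝ (Fin d)) (ω : Ω) =>
      if ‖u‖ ≤ R then ENNReal.ofReal (Real.exp (r * ‖u‖ ^ 2 - k * (inner ℝ u (Φ ω)) ^ 2))
        else (0 : ℝ≥0∞)) := by
  simp only [Function.uncurry_def]
  have h1 : Measurable fun p : EuclideanSpace ℝ (Fin d) × Ω => Φ p.2 := hΦ.comp measurable_snd
  have h2 : Measurable fun p : EuclideanSpace ℝ (Fin d) × Ω => inner ℝ p.1 (Φ p.2) :=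
    measurable_fst.inner h1
  have h3 : Measurable fun p : EuclideanSpace ℝ (Fin d) × Ω => ‖p.1‖ := measurable_fst.norm
  exact Measurable.ite (measurableSet_le h3 measurable_const)
    (ENNReal.measurable_ofReal.comp (Real.measurable_exp.comp
      (((h3.pow_const 2).const_mul r).sub ((h2.pow_const 2).const_mul k)))) measurable_const

/-- Lower tail of a random quadratic form, by integrating exponential moments over a ball. -/
theorem quadratic_lower_tail [m0 : MeasurableSpace Ω] {P : Measure Ω} [IsProbabilityMeasure P]
    {d N : ℕ} {G : ℕ → MeasurableSpace Ω} (hG : ∀ t ∈ Finset.Icc 1 (N + 1), G t ≤ m0)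
    (hmono : ∀ s t, s ≤ t → G s ≤ G t) {Ψ : ℕ → Ω → EuclideanSpace ℝ (Fin d)} {τ b r k Λ : ℝ}
    (hN : 0 < N) (hτ : 0 < τ) (hτ1 : τ < 1) (hb : 0 < b) (hr : 0 ≤ r) (hk : 0 ≤ k) (hΛ : 0 < Λ)
    (hΨ : ∀ s ∈ Finset.Icc 1 N, Measurable[G (s + 1)] (Ψ s))
    (hbd : ∀ s ∈ Finset.Icc 1 N, ∀ᵐ ω ∂P, ‖Ψ s ω‖ ≤ b)
    (hc : ∀ s ∈ Finset.Icc 1 N, ∀ u : EuclideanSpace ℝ (Fin d), ‖u‖ ≤ 1 + τ →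
      CondLeOne (G s) P fun ω =>
        ENNReal.ofReal (Real.exp (r * ‖u‖ ^ 2 - k * (inner ℝ u (Ψ s ω)) ^ 2))) :
    P {ω | ¬ ∀ u, Λ * ‖u‖ ^ 2 ≤ ∑ s ∈ Finset.Ico 1 (N + 1), (inner ℝ u (Ψ s ω)) ^ 2} ≤
      ENNReal.ofReal (((1 + τ) / τ) ^ d *
        Real.exp (-(N * r * (1 - τ) ^ 2 - k * (√Λ + τ * b * √N) ^ 2))) := by
  classical
  let E := EuclideanSpace ℝ (Fin d)
  -- The moment bound is only known for `‖u‖ ≤ 1 + τ`. Outside, the factor is set to zero, which has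
  -- conditional mean at most one trivially.
  set D : ℕ → E → Ω → ℝ≥0∞ := fun s u ω => if ‖u‖ ≤ 1 + τ then
    ENNReal.ofReal (Real.exp (r * ‖u‖ ^ 2 - k * (inner ℝ u (Ψ s ω)) ^ 2)) else 0 with hD
  set ν : Measure E := volume.restrict (Metric.ball 0 (1 + τ)) with hν
  have hpoly : ∀ m : MeasurableSpace Ω, ∀ Φ : Ω → E, Measurable[m] Φ →
      Measurable[Prod.instMeasurableSpace (m₂ := m)] (Function.uncurry fun (u : E) (ω : Ω) =>
        if ‖u‖ ≤ 1 + τ then ENNReal.ofReal (Real.exp (r * ‖u‖ ^ 2 - k * (inner ℝ u (Φ ω)) ^ 2))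
          else (0 : ℝ≥0∞)) := fun m Φ hΦ => measurable_clipped_factor hΦ (1 + τ) r k
  have hμ1 : volume (Metric.ball (0 : E) 1) ≠ 0 := (Metric.measure_ball_pos _ _ one_pos).ne'
  have hμ1' : volume (Metric.ball (0 : E) 1) ≠ ∞ := measure_ball_lt_top.ne
  set μ1 := volume (Metric.ball (0 : E) 1) with hμ
  set e : ℝ := N * r * (1 - τ) ^ 2 - k * (√Λ + τ * b * √N) ^ 2 with he
  have hfin : Module.finrank ℝ E = d := by simp [E]
  -- On the bad event the integrand is at least `exp e` on a ball of radius `τ`, whereas the prior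
  -- has the volume of a ball of radius `1 + τ`. The ratio of volumes `((1 + τ) / τ)^d` plays the
  -- role of a covering number.
  set c : ℝ≥0∞ := ENNReal.ofReal (Real.exp e * τ ^ d) * μ1 with hcdef
  have hc0 : c ≠ 0 := mul_ne_zero (ENNReal.ofReal_pos.2 (by positivity)).ne' hμ1
  have hct : c ≠ ∞ := ENNReal.mul_ne_top ENNReal.ofReal_ne_top hμ1'
  have hville := ville_mixture (P := P) (ν := ν) hG hmono (D := D)
    (fun s hs => hpoly (G (s + 1)) (Ψ s) (hΨ s hs))
    (fun s hs u => by
      by_cases hu : ‖u‖ ≤ 1 + τ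
      · simp only [hD, hu, if_true]
        exact hc s hs u hu
      · intro f _
        simp [hD, hu]) c
  set bad : Set Ω := {ω | ∃ t ∈ Finset.Icc 1 (N + 1),
    c ≤ ∫⁻ u, ∏ s ∈ Finset.Ico 1 t, D s u ω ∂ν} with hbad
  have hbadP : P bad ≤ ENNReal.ofReal (((1 + τ) / τ) ^ d * Real.exp (-e)) := by
    rw [measure_univ (μ := P), mul_one, hν, Measure.restrict_apply_univ,
      Measure.addHaar_ball_of_pos _ _ (by linarith), hfin] at hville
    have h1 : P bad ≤ (ENNReal.ofReal ((1 + τ) ^ d) * μ1) / c := by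
      rw [ENNReal.le_div_iff_mul_le (Or.inl hc0) (Or.inl hct), mul_comm]
      exact hville
    refine h1.trans (le_of_eq ?_)
    rw [hcdef, ENNReal.mul_div_mul_right _ _ hμ1 hμ1', ← ENNReal.ofReal_div_of_pos (by positivity)]
    congr 1
    rw [Real.exp_neg, div_pow]
    field_simp
  have hae : ∀ᵐ ω ∂P, ∀ s ∈ Finset.Icc 1 N, ‖Ψ s ω‖ ≤ b :=
    (ae_ball_iff (Finset.Icc 1 N).countable_toSet).2 hbd
  refine le_trans (measure_mono_ae ?_) hbadP
  filter_upwards [hae] with ω hω hnot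
  change ¬ ∀ u, Λ * ‖u‖ ^ 2 ≤ ∑ s ∈ Finset.Ico 1 (N + 1), (inner ℝ u (Ψ s ω)) ^ 2 at hnot
  simp only [not_forall, not_le] at hnot
  obtain ⟨w, hw⟩ := hnot
  have hw0 : w ≠ 0 := by
    rintro rfl
    simp at hw
  have hwn : 0 < ‖w‖ := norm_pos_iff.2 hw0
  set u0 : E := ‖w‖⁻¹ • w with hu0
  have hu0n : ‖u0‖ = 1 := by
    rw [hu0, norm_smul, norm_inv, norm_norm, inv_mul_cancel₀ hwn.ne']
  have hu0s : ∑ s ∈ Finset.Ico 1 (N + 1), (inner ℝ u0 (Ψ s ω)) ^ 2 ≤ Λ := by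
    have : ∀ s, (inner ℝ u0 (Ψ s ω)) ^ 2 = (‖w‖ ^ 2)⁻¹ * (inner ℝ w (Ψ s ω)) ^ 2 := by
      intro s
      rw [hu0, real_inner_smul_left, mul_pow, inv_pow]
    simp only [this, ← Finset.mul_sum]
    rw [inv_mul_le_iff₀ (by positivity)]
    linarith
  refine ⟨N + 1, by simp, ?_⟩
  have hNR : (0 : ℝ) < N := by exact_mod_cast hN
  set p := √Λ with hp
  set q := τ * b * √N with hq
  have hp0 : 0 < p := Real.sqrt_pos.2 hΛ
  have hq0 : 0 < q := by
    have := Real.sqrt_pos.2 hNR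
    positivity
  have hp2 : p ^ 2 = Λ := Real.sq_sqrt hΛ.le
  have hq2 : q ^ 2 = τ ^ 2 * b ^ 2 * N := by
    rw [hq, mul_pow, mul_pow, Real.sq_sqrt hNR.le]
  have hball : ∀ u ∈ Metric.ball u0 τ, ENNReal.ofReal (Real.exp e) ≤
      ∏ s ∈ Finset.Ico 1 (N + 1), D s u ω := by
    intro u hu
    rw [Metric.mem_ball, dist_eq_norm] at hu
    have hun : ‖u‖ ≤ 1 + τ := by
      have := norm_le_norm_add_norm_sub' u u0
      linarith
    have hun2 : 1 - τ ≤ ‖u‖ := by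
      have := norm_le_norm_add_norm_sub' u0 u
      rw [norm_sub_rev] at this
      linarith
    simp only [hD, hun, if_true]
    rw [← ENNReal.ofReal_prod_of_nonneg fun _ _ => (Real.exp_pos _).le, ← Real.exp_sum]
    refine ENNReal.ofReal_le_ofReal (Real.exp_le_exp.2 ?_)
    rw [Finset.sum_sub_distrib, Finset.sum_const, Nat.card_Ico,
      Nat.add_sub_cancel, nsmul_eq_mul]
    have h1 : ∑ s ∈ Finset.Ico 1 (N + 1), (inner ℝ u (Ψ s ω)) ^ 2 ≤ (p + q) ^ 2 := by
      -- Young's inequality with weights `q / p` and `p / q`, for which the sum is exactly `(p +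
      -- q)²`, as in Minkowski's inequality.
      have hs : ∀ s ∈ Finset.Ico 1 (N + 1), (inner ℝ u (Ψ s ω)) ^ 2 ≤
          (1 + q / p) * (inner ℝ u0 (Ψ s ω)) ^ 2 + (1 + p / q) * (τ ^ 2 * b ^ 2) := by
        intro s hs
        have hin : inner ℝ u (Ψ s ω) = inner ℝ u0 (Ψ s ω) + inner ℝ (u - u0) (Ψ s ω) := by
          rw [inner_sub_left]; ring
        have hy : (inner ℝ (u - u0) (Ψ s ω)) ^ 2 ≤ τ ^ 2 * b ^ 2 := by
          have h1 := abs_real_inner_le_norm (u - u0) (Ψ s ω)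
          have h2 : ‖u - u0‖ * ‖Ψ s ω‖ ≤ τ * b := by
            have := hω s (by simp only [Finset.mem_Icc, Finset.mem_Ico] at hs ⊢; omega)
            gcongr
          rw [← mul_pow, ← sq_abs]
          exact pow_le_pow_left₀ (abs_nonneg _) (h1.trans h2) 2
        rw [hin]
        set x := inner ℝ u0 (Ψ s ω)
        set y := inner ℝ (u - u0) (Ψ s ω)
        have : (x + y) ^ 2 ≤ (1 + q / p) * x ^ 2 + (1 + p / q) * y ^ 2 := by
          have : (1 + q / p) * x ^ 2 + (1 + p / q) * y ^ 2 - (x + y) ^ 2 =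
              (q * x - p * y) ^ 2 / (p * q) := by
            field_simp
            ring
          have h3 : 0 ≤ (q * x - p * y) ^ 2 / (p * q) := by positivity
          linarith
        have h4 : (1 + p / q) * y ^ 2 ≤ (1 + p / q) * (τ ^ 2 * b ^ 2) := by gcongr
        linarith
      calc _ ≤ ∑ s ∈ Finset.Ico 1 (N + 1), ((1 + q / p) * (inner ℝ u0 (Ψ s ω)) ^ 2 +
            (1 + p / q) * (τ ^ 2 * b ^ 2)) := Finset.sum_le_sum hs
        _ = (1 + q / p) * ∑ s ∈ Finset.Ico 1 (N + 1), (inner ℝ u0 (Ψ s ω)) ^ 2 +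
            (1 + p / q) * q ^ 2 := by
          rw [Finset.sum_add_distrib, ← Finset.mul_sum, Finset.sum_const, Nat.card_Ico,
            Nat.add_sub_cancel, nsmul_eq_mul, hq2]
          ring
        _ ≤ (1 + q / p) * p ^ 2 + (1 + p / q) * q ^ 2 := by
          rw [hp2]; gcongr
        _ = (p + q) ^ 2 := by field_simp; ring
    have h2 : (1 - τ) ^ 2 ≤ ‖u‖ ^ 2 := pow_le_pow_left₀ (by linarith) hun2 2
    have h3 : N * r * (1 - τ) ^ 2 ≤ N * r * ‖u‖ ^ 2 := by gcongr
    have h4 : k * ∑ s ∈ Finset.Ico 1 (N + 1), (inner ℝ u (Ψ s ω)) ^ 2 ≤ k * (p + q) ^ 2 := by gcongr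
    have h5 : (N : ℝ) * (r * ‖u‖ ^ 2) = N * r * ‖u‖ ^ 2 := by ring
    rw [he, h5, ← Finset.mul_sum]
    exact sub_le_sub h3 h4
  have hsub : Metric.ball u0 τ ⊆ Metric.ball 0 (1 + τ) := by
    refine Metric.ball_subset_ball' ?_
    rw [dist_zero_right, hu0n]; linarith
  calc c = ENNReal.ofReal (Real.exp e) * volume (Metric.ball u0 τ) := by
        rw [Measure.addHaar_ball_of_pos _ _ hτ, hfin, ← mul_assoc,
          ← ENNReal.ofReal_mul (Real.exp_pos _).le]
    _ = ∫⁻ _ in Metric.ball u0 τ, ENNReal.ofReal (Real.exp e) := by simp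
    _ ≤ ∫⁻ u in Metric.ball u0 τ, ∏ s ∈ Finset.Ico 1 (N + 1), D s u ω :=
        setLIntegral_mono' measurableSet_ball hball
    _ ≤ ∫⁻ u, ∏ s ∈ Finset.Ico 1 (N + 1), D s u ω ∂ν :=
        lintegral_mono' (Measure.restrict_mono hsub le_rfl) le_rfl

end Tails

end UCR

namespace UCR

/-! ### Maximum likelihood in a generalized linear model with locally bounded curvature. -/

section GLM

/-- Lengthening `θ` by one in its own direction gives an admissible `ϑ` of norm `‖θ‖ + 1`; its
products with the multiples of that direction in the unit ball fill the whole interval. -/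
theorem le_deriv_deriv_of_abs_le {n : ℕ} {A : ℝ → ℝ} {κ : ℝ} {θ : EuclideanSpace ℝ (Fin (n + 1))}
    (h : ∀ ϑ z : EuclideanSpace ℝ (Fin (n + 1)), ‖z‖ ≤ 1 → ‖ϑ - θ‖ ≤ 1 →
      κ ≤ deriv (deriv A) (inner ℝ ϑ z)) {u : ℝ} (hu : |u| ≤ ‖θ‖ + 1) :
    κ ≤ deriv (deriv A) u := by
  obtain ⟨e, he, hθ⟩ : ∃ e : EuclideanSpace ℝ (Fin (n + 1)), ‖e‖ = 1 ∧ θ = ‖θ‖ • e := by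
    by_cases h0 : θ = 0
    · obtain ⟨e, he⟩ := exists_norm_eq (EuclideanSpace ℝ (Fin (n + 1))) zero_le_one
      exact ⟨e, he, by simp [h0]⟩
    · have : ‖θ‖ ≠ 0 := norm_ne_zero_iff.2 h0
      exact ⟨‖θ‖⁻¹ • θ, by rw [norm_smul, norm_inv, norm_norm, inv_mul_cancel₀ this],
        by rw [smul_smul, mul_inv_cancel₀ this, one_smul]⟩
  have hpos : 0 < ‖θ‖ + 1 := by positivity
  have := h (θ + e) ((u / (‖θ‖ + 1)) • e)
    (by rw [norm_smul, he, mul_one, Real.norm_eq_abs, abs_div, abs_of_pos hpos]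
        exact div_le_one_of_le₀ hu hpos.le)
    (by simp [he])
  have e1 : θ + e = (‖θ‖ + 1) • e := by rw [add_smul, one_smul, ← hθ]
  rw [e1, real_inner_smul_left, real_inner_smul_right, real_inner_self_eq_norm_sq, he] at this
  have e2 : (‖θ‖ + 1) * (u / (‖θ‖ + 1) * 1 ^ 2) = u := by field_simp
  rwa [e2] at this

/-- Within distance one of `v` the slope is at least `κ`. Farther away monotonicity keeps the
increment `κ` already gained, so the growth is still linear and no curvature is required there. -/
theorem mul_min_le_of_curvature {f : ℝ → ℝ} (hf : Differentiable ℝ f) (hmono : Monotone f)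
    {κ c : ℝ} (hκ : ∀ u, |u| ≤ c + 1 → κ ≤ deriv f u) {v : ℝ} (hv : |v| ≤ c) (y : ℝ) :
    κ * min (y ^ 2) |y| ≤ (f (v + y) - f v) * y := by
  have hloc : ∀ a b, -(c + 1) ≤ a → a ≤ b → b ≤ c + 1 → κ * (b - a) ≤ f b - f a := by
    intro a b ha hab hb
    refine (convex_Icc a b).mul_sub_le_image_sub_of_le_deriv hf.continuous.continuousOn
      hf.differentiableOn (fun x hx => hκ x ?_) a (Set.left_mem_Icc.2 hab) b
      (Set.right_mem_Icc.2 hab) hab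
    have := interior_subset hx
    rw [abs_le]
    exact ⟨ha.trans this.1, this.2.trans hb⟩
  rw [abs_le] at hv
  rcases le_total 0 y with hy | hy
  · rw [abs_of_nonneg hy]
    rcases le_total y 1 with h1 | h1
    · rw [min_eq_left (by nlinarith)]
      have := hloc v (v + y) (by linarith) (by linarith) (by linarith)
      nlinarith
    · rw [min_eq_right (by nlinarith)]
      have := hloc v (v + 1) (by linarith) (by linarith) (by linarith)
      have h2 := hmono (by linarith : v + 1 ≤ v + y)
      nlinarith
  · rw [abs_of_nonpos hy]
    rcases le_total (-1) y with h1 | h1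
    · rw [min_eq_left (by nlinarith)]
      have := hloc (v + y) v (by linarith) (by linarith) (by linarith)
      nlinarith
    · rw [min_eq_right (by nlinarith)]
      have := hloc (v - 1) v (by linarith) (by linarith) (by linarith)
      have h2 := hmono (by linarith : v + y ≤ v - 1)
      nlinarith

theorem tangent_le_of_monotone_deriv {A : ℝ → ℝ} (hA : Differentiable ℝ A)
    (hmono : Monotone (deriv A)) (a b : ℝ) : A a + deriv A a * (b - a) ≤ A b := by
  rcases lt_trichotomy a b with h | h | h
  · obtain ⟨c, hc, he⟩ := exists_deriv_eq_slope A h hA.continuous.continuousOn hA.differentiableOn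
    have := hmono hc.1.le
    rw [he, le_div_iff₀ (by linarith)] at this
    linarith
  · simp [h]
  · obtain ⟨c, hc, he⟩ := exists_deriv_eq_slope A h hA.continuous.continuousOn hA.differentiableOn
    have := hmono hc.2.le
    rw [he, div_le_iff₀ (by linarith)] at this
    linarith

/-- Existence and accuracy of the maximum likelihood estimate in a generalized linear model, when
the curvature of the log-likelihood is controlled by a Huber-type lower bound. -/
theorem mle_accuracy {E : Type*} [NormedAddCommGroup E] [InnerProductSpace ℝ E]
    [FiniteDimensional ℝ E] {A : ℝ → ℝ} (hA : Differentiable ℝ A)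
    (hA' : Differentiable ℝ (deriv A)) (hmono : Monotone (deriv A)) {κ : ℝ} (hκ0 : 0 < κ)
    {θ : E} (hκ : ∀ u, |u| ≤ ‖θ‖ + 1 → κ ≤ deriv (deriv A) u) (I : Finset ℕ) (Z : ℕ → E)
    (Y : ℕ → ℝ) (hZ : ∀ s ∈ I, ‖Z s‖ ≤ 1) {lam ξ C ϱ : ℝ} (hlam : 0 < lam) (hξ : 0 < ξ)
    (hC : 0 ≤ C) (hϱ : 0 < ϱ)
    (hV : ∀ a : E, lam * ‖a‖ ^ 2 ≤ ∑ s ∈ I, (inner ℝ a (Z s)) ^ 2)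
    (hh : ∀ a : E, ∑ s ∈ I, (inner ℝ a (Z s)) ^ 2 ≤ ξ ^ 2 →
      ϱ * ∑ s ∈ I, (inner ℝ a (Z s)) ^ 2 ≤ ∑ s ∈ I, min ((inner ℝ a (Z s)) ^ 2) |inner ℝ a (Z s)|)
    (hnoise : ∀ a : E, (∑ s ∈ I, inner ℝ a (Z s) * (Y s - deriv A (inner ℝ θ (Z s)))) ^ 2 ≤
      C ^ 2 * ∑ s ∈ I, (inner ℝ a (Z s)) ^ 2) (hCξ : C < ϱ * κ * ξ) :
    (∃ ϑ, IsMaxOn (fun ϑ => ∑ s ∈ I, (Y s * inner ℝ ϑ (Z s) - A (inner ℝ ϑ (Z s)))) Set.univ ϑ) ∧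
    ∀ ϑ, IsMaxOn (fun ϑ => ∑ s ∈ I, (Y s * inner ℝ ϑ (Z s) - A (inner ℝ ϑ (Z s)))) Set.univ ϑ →
      ∑ s ∈ I, (inner ℝ (ϑ - θ) (Z s)) ^ 2 ≤ (C / (ϱ * κ)) ^ 2 := by
  set L : E → ℝ := fun ϑ => ∑ s ∈ I, (Y s * inner ℝ ϑ (Z s) - A (inner ℝ ϑ (Z s))) with hL
  set q : E → ℝ := fun a => ∑ s ∈ I, (inner ℝ a (Z s)) ^ 2 with hq
  set g : E → E → ℝ := fun ϑ a =>
    ∑ s ∈ I, (Y s - deriv A (inner ℝ ϑ (Z s))) * inner ℝ a (Z s) with hg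
  have hq0 : ∀ a, 0 ≤ q a := fun a => Finset.sum_nonneg fun _ _ => sq_nonneg _
  have hsq : ∀ a, ∑ s ∈ I, inner ℝ a (Z s) * (Y s - deriv A (inner ℝ θ (Z s))) ≤ C * √(q a) := by
    intro a
    refine le_trans (le_abs_self _) ?_
    refine abs_le_of_sq_le_sq ?_ (by positivity)
    rw [mul_pow, Real.sq_sqrt (hq0 a)]
    exact hnoise a
  -- The score at `θ + a` in the direction `a` is noise minus curvature: `hnoise` bounds the former
  -- by `C √q`, and the Huber bound `hh` makes the latter at least `ϱ κ q`.
  have hgbound : ∀ a, q a ≤ ξ ^ 2 → g (θ + a) a ≤ C * √(q a) - ϱ * κ * q a := by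
    intro a ha
    have h1 : ∀ s ∈ I, κ * min ((inner ℝ a (Z s)) ^ 2) |inner ℝ a (Z s)| ≤
        (deriv A (inner ℝ (θ + a) (Z s)) - deriv A (inner ℝ θ (Z s))) * inner ℝ a (Z s) := by
      intro s hs
      rw [inner_add_left]
      refine mul_min_le_of_curvature hA' hmono (c := ‖θ‖) hκ ?_ _
      refine (abs_real_inner_le_norm _ _).trans ?_
      exact mul_le_of_le_one_right (norm_nonneg _) (hZ s hs)
    have h2 := Finset.sum_le_sum h1
    rw [← Finset.mul_sum] at h2
    have h3 := hh a ha
    have h4 : κ * (ϱ * q a) ≤ κ * ∑ s ∈ I, min ((inner ℝ a (Z s)) ^ 2) |inner ℝ a (Z s)| := by gcongr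
    have h5 : g (θ + a) a = ∑ s ∈ I, inner ℝ a (Z s) * (Y s - deriv A (inner ℝ θ (Z s))) -
        ∑ s ∈ I, (deriv A (inner ℝ (θ + a) (Z s)) - deriv A (inner ℝ θ (Z s))) * inner ℝ a (Z s) := by
      rw [hg, ← Finset.sum_sub_distrib]
      exact Finset.sum_congr rfl fun s _ => by ring
    have h6 := hsq a
    linarith
  have hconc : ∀ ϑ ϑ', L ϑ' ≤ L ϑ + g ϑ (ϑ' - ϑ) := by
    intro ϑ ϑ'
    simp only [hL, hg]
    rw [← Finset.sum_add_distrib]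
    refine Finset.sum_le_sum fun s _ => ?_
    have := tangent_le_of_monotone_deriv hA hmono (inner ℝ ϑ (Z s)) (inner ℝ ϑ' (Z s))
    rw [inner_sub_left]
    linarith
  have hqsmul : ∀ (c : ℝ) a, q (c • a) = c ^ 2 * q a := by
    intro c a
    simp only [hq, real_inner_smul_left, mul_pow, ← Finset.mul_sum]
  -- Shrink `a` to the boundary `q = ξ²`. There the outward score is at most `ξ (C - ϱ κ ξ) < 0`, so
  -- by concavity the likelihood is smaller at every point beyond.
  have hout : ∀ a, ξ ^ 2 < q a → ∃ b, q b = ξ ^ 2 ∧ L (θ + a) < L (θ + b) := by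
    intro a ha
    have hqa : 0 < q a := lt_of_le_of_lt (sq_nonneg _) ha
    have hr : 0 < √(q a) := Real.sqrt_pos.2 hqa
    have hξr : ξ < √(q a) := Real.lt_sqrt_of_sq_lt ha
    set c := ξ / √(q a) with hc
    have hc0 : 0 < c := by positivity
    have hc1 : c < 1 := (div_lt_one hr).2 hξr
    have hqb : q (c • a) = ξ ^ 2 := by
      rw [hqsmul, hc, div_pow, Real.sq_sqrt hqa.le]
      field_simp
    refine ⟨c • a, hqb, ?_⟩
    have h1 := hconc (θ + c • a) (θ + a)
    have h2 : g (θ + c • a) (θ + a - (θ + c • a)) = (1 / c - 1) * g (θ + c • a) (c • a) := by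
      have : θ + a - (θ + c • a) = (1 / c - 1) • (c • a) := by
        rw [smul_smul]
        have : (1 / c - 1) * c = 1 - c := by field_simp
        rw [this, sub_smul, one_smul]
        abel
      rw [this]
      simp only [hg, Finset.mul_sum, real_inner_smul_left]
      exact Finset.sum_congr rfl fun s _ => by ring
    have h3 := hgbound (c • a) hqb.le
    rw [hqb, Real.sqrt_sq hξ.le] at h3
    have h4 : g (θ + c • a) (c • a) < 0 := by nlinarith
    have h5 : 0 < 1 / c - 1 := by
      rw [sub_pos, lt_div_iff₀ hc0]; linarith
    nlinarith
  have hLc : Continuous L := by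
    have := hA.continuous
    simp only [hL]
    fun_prop
  have hqc : Continuous q := by
    simp only [hq]
    fun_prop
  refine ⟨?_, ?_⟩
  -- By `hV` the ellipsoid is bounded, and by `hout` a maximizer on it is a global one.
  · have hK : IsCompact {a : E | q a ≤ ξ ^ 2} := by
      refine Metric.isCompact_of_isClosed_isBounded (isClosed_le hqc continuous_const) ?_
      refine (Metric.isBounded_closedBall (x := (0 : E)) (r := √(ξ ^ 2 / lam))).subset fun a ha => ?_
      rw [mem_closedBall_zero_iff]
      refine Real.le_sqrt_of_sq_le ?_
      rw [le_div_iff₀ hlam]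
      have := hV a
      have ha : q a ≤ ξ ^ 2 := ha
      linarith
    obtain ⟨a, ha, hmax⟩ := hK.exists_isMaxOn ⟨0, by simp [hq]; positivity⟩
      ((hLc.comp (continuous_const.add continuous_id : Continuous fun a : E => θ + a)).continuousOn)
    refine ⟨θ + a, fun ϑ _ => ?_⟩
    have e : ϑ = θ + (ϑ - θ) := by abel
    by_cases hb : q (ϑ - θ) ≤ ξ ^ 2
    · have : L (θ + (ϑ - θ)) ≤ L (θ + a) := hmax hb
      rwa [← e] at this
    · obtain ⟨b, hb1, hb2⟩ := hout (ϑ - θ) (not_le.1 hb)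
      have : L (θ + b) ≤ L (θ + a) := hmax hb1.le
      rw [← e] at hb2
      exact (hb2.trans_le this).le
  · intro ϑ hϑ
    set a := ϑ - θ with ha
    have e : ϑ = θ + a := by rw [ha]; abel
    have hqa : q a ≤ ξ ^ 2 := by
      by_contra hcon
      obtain ⟨b, _, hb2⟩ := hout a (not_le.1 hcon)
      rw [← e] at hb2
      exact absurd (hϑ (Set.mem_univ (θ + b))) (not_le.2 hb2)
    -- Stationarity on the line through `θ` and the maximizer is enough: with `hgbound` it leaves `ϱ
    -- κ q ≤ C √q`.
    have hg0 : g (θ + a) a = 0 := by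
      have hder : HasDerivAt (fun x : ℝ => L (θ + x • a)) (g (θ + (1 : ℝ) • a) a) 1 := by
        have hs : ∀ s ∈ I, HasDerivAt (fun x : ℝ => Y s * inner ℝ (θ + x • a) (Z s) -
            A (inner ℝ (θ + x • a) (Z s)))
            ((Y s - deriv A (inner ℝ (θ + (1 : ℝ) • a) (Z s))) * inner ℝ a (Z s)) 1 := by
          intro s _
          have h1 : HasDerivAt (fun x : ℝ => inner ℝ (θ + x • a) (Z s)) (inner ℝ a (Z s)) 1 := by
            simp only [inner_add_left, real_inner_smul_left]
            simpa using ((hasDerivAt_id (1 : ℝ)).mul_const (inner ℝ a (Z s))).const_add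
              (inner ℝ θ (Z s))
          have h2 := (hA (inner ℝ (θ + (1 : ℝ) • a) (Z s))).hasDerivAt.comp (1 : ℝ) h1
          have h3 := (h1.const_mul (Y s)).sub h2
          refine h3.congr_deriv ?_
          ring
        simpa [hL, hg] using HasDerivAt.fun_sum hs
      have hmax : IsLocalMax (fun x : ℝ => L (θ + x • a)) 1 := by
        refine Filter.Eventually.of_forall fun x => ?_
        have := hϑ (Set.mem_univ (θ + x • a))
        simp only [Set.mem_ofPred_eq] at this
        rw [e] at this
        simpa using this
      simpa using hmax.hasDerivAt_eq_zero hder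
    have h1 := hgbound a hqa
    rw [hg0] at h1
    have hr : √(q a) ^ 2 = q a := Real.sq_sqrt (hq0 a)
    have hpos : 0 < ϱ * κ := by positivity
    have h2 : √(q a) ≤ C / (ϱ * κ) := by
      rw [le_div_iff₀ hpos]
      rcases (Real.sqrt_nonneg (q a)).eq_or_lt with h0 | h0
      · rw [← h0]; simpa using hC
      · nlinarith
    calc q a = √(q a) ^ 2 := hr.symm
      _ ≤ _ := pow_le_pow_left₀ (Real.sqrt_nonneg _) h2 2

end GLM

end UCR

namespace UCR

/-! ### Deterministic inequalities for the randomized rounds. -/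

section Exploration

theorem sum_sq_sub_le {I : Finset ℕ} (f : ℕ → ℝ) (c : ℝ) :
    ∑ s ∈ I, (f s - c) ^ 2 ≤ 2 * ∑ s ∈ I, (f s) ^ 2 + 2 * c ^ 2 * I.card := by
  calc ∑ s ∈ I, (f s - c) ^ 2 ≤ ∑ s ∈ I, (2 * (f s) ^ 2 + 2 * c ^ 2) :=
        Finset.sum_le_sum fun s _ => by nlinarith [sq_nonneg (f s + c)]
    _ = _ := by rw [Finset.sum_add_distrib, ← Finset.mul_sum, Finset.sum_const, nsmul_eq_mul]; ring

theorem sqrt_sum_sq_sub_le {I : Finset ℕ} (f : ℕ → ℝ) (c : ℝ) :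
    √(∑ s ∈ I, (f s - c) ^ 2) ≤ √(∑ s ∈ I, (f s) ^ 2) + |c| * √I.card := by
  have h1 : 0 ≤ ∑ s ∈ I, (f s) ^ 2 := Finset.sum_nonneg fun _ _ => sq_nonneg _
  refine Real.sqrt_le_iff.2 ⟨by positivity, ?_⟩
  have hcs := Finset.sum_mul_sq_le_sq_mul_sq I f (fun _ => 1)
  simp only [mul_one, one_pow, Finset.sum_const, nsmul_eq_mul] at hcs
  have h2 : |∑ s ∈ I, f s| ≤ √(∑ s ∈ I, (f s) ^ 2) * √I.card := by
    refine abs_le_of_sq_le_sq ?_ (by positivity)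
    rw [mul_pow, Real.sq_sqrt h1, Real.sq_sqrt (Nat.cast_nonneg _)]
    exact hcs
  have h3 : -(c * ∑ s ∈ I, f s) ≤ |c| * (√(∑ s ∈ I, (f s) ^ 2) * √I.card) := by
    calc -(c * ∑ s ∈ I, f s) ≤ |c * ∑ s ∈ I, f s| := neg_le_abs _
      _ = |c| * |∑ s ∈ I, f s| := abs_mul _ _
      _ ≤ _ := by gcongr
  have h4 : ∑ s ∈ I, (f s - c) ^ 2 = ∑ s ∈ I, (f s) ^ 2 - 2 * (c * ∑ s ∈ I, f s) + c ^ 2 * I.card := by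
    rw [Finset.mul_sum, Finset.mul_sum, ← Finset.sum_sub_distrib, mul_comm (c ^ 2), ← nsmul_eq_mul,
      ← Finset.sum_const, ← Finset.sum_add_distrib]
    exact Finset.sum_congr rfl fun s _ => by ring
  have h5 : (√(∑ s ∈ I, (f s) ^ 2) + |c| * √I.card) ^ 2 = ∑ s ∈ I, (f s) ^ 2 +
      2 * (|c| * (√(∑ s ∈ I, (f s) ^ 2) * √I.card)) + c ^ 2 * I.card := by
    rw [add_sq, mul_pow, Real.sq_sqrt h1, Real.sq_sqrt (Nat.cast_nonneg _), sq_abs]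
    ring
  rw [h4, h5]
  linarith

/-- The regularized energy of a parameter `(α, b)` in the exploration rounds, after averaging over
the positions (of mean `m` and variance `v`). -/
noncomputable def energy (I : Finset ℕ) (v m α : ℝ) (e : ℕ → ℝ) : ℝ :=
  v * α ^ 2 * I.card + ∑ s ∈ I, (e s + α * m) ^ 2

/-- Since `m² ≤ v`, removing the shift `α m` costs a factor 2, so the context part is at most
`(200/38)` energies; the position part is at most `(3/4) · 16 = 12` energies. The total is below
17.3. -/
theorem norm_sq_le_energy {I : Finset ℕ} (hI : 0 < I.card) {v m cx α B : ℝ} (hv : 1 / 16 ≤ v)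
    (hm : m ^ 2 ≤ v) (hcx' : cx ≤ 3 / 4) (e : ℕ → ℝ)
    (hX : 38 / 100 * I.card * cx * B ≤ ∑ s ∈ I, (e s) ^ 2) :
    (α ^ 2 + B) * (cx * I.card) ≤ 173 / 10 * energy I v m α e := by
  have hN : (0 : ℝ) < I.card := by exact_mod_cast hI
  have h1 := sum_sq_sub_le (I := I) (fun s => e s + α * m) (α * m)
  simp only [add_sub_cancel_right] at h1
  set F := ∑ s ∈ I, (e s + α * m) ^ 2 with hF
  have hF0 : 0 ≤ F := Finset.sum_nonneg fun _ _ => sq_nonneg _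
  have h2 : (α * m) ^ 2 * I.card ≤ v * α ^ 2 * I.card := by
    have : (α * m) ^ 2 ≤ v * α ^ 2 := by
      rw [mul_pow, mul_comm]; gcongr
    gcongr
  have h3 : 38 / 100 * (B * (cx * I.card)) ≤ 2 * energy I v m α e := by
    rw [energy]; nlinarith
  have h4 : α ^ 2 * (cx * I.card) ≤ 12 * energy I v m α e := by
    have : α ^ 2 * cx ≤ 12 * (v * α ^ 2) := by nlinarith [sq_nonneg α]
    have : α ^ 2 * cx * I.card ≤ 12 * (v * α ^ 2) * I.card := by gcongr
    rw [energy]; nlinarith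
  have h5 : 0 ≤ energy I v m α e := by rw [energy]; positivity
  nlinarith

/-- The Gram form of the exploration rounds dominates the averaged energy. -/
theorem energy_le_gram {I : Finset ℕ} (hI : 0 < I.card) {v m cx α B lam x : ℝ} (hv : 1 / 16 ≤ v)
    (hm : m ^ 2 ≤ v) (hcx : 0 < cx) (hcx' : cx ≤ 3 / 4) (hlam : 0 ≤ lam) (hB : 0 ≤ B) (p e : ℕ → ℝ)
    (hX : 38 / 100 * I.card * cx * B ≤ ∑ s ∈ I, (e s) ^ 2)
    (hlamN : 173 / 10 * lam ≤ 61 / 1000 * (cx * I.card))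
    (hx : x ≤ 31 / 10000 * (v * I.card))
    (hcross : (∑ s ∈ I, (e s + α * m) * (p s - m)) ^ 2 ≤
      x * (∑ s ∈ I, (e s + α * m) ^ 2 + lam * (α ^ 2 + B)))
    (hvar : 97 / 100 * (v * I.card) ≤ ∑ s ∈ I, (p s - m) ^ 2) :
    91 / 100 * energy I v m α e ≤ ∑ s ∈ I, (α * p s + e s) ^ 2 := by
  have hN : (0 : ℝ) < I.card := by exact_mod_cast hI
  have hnorm := norm_sq_le_energy (α := α) hI hv hm hcx' e hX
  set U := energy I v m α e with hU
  set F := ∑ s ∈ I, (e s + α * m) ^ 2 with hF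
  set A := v * α ^ 2 * I.card with hA
  have hF0 : 0 ≤ F := Finset.sum_nonneg fun _ _ => sq_nonneg _
  have hA0 : 0 ≤ A := by positivity
  have hUe : U = A + F := rfl
  set R := ∑ s ∈ I, (e s + α * m) * (p s - m) with hR
  have hlamU : lam * (α ^ 2 + B) ≤ 61 / 1000 * U := by
    have hcN : 0 < cx * I.card := by positivity
    have h1 : lam * ((α ^ 2 + B) * (cx * I.card)) ≤ lam * (173 / 10 * U) := by gcongr
    have hU0 : 0 ≤ U := by rw [hUe]; positivity
    have h2 : 173 / 10 * lam * U ≤ 61 / 1000 * (cx * I.card) * U := by gcongr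
    have h3 : lam * (α ^ 2 + B) * (cx * I.card) ≤ 61 / 1000 * U * (cx * I.card) := by linarith
    exact le_of_mul_le_mul_right h3 hcN
  -- Centre the positions. The three terms are worth `F`, at least `-6/100` of the energy, and at
  -- least `97/100` of `A`, whence 91/100.
  have hexp : ∑ s ∈ I, (α * p s + e s) ^ 2 = F + 2 * α * R + α ^ 2 * ∑ s ∈ I, (p s - m) ^ 2 := by
    rw [hF, hR, Finset.mul_sum, Finset.mul_sum, ← Finset.sum_add_distrib, ← Finset.sum_add_distrib]
    exact Finset.sum_congr rfl fun s _ => by ring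
  have hvar' : 97 / 100 * A ≤ α ^ 2 * ∑ s ∈ I, (p s - m) ^ 2 := by
    have : α ^ 2 * (97 / 100 * (v * I.card)) ≤ α ^ 2 * ∑ s ∈ I, (p s - m) ^ 2 := by gcongr
    rw [hA]; linarith
  -- By `4 A B ≤ (A + B)²` the square is at most `0.0031 · 1.061²` of the squared energy, which is
  -- below `0.06²`.
  have hcr : |2 * α * R| ≤ 6 / 100 * U := by
    refine abs_le_of_sq_le_sq ?_ (by rw [hUe]; positivity)
    have h1 : R ^ 2 ≤ 31 / 10000 * (v * I.card) * (F + 61 / 1000 * U) := by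
      refine hcross.trans ?_
      gcongr
    have h2 : (2 * α * R) ^ 2 ≤ 4 * α ^ 2 * (31 / 10000 * (v * I.card) * (F + 61 / 1000 * U)) := by
      have : (2 * α * R) ^ 2 = 4 * α ^ 2 * R ^ 2 := by ring
      rw [this]; gcongr
    have h3 : 4 * α ^ 2 * (31 / 10000 * (v * I.card) * (F + 61 / 1000 * U)) =
        31 / 10000 * (4 * A * (F + 61 / 1000 * U)) := by rw [hA]; ring
    have h4 : 4 * A * (F + 61 / 1000 * U) ≤ (A + (F + 61 / 1000 * U)) ^ 2 := by
      nlinarith [sq_nonneg (A - (F + 61 / 1000 * U))]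
    have h5 : A + (F + 61 / 1000 * U) = 1061 / 1000 * U := by rw [hUe]; ring
    rw [h5] at h4
    nlinarith [sq_nonneg U]
  have := (abs_le.1 hcr).1
  rw [hexp]
  rw [hUe] at this ⊢
  linarith

theorem div_le_min_sq_abs {y Y : ℝ} (hY : 1 ≤ Y) (h : |y| ≤ Y) : y ^ 2 / Y ≤ min (y ^ 2) |y| := by
  have h0 : 0 < Y := by linarith
  refine le_min ?_ ?_
  · exact div_le_self (sq_nonneg _) hY
  · rw [div_le_iff₀ h0, ← sq_abs, sq]
    gcongr

/-- Parameters in the confidence ellipsoid are moderate on all features (at least three items). -/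
theorem abs_le_of_energy_le {I : Finset ℕ} (hI : 0 < I.card) {v m cx c₁ α β ξ : ℝ}
    (hv : 2 / 27 ≤ v) (hm0 : 0 ≤ m) (hm : m ≤ 1 / 6) (hc₁ : 0 < c₁) (hc₁' : c₁ ≤ 1 / 6)
    (hcx : c₁ ≤ cx) (hβ : 0 ≤ β) (e : ℕ → ℝ)
    (hX : 82 / 100 * I.card * cx * β ^ 2 ≤ ∑ s ∈ I, (e s) ^ 2)
    (hξ : ξ ^ 2 ≤ 5005 / 10000 * c₁ * I.card) (hU : 91 / 100 * energy I v m α e ≤ ξ ^ 2) :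
    |α| / 2 + √3 / 2 * β ≤ 50 / 41 := by
  have hN : (0 : ℝ) < I.card := by exact_mod_cast hI
  have h1 := sqrt_sum_sq_sub_le (I := I) (fun s => e s + α * m) (α * m)
  simp only [add_sub_cancel_right] at h1
  set F := ∑ s ∈ I, (e s + α * m) ^ 2 with hF
  have hF0 : 0 ≤ F := Finset.sum_nonneg fun _ _ => sq_nonneg _
  have hen : energy I v m α e = v * α ^ 2 * (I.card : ℝ) + F := rfl
  rw [hen] at hU
  generalize (I.card : ℝ) = N at *
  -- `0.5005 / 0.91 = 0.55`.
  have hUN : v * α ^ 2 * N + F ≤ 55 / 100 * c₁ * N := by linarith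
  set r := √c₁ with hr
  have hr0 : 0 < r := Real.sqrt_pos.2 hc₁
  have hr2 : r ^ 2 = c₁ := Real.sq_sqrt hc₁.le
  have hr1 : r ≤ 40825 / 100000 := by
    refine Real.sqrt_le_iff.2 ⟨by norm_num, ?_⟩
    norm_num; linarith
  set n := √N with hn
  have hn0 : 0 < n := Real.sqrt_pos.2 hN
  have hn2 : n ^ 2 = N := Real.sq_sqrt hN.le
  set f := √F with hf
  have hf0 : 0 ≤ f := Real.sqrt_nonneg _
  have hf2 : f ^ 2 = F := Real.sq_sqrt hF0
  have hα0 := abs_nonneg α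
  have hb : 905 / 1000 * (r * n * β) ≤ f + |α| * n / 6 := by
    have h2 : 905 / 1000 * (r * n * β) ≤ √(∑ s ∈ I, (e s) ^ 2) := by
      refine Real.le_sqrt_of_sq_le ?_
      refine le_trans ?_ hX
      have : (905 / 1000 * (r * n * β)) ^ 2 = (905 / 1000) ^ 2 * (N * c₁ * β ^ 2) := by
        rw [← hr2, ← hn2]; ring
      rw [this]
      have h3 : N * c₁ * β ^ 2 ≤ N * cx * β ^ 2 := by gcongr
      have h4 : 0 ≤ N * c₁ * β ^ 2 := by positivity
      nlinarith
    have h3 : |α * m| * n ≤ |α| * n / 6 := by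
      rw [abs_mul, abs_of_nonneg hm0]
      have : |α| * m * n ≤ |α| * (1 / 6) * n := by gcongr
      linarith
    linarith
  have hs3 : √3 ≤ 17321 / 10000 := by
    refine Real.sqrt_le_iff.2 ⟨by norm_num, by norm_num⟩
  have hrn : 0 < r * n := by positivity
  have hlin : (|α| / 2 + √3 / 2 * β) * (r * n) ≤ 36365 / 100000 * (|α| * n) + 957 / 1000 * f := by
    have h2 : √3 / 2 * β * (r * n) ≤ 17321 / 20000 * (r * n * β) := by
      have : √3 / 2 * β * (r * n) = √3 * (r * n * β / 2) := by ring
      rw [this]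
      have h5 : 0 ≤ r * n * β / 2 := by positivity
      nlinarith
    have h3 : |α| / 2 * (r * n) ≤ |α| * n / 2 * (40825 / 100000) := by
      have : |α| / 2 * (r * n) = |α| * n / 2 * r := by ring
      rw [this]; gcongr
    have h5 : 0 ≤ |α| * n := by positivity
    linarith
  have hell : 2 / 27 * (|α| * n) ^ 2 + f ^ 2 ≤ 55 / 100 * (r * n) ^ 2 := by
    rw [mul_pow, mul_pow, hn2, hf2, hr2, sq_abs]
    have : 2 / 27 * (α ^ 2 * N) ≤ v * (α ^ 2 * N) := by gcongr
    linarith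
  -- Cauchy–Schwarz against the ellipse `hell`; the resulting constant `0.55 (0.36365² · 27/2 +
  -- 0.957²)` is just below `(50/41)²`.
  have hsq : ((|α| / 2 + √3 / 2 * β) * (r * n)) ^ 2 ≤ (50 / 41 * (r * n)) ^ 2 := by
    have h0 : 0 ≤ (|α| / 2 + √3 / 2 * β) * (r * n) := by positivity
    have h2 := pow_le_pow_left₀ h0 hlin 2
    have h3 : (36365 / 100000 * (|α| * n) + 957 / 1000 * f) ^ 2 ≤
        ((36365 / 100000) ^ 2 * (27 / 2) + (957 / 1000) ^ 2) * (2 / 27 * (|α| * n) ^ 2 + f ^ 2) := by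
      nlinarith [sq_nonneg (36365 / 100000 * f * (27 / 2) - 957 / 1000 * (|α| * n))]
    have h4 : 0 ≤ (r * n) ^ 2 := by positivity
    rw [mul_pow]
    linarith
  have := abs_le_of_sq_le_sq' hsq (by positivity)
  exact le_of_mul_le_mul_right this.2 hrn

theorem huber_of_abs_le {J : Finset ℕ} (y : ℕ → ℝ) (h : ∀ s ∈ J, |y s| ≤ 50 / 41) :
    41 / 50 * ∑ s ∈ J, (y s) ^ 2 ≤ ∑ s ∈ J, min ((y s) ^ 2) |y s| := by
  rw [Finset.mul_sum]
  refine Finset.sum_le_sum fun s hs => ?_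
  have := div_le_min_sq_abs (by norm_num) (h s hs)
  linarith

/-- The difference of the two sides is a cubic with its minimum over `z ≥ 0` near `0.617`, where it
is still positive. -/
theorem cubic_aux {z : ℝ} (hz : 0 ≤ z) :
    41 / 50 * (742 / 1000 + 994 / 1000 * z) ≤
      z ^ 2 * (742 / 1000 + 994 / 1000 * z) + (1 - z ^ 2) := by
  nlinarith [mul_nonneg hz (sq_nonneg (z - 617 / 1000)), sq_nonneg (z - 617 / 1000)]

/-- With two items, half of the exploration rounds do not involve the position, which compensates
for the rounds in which a parameter of the confidence ellipsoid is large. -/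
theorem huber_of_two_items {I J I₀ : Finset ℕ} (hI : 0 < I.card) (hIJ : I ⊆ J) (hI₀ : I₀ ⊆ I)
    {v m cx c₁ α β ξ : ℝ} (hv : 1 / 16 ≤ v) (hc₁ : 0 < c₁) (hc₁' : c₁ ≤ 1 / 4) (hcx : c₁ ≤ cx)
    (y e : ℕ → ℝ) (hξ : ξ ^ 2 ≤ 5005 / 10000 * c₁ * I.card)
    (hU : 91 / 100 * energy I v m α e ≤ ξ ^ 2) (hy : ∀ s ∈ J, |y s| ≤ |α| / 2 + √3 / 2 * β)
    (hy₀ : ∀ s ∈ I₀, |y s| ≤ √3 / 2 * β)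
    (hX : 38 / 100 * I.card * cx * β ^ 2 ≤ ∑ s ∈ I₀, (y s) ^ 2)
    (hV : ∑ s ∈ J, (y s) ^ 2 ≤ ξ ^ 2) :
    41 / 50 * ∑ s ∈ J, (y s) ^ 2 ≤ ∑ s ∈ J, min ((y s) ^ 2) |y s| := by
  have hN : (0 : ℝ) < I.card := by exact_mod_cast hI
  have hen : energy I v m α e =
    v * α ^ 2 * (I.card : ℝ) + ∑ s ∈ I, (e s + α * m) ^ 2 := rfl
  rw [hen] at hU
  generalize (I.card : ℝ) = N at *
  have hsplit : ∀ f : ℕ → ℝ, ∑ s ∈ J, f s = ∑ s ∈ I₀, f s + ∑ s ∈ J \ I₀, f s := fun f => by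
    rw [add_comm, Finset.sum_sdiff (hI₀.trans hIJ)]
  set V₀ := ∑ s ∈ I₀, (y s) ^ 2 with hV₀
  set V₁ := ∑ s ∈ J \ I₀, (y s) ^ 2 with hV₁
  have hV₀0 : 0 ≤ V₀ := Finset.sum_nonneg fun _ _ => sq_nonneg _
  have hV₁0 : 0 ≤ V₁ := Finset.sum_nonneg fun _ _ => sq_nonneg _
  have hVe : ∑ s ∈ J, (y s) ^ 2 = V₀ + V₁ := hsplit _
  rw [hVe] at hV ⊢
  rcases (add_nonneg hV₀0 hV₁0).eq_or_lt with h0 | hVpos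
  · rw [← h0, mul_zero]
    exact Finset.sum_nonneg fun s _ => le_min (sq_nonneg _) (abs_nonneg _)
  -- `z²` is the share of the Gram form carried by the rounds at position zero. Those rounds force
  -- `‖b‖` to be at most of order `z`, so large predictors occur only when `z` is large, and then
  -- much of the form needs no correction.
  set z := √(V₀ / (V₀ + V₁)) with hz
  have hz0 : 0 ≤ z := Real.sqrt_nonneg _
  have hz2 : z ^ 2 = V₀ / (V₀ + V₁) := Real.sq_sqrt (by positivity)
  have hz1 : z ≤ 1 := by
    exact Real.sqrt_le_one.2 ((div_le_one hVpos).2 (by linarith))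
  have hV₀z : V₀ = z ^ 2 * (V₀ + V₁) := by rw [hz2]; field_simp
  -- `(3/4) · 0.5005 / 0.38 < 0.994²`.
  have hβz : √3 / 2 * β ≤ 994 / 1000 * z := by
    refine le_of_abs_le (abs_le_of_sq_le_sq ?_ (by positivity))
    have h1 : (√3 / 2 * β) ^ 2 = 3 / 4 * β ^ 2 := by
      rw [mul_pow, div_pow, Real.sq_sqrt (by norm_num)]; ring
    have h2 : N * c₁ * β ^ 2 ≤ N * cx * β ^ 2 := by gcongr
    have h3 : V₀ ≤ z ^ 2 * (5005 / 10000 * c₁ * N) := by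
      rw [hV₀z]
      have := hV.trans hξ
      gcongr
    have h4 : 38 / 100 * β ^ 2 * (N * c₁) ≤ 5005 / 10000 * z ^ 2 * (N * c₁) := by
      linarith
    have h5 := le_of_mul_le_mul_right h4 (by positivity)
    rw [h1]
    nlinarith [sq_nonneg z]
  -- From `v ≥ 1/16` and `c₁ ≤ 1/4`: `α² ≤ 16 · 0.55 / 4 = 2.2`.
  have hα : |α| / 2 ≤ 742 / 1000 := by
    have hF0 : 0 ≤ ∑ s ∈ I, (e s + α * m) ^ 2 := Finset.sum_nonneg fun _ _ => sq_nonneg _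
    have h1 : v * α ^ 2 * N ≤ 55 / 100 * c₁ * N := by
      linarith
    have h2 := le_of_mul_le_mul_right h1 hN
    have h3 : α ^ 2 ≤ 22 / 10 := by nlinarith [sq_nonneg α]
    have : |α| ≤ 1484 / 1000 := by
      refine abs_le_of_sq_le_sq ?_ (by norm_num)
      norm_num; linarith
    linarith
  set Y := 742 / 1000 + 994 / 1000 * z with hY
  have hY0 : 0 < Y := by positivity
  have h0 : ∀ s ∈ I₀, (y s) ^ 2 ≤ min ((y s) ^ 2) |y s| := by
    intro s hs
    have := div_le_min_sq_abs (le_refl 1) ((hy₀ s hs).trans (hβz.trans (by linarith)))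
    simpa using this
  have hJ : ∀ s ∈ J \ I₀, 1 / max 1 Y * (y s) ^ 2 ≤ min ((y s) ^ 2) |y s| := by
    intro s hs
    have := div_le_min_sq_abs (le_max_left 1 Y) (((hy s (Finset.mem_sdiff.1 hs).1).trans
      (by linarith : _ ≤ Y)).trans (le_max_right _ _))
    rwa [one_div_mul_eq_div]
  rw [hsplit]
  refine le_trans ?_ (add_le_add (Finset.sum_le_sum h0) (Finset.sum_le_sum hJ))
  rw [← Finset.mul_sum]
  change _ ≤ V₀ + 1 / max 1 Y * V₁
  have hV₁z : V₁ = (1 - z ^ 2) * (V₀ + V₁) := by linarith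
  rcases le_total Y 1 with h | h
  · rw [max_eq_left h]; linarith
  · rw [max_eq_right h]
    have hc := cubic_aux hz0
    rw [← hY] at hc
    have h1 : V₀ + 1 / Y * V₁ = (z ^ 2 * Y + (1 - z ^ 2)) / Y * (V₀ + V₁) := by
      rw [add_div, mul_div_cancel_right₀ _ hY0.ne', add_mul, ← hV₀z]
      congr 1
      rw [div_mul_eq_mul_div, div_mul_eq_mul_div, ← hV₁z, one_mul]
    rw [h1]
    refine mul_le_mul_of_nonneg_right ?_ hVpos.le
    rw [le_div_iff₀ hY0]
    exact hc

end Exploration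

end UCR

namespace UCR

open Matrix

/-! ### The elliptical potential and two-by-two determinants. -/

section Elliptical

variable {n : ℕ}

theorem inv_form_nonneg {W : Matrix (Fin n) (Fin n) ℝ} (hW : W.PosDef) (z : Fin n → ℝ) :
    0 ≤ z ⬝ᵥ W⁻¹ *ᵥ z := by
  simpa using hW.inv.posSemidef.dotProduct_mulVec_nonneg z

/-- With `a = W⁻¹ z` and `x = zᵀ W⁻¹ z`, the hypothesis gives `lam |a|² ≤ x` and Cauchy–Schwarz
gives `x² ≤ |a|²`. -/
theorem inv_form_le_of_le {W : Matrix (Fin n) (Fin n) ℝ} (hW : W.PosDef) {lam : ℝ} (hlam : 0 < lam)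
    (h : ∀ a : Fin n → ℝ, lam * (a ⬝ᵥ a) ≤ a ⬝ᵥ W *ᵥ a) {z : Fin n → ℝ} (hz : z ⬝ᵥ z ≤ 1) :
    z ⬝ᵥ W⁻¹ *ᵥ z ≤ 1 / lam := by
  have hu : IsUnit W.det := hW.isUnit.map detMonoidHom
  set x := z ⬝ᵥ W⁻¹ *ᵥ z with hx
  have hx0 : 0 ≤ x := inv_form_nonneg hW z
  set a := W⁻¹ *ᵥ z with ha
  have h1 : a ⬝ᵥ W *ᵥ a = x := by
    rw [ha, mulVec_mulVec, mul_nonsing_inv _ hu, one_mulVec, dotProduct_comm]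
  have h2 := h a
  rw [h1] at h2
  have h3 : x ^ 2 ≤ (z ⬝ᵥ z) * (a ⬝ᵥ a) := by
    have := posSemidef_mul_le (W := 1) PosSemidef.one z a
    simpa using this
  have haa : 0 ≤ a ⬝ᵥ a := by simpa [dotProduct] using Finset.sum_nonneg fun i _ => mul_self_nonneg (a i)
  rw [le_div_iff₀ hlam]
  rcases hx0.eq_or_lt with h0 | h0
  · rw [← h0]; norm_num
  · have h4 : x ^ 2 ≤ 1 * (a ⬝ᵥ a) := h3.trans (by gcongr)
    have : x * (x * lam) ≤ x * 1 := by nlinarith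
    exact le_of_mul_le_mul_left this h0

/-- Elliptical potential lemma. -/
theorem sum_inv_form_le {W : ℕ → Matrix (Fin n) (Fin n) ℝ} {z : ℕ → Fin n → ℝ} {t₀ t₁ : ℕ}
    (hle : t₀ ≤ t₁) (hstep : ∀ t ∈ Finset.Ico t₀ t₁, W (t + 1) = W t + vecMulVec (z t) (z t))
    (hW : ∀ t ∈ Finset.Ico t₀ t₁, (W t).PosDef) {C : ℝ}
    (hC : ∀ t ∈ Finset.Ico t₀ t₁, z t ⬝ᵥ (W t)⁻¹ *ᵥ z t ≤ C) :
    ∑ t ∈ Finset.Ico t₀ t₁, z t ⬝ᵥ (W t)⁻¹ *ᵥ z t ≤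
      (1 + C) * (Real.log (W t₁).det - Real.log (W t₀).det) := by
  rw [← Finset.sum_Ico_sub (fun t => Real.log (W t).det) hle, Finset.mul_sum]
  refine Finset.sum_le_sum fun t ht => ?_
  have hx0 := inv_form_nonneg (hW t ht) (z t)
  have hdet := (hW t ht).det_pos
  rw [hstep t ht, det_add_vecMulVec (hW t ht), Real.log_mul hdet.ne' (by positivity),
    add_sub_cancel_left]
  have h1 := Real.one_sub_inv_le_log_of_pos (show 0 < 1 + z t ⬝ᵥ (W t)⁻¹ *ᵥ z t by positivity)
  -- Writing `x = (1 + x)(1 - 1/(1 + x))` and using `1 - 1/u ≤ log u` gives `x ≤ (1 + C) log (1 +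
  -- x)`. A small `C` makes the constant almost one.
  have h2 : z t ⬝ᵥ (W t)⁻¹ *ᵥ z t = (1 + z t ⬝ᵥ (W t)⁻¹ *ᵥ z t) *
      (1 - (1 + z t ⬝ᵥ (W t)⁻¹ *ᵥ z t)⁻¹) := by
    field_simp; ring
  have h3 : 0 ≤ 1 - (1 + z t ⬝ᵥ (W t)⁻¹ *ᵥ z t)⁻¹ := by
    rw [sub_nonneg]; exact inv_le_one_of_one_le₀ (by linarith)
  have := hC t ht
  have h4 : 0 ≤ 1 + C := by linarith
  refine h2.le.trans ?_
  gcongr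

theorem det_fin_two_le_mul {W : Matrix (Fin 2) (Fin 2) ℝ} (hW : W.IsHermitian) :
    W.det ≤ W 0 0 * W 1 1 := by
  have := hW.apply 0 1
  simp only [star_trivial] at this
  rw [det_fin_two, this]
  nlinarith [sq_nonneg (W 0 1)]

/-- The minimum of the form over the vectors `(1, b)` is the Schur complement `det W / W 1 1`. -/
theorem mul_le_det_fin_two {W : Matrix (Fin 2) (Fin 2) ℝ} (hW : W.IsHermitian) {r : ℝ}
    (h11 : 0 < W 1 1) (h : ∀ b : ℝ, r ≤ ![1, b] ⬝ᵥ W *ᵥ ![1, b]) : r * W 1 1 ≤ W.det := by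
  have hs := hW.apply 0 1
  simp only [star_trivial] at hs
  have h1 := h (-(W 0 1) / W 1 1)
  simp [dotProduct, mulVec, Fin.sum_univ_two] at h1
  rw [hs] at h1
  rw [det_fin_two, hs]
  have h2 : (W 0 0 + W 0 1 * (-W 0 1 / W 1 1) + -W 0 1 / W 1 1 * (W 0 1 + W 1 1 * (-W 0 1 / W 1 1)))
      * W 1 1 = W 0 0 * W 1 1 - W 0 1 * W 0 1 := by field_simp; ring
  rw [← h2]
  gcongr

/-- Sums of square roots of a block of nonnegative terms. -/
theorem sum_sqrt_le {I : Finset ℕ} {x : ℕ → ℝ} (hx : ∀ t ∈ I, 0 ≤ x t) {c S : ℝ}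
    (hc : (I.card : ℝ) ≤ c) (hS : ∑ t ∈ I, x t ≤ S) : ∑ t ∈ I, √(x t) ≤ √(c * S) := by
  refine Real.le_sqrt_of_sq_le ?_
  have h := Finset.sum_mul_sq_le_sq_mul_sq I (fun _ => (1 : ℝ)) (fun t => √(x t))
  simp only [one_mul, one_pow, Finset.sum_const, nsmul_eq_mul, mul_one] at h
  refine h.trans ?_
  rw [Finset.sum_congr rfl fun t ht => Real.sq_sqrt (hx t ht)]
  have := Finset.sum_nonneg hx
  gcongr
  exact (Nat.cast_nonneg _).trans hc

end Elliptical

end UCR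

namespace UCR

/-! ### Numerical consequences of the exploration threshold. -/

section Calibration

/-- The relations between the constants of the problem that the analysis of `N` randomized rounds,
with at least two items, relies on. -/
structure Calibration (d K : ℕ) (cx c₁ δ : ℝ) (N T : ℕ) : Prop where
  one_le_d : 1 ≤ d
  two_le_K : 2 ≤ K
  δ_pos : 0 < δ
  δ_lt : δ < 1 / 2
  c₁_pos : 0 < c₁
  c₁_le : c₁ ≤ 1 / (2 * K)
  c₁_le_cx : c₁ ≤ cx
  cx_mul_le : cx * d ≤ 3 / 4
  explore : 256 * Real.log ((4 * d + 4) / δ) ≤ c₁ ^ 2 * N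
  lt_horizon : N + 1 ≤ T

/-- The tangent line of the logarithm at `r`. With `r` a power of two, it reduces the numerical
estimates below to bounds on `log 2`. -/
theorem log_le_add_div_sub_one {r u : ℝ} (hr : 0 < r) (hu : 0 < u) :
    Real.log u ≤ Real.log r + u / r - 1 := by
  have := Real.log_le_sub_one_of_pos (div_pos hu hr)
  rw [Real.log_div hu.ne' hr.ne'] at this
  linarith

theorem log_two_pow (k : ℕ) : Real.log (2 ^ k) = k * Real.log 2 := Real.log_pow 2 k

variable {d K : ℕ} {cx c₁ δ : ℝ} {N T : ℕ}

namespace Calibration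

theorem le_log (h : Calibration d K cx c₁ δ N T) :
    Real.log 8 + Real.log (d + 1) ≤ Real.log ((4 * d + 4) / δ) := by
  have h1 := h.δ_pos
  have h2 := h.δ_lt
  rw [← Real.log_mul (by norm_num) (by positivity)]
  refine Real.log_le_log (by positivity) ?_
  rw [le_div_iff₀ h1]
  have : (0 : ℝ) ≤ d := Nat.cast_nonneg _
  nlinarith

theorem log_eight_gt : 2.0794415 < Real.log 8 := by
  have h := log_two_pow 3
  norm_num at h
  rw [h]; have := Real.log_two_gt_d9; linarith

theorem log_ge (h : Calibration d K cx c₁ δ N T) :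
    2.772588 ≤ Real.log ((4 * d + 4) / δ) := by
  refine le_trans ?_ h.le_log
  have h1 : Real.log 2 ≤ Real.log (d + 1) := by
    refine Real.log_le_log (by norm_num) ?_
    have : (1 : ℝ) ≤ d := by exact_mod_cast h.one_le_d
    linarith
  have := Real.log_two_gt_d9
  have := log_eight_gt
  linarith

theorem log_eq (h : Calibration d K cx c₁ δ N T) :
    Real.log ((4 * d + 4) / δ) = Real.log 4 + Real.log (d + 1) - Real.log δ := by
  rw [Real.log_div (by positivity) h.δ_pos.ne', ← Real.log_mul (by norm_num) (by positivity)]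
  congr 2; ring

/-- All parameters are measured against `q = 1 / c₁`. For `d ≤ 3` the bound `d + 1 ≤ q` comes from
`4 ≤ q`, for larger `d` from `4 d / 3 ≤ q`. -/
theorem exists_inv (h : Calibration d K cx c₁ δ N T) :
    ∃ q, c₁ = 1 / q ∧ 4 ≤ q ∧ 2 * (K : ℝ) ≤ q ∧ (d : ℝ) + 1 ≤ q ∧ 4 / 3 * (d : ℝ) ≤ q ∧
      256 * Real.log ((4 * d + 4) / δ) * q ^ 2 ≤ N := by
  have hc := h.c₁_pos
  have hK : (2 : ℝ) ≤ K := by exact_mod_cast h.two_le_K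
  have hd : (1 : ℝ) ≤ d := by exact_mod_cast h.one_le_d
  have hKq : 2 * (K : ℝ) ≤ 1 / c₁ := by
    rw [le_div_iff₀ hc]
    have := h.c₁_le
    rw [le_div_iff₀ (by positivity)] at this
    linarith
  have hdq : 4 / 3 * (d : ℝ) ≤ 1 / c₁ := by
    rw [le_div_iff₀ hc]
    have h1 := h.cx_mul_le
    have h2 := h.c₁_le_cx
    have : c₁ * d ≤ cx * d := by gcongr
    linarith
  refine ⟨1 / c₁, by simp, by linarith, hKq, ?_, hdq, ?_⟩
  · rcases le_or_gt (d : ℝ) 3 with h3 | h3 <;> linarith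
  · have := h.explore
    rw [div_pow, one_pow, mul_one_div, div_le_iff₀ (by positivity)]
    linarith

theorem N_pos (h : Calibration d K cx c₁ δ N T) : 11000 < (N : ℝ) := by
  obtain ⟨q, -, hq, -, -, -, hN⟩ := h.exists_inv
  have := h.log_ge
  nlinarith

/-- The cross term between positions and contexts is negligible. -/
theorem cross (h : Calibration d K cx c₁ δ N T) :
    (K : ℝ) / 2 * ((d + 1) * Real.log (1 + N / ((d + 1) * (5 / 2 / c₁))) +
      2 * Real.log (1 / (δ / (8 * K)))) ≤ 31 / 10000 * N := by
  obtain ⟨q, rfl, hq, hK, hn, -, hN⟩ := h.exists_inv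
  have hL := h.log_ge
  have hLe := h.log_eq
  have hK2 : (2 : ℝ) ≤ K := by exact_mod_cast h.two_le_K
  have hδ := h.δ_pos
  have hd : (1 : ℝ) ≤ d := by exact_mod_cast h.one_le_d
  set L := Real.log ((4 * d + 4) / δ)
  set n : ℝ := (d : ℝ) + 1 with hndef
  have hn2 : 2 ≤ n := by rw [hndef]; linarith
  have hlog2 := Real.log_two_lt_d9
  have hlog2' := Real.log_two_gt_d9
  obtain ⟨y, hy⟩ : ∃ y, y = (N : ℝ) / q := ⟨_, rfl⟩
  have hNy : (N : ℝ) = y * q := by rw [hy]; field_simp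
  have hyL : 256 * L * q ≤ y := by
    rw [hNy] at hN
    have : 256 * L * q * q ≤ y * q := by linarith
    exact le_of_mul_le_mul_right this (by linarith)
  have e1 : 1 + (N : ℝ) / (n * (5 / 2 / (1 / q))) = 1 + y / (5 / 2 * n) := by
    rw [hNy]; field_simp
  rw [e1]
  have hqy : 7097 / 10 * q ≤ y := by nlinarith
  have hLy : 1024 * L ≤ y := by nlinarith
  have hy0 : 0 < y := by nlinarith
  have h1 : n * Real.log (1 + y / (5 / 2 * n)) ≤ 4.5492 * n + y / 640 := by
    have h2 := log_le_add_div_sub_one (r := 2 ^ 8) (u := 1 + y / (5 / 2 * n)) (by norm_num)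
      (by positivity)
    rw [log_two_pow] at h2
    have h3 : Real.log (1 + y / (5 / 2 * n)) ≤ 4.5492 + y / (640 * n) := by
      have : (1 + y / (5 / 2 * n)) / 2 ^ 8 = 1 / 256 + y / (640 * n) := by field_simp; ring
      rw [this] at h2
      norm_num at h2 ⊢
      linarith
    calc n * Real.log (1 + y / (5 / 2 * n)) ≤ n * (4.5492 + y / (640 * n)) := by gcongr
      _ = _ := by field_simp
  have h2 : Real.log (1 / (δ / (8 * K))) ≤ Real.log q + L := by
    have : 1 / (δ / (8 * K)) = 8 * K / δ := by field_simp
    rw [this, Real.log_div (by positivity) hδ.ne', hLe]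
    have h3 : Real.log (8 * K) ≤ Real.log (4 * q) := Real.log_le_log (by positivity) (by linarith)
    rw [Real.log_mul (x := 4) (by norm_num) (by positivity)] at h3
    have : 0 ≤ Real.log n := Real.log_nonneg (by linarith)
    linarith
  have h3 : Real.log q ≤ q / 4 + 0.3864 := by
    have h4 := log_le_add_div_sub_one (r := 2 ^ 2) (u := q) (by norm_num) (by positivity)
    rw [log_two_pow] at h4
    norm_num at h4 ⊢
    linarith
  have h5 : n * Real.log (1 + y / (5 / 2 * n)) + 2 * Real.log (1 / (δ / (8 * K))) ≤
      124 / 10000 * y := by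
    norm_num at h1 h3
    linarith
  calc (K : ℝ) / 2 * (n * Real.log (1 + y / (5 / 2 * n)) + 2 * Real.log (1 / (δ / (8 * K))))
      ≤ K / 2 * (124 / 10000 * y) := by gcongr
    _ ≤ q / 4 * (124 / 10000 * y) := by
        refine mul_le_mul_of_nonneg_right (by linarith) (by positivity)
    _ = _ := by rw [hNy]; ring

/-- `c₁² N ≥ 256 · 2.7725` exceeds 709, and `0.061` times this bound is just above `17.3 · 5/2`. -/
theorem regularizer (h : Calibration d K cx c₁ δ N T) :
    173 / 10 * (5 / 2 / c₁) ≤ 61 / 1000 * (cx * N) := by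
  have hc := h.c₁_pos
  have h1 := h.explore
  have h2 := h.log_ge
  have h3 : c₁ * N ≤ cx * N := by have := h.c₁_le_cx; gcongr
  rw [mul_div_assoc', div_le_iff₀ hc]
  have h4 : 61 / 1000 * (c₁ * N) * c₁ ≤ 61 / 1000 * (cx * N) * c₁ := by gcongr
  norm_num at h2
  nlinarith

theorem log_card_add (h : Calibration d K cx c₁ δ N T) :
    Real.log (1 / (δ / (8 * K))) ≤ K - 1 + Real.log ((4 * d + 4) / δ) := by
  have hK2 : (2 : ℝ) ≤ K := by exact_mod_cast h.two_le_K
  have hδ := h.δ_pos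
  have hd : (1 : ℝ) ≤ d := by exact_mod_cast h.one_le_d
  have : 1 / (δ / (8 * K)) = K * (8 / δ) := by field_simp
  rw [this, Real.log_mul (by positivity) (by positivity)]
  have h1 := Real.log_le_sub_one_of_pos (show (0 : ℝ) < K by linarith)
  have h2 : Real.log (8 / δ) ≤ Real.log ((4 * d + 4) / δ) := by
    refine Real.log_le_log (by positivity) ?_
    gcongr; linarith
  linarith

theorem variance (h : Calibration d K cx c₁ δ N T) :
    Real.exp (-(9 / 10000 * (N / K))) ≤ δ / (8 * K) := by
  obtain ⟨q, rfl, hq, hK, hn, -, hN⟩ := h.exists_inv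
  have hL := h.log_ge
  have hK2 : (2 : ℝ) ≤ K := by exact_mod_cast h.two_le_K
  have hδ := h.δ_pos
  have h1 := h.log_card_add
  rw [Real.exp_neg, inv_le_comm₀ (Real.exp_pos _) (by positivity), ← one_div,
    ← Real.log_le_iff_le_exp (by positivity)]
  refine h1.trans ?_
  set L := Real.log ((4 * d + 4) / δ)
  have h2 : 1024 * K * L ≤ N / K := by
    rw [le_div_iff₀ (by positivity)]
    have : (2 * (K : ℝ)) ^ 2 ≤ q ^ 2 := by gcongr
    nlinarith
  norm_num at hL
  nlinarith

/-- The covering number of the unit ball is dominated by the exponential rate. -/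
theorem covering (h : Calibration d K cx c₁ δ N T) {N' : ℕ} (hN' : N ≤ N') {E : ℝ}
    (hE : 64 / 10000 * N' * cx ≤ E) :
    ((1 + 2 / 100 * √(cx / (3 / 4))) / (2 / 100 * √(cx / (3 / 4)))) ^ d * Real.exp (-E) ≤
      δ / (8 * K) := by
  obtain ⟨q, hcq, hq, hK, hn, hdq, hN⟩ := h.exists_inv
  have hL := h.log_ge
  have hLe := h.le_log
  have hL8 := log_eight_gt
  have hK2 : (2 : ℝ) ≤ K := by exact_mod_cast h.two_le_K
  have hδ := h.δ_pos
  have h1 := h.log_card_add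
  have hd : (1 : ℝ) ≤ d := by exact_mod_cast h.one_le_d
  have hcx : 0 < cx := h.c₁_pos.trans_le h.c₁_le_cx
  have hcx' : cx ≤ 3 / 4 := by nlinarith [h.cx_mul_le]
  have hqcx : 1 ≤ cx * q := by
    have := h.c₁_le_cx
    rw [hcq, div_le_iff₀ (by linarith)] at this
    exact this
  set g := cx / (3 / 4) with hg
  have hg0 : 0 < g := by positivity
  have hg1 : g ≤ 1 := by rw [hg, div_le_one (by norm_num)]; exact hcx'
  have hsg : √g ≤ 1 := Real.sqrt_le_one.2 hg1
  have hsg0 : 0 < √g := Real.sqrt_pos.2 hg0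
  set L := Real.log ((4 * d + 4) / δ)
  set b := (1 + 2 / 100 * √g) / (2 / 100 * √g) with hb
  have hb0 : 0 < b := by positivity
  have hlogb : Real.log b ≤ 3.956 + Real.log (3 / 4 * q) / 2 := by
    have h2 : b ≤ 51 / √g := by
      rw [hb, div_le_div_iff₀ (by positivity) hsg0]
      nlinarith
    have h3 : Real.log b ≤ Real.log 51 - Real.log g / 2 := by
      have := Real.log_le_log hb0 h2
      rwa [Real.log_div (by norm_num) hsg0.ne', Real.log_sqrt hg0.le] at this
    have h4 : Real.log 51 ≤ 3.956 := by
      have := log_le_add_div_sub_one (r := 2 ^ 6) (u := 51) (by norm_num) (by norm_num)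
      rw [log_two_pow] at this
      have h5 := Real.log_two_lt_d9
      norm_num at *
      linarith
    have h5 : -Real.log g ≤ Real.log (3 / 4 * q) := by
      rw [← Real.log_inv]
      refine Real.log_le_log (by positivity) ?_
      rw [hg, inv_div, div_le_iff₀ hcx]
      nlinarith
    linarith
  -- Taking the tangent at `d` makes `d log q` a multiple of `q` plus `d log d`, and `log d` is
  -- absorbed by `L`.
  have hq' : Real.log (3 / 4 * q) ≤ Real.log d + 3 / 4 * q / d - 1 :=
    log_le_add_div_sub_one (by linarith) (by positivity)
  have hdlogb : d * Real.log b ≤ q * (2.97 + 3 / 8 * (L - 2.0794415)) := by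
    have h2 : Real.log d ≤ L - 2.0794415 := by
      have : Real.log d ≤ Real.log (d + 1) := Real.log_le_log (by positivity) (by linarith)
      linarith
    have h3 : d * Real.log b ≤ d * (3.456 + (L - 2.0794415) / 2 + 3 / 8 * q / d) := by
      refine mul_le_mul_of_nonneg_left ?_ (by linarith)
      have : 3 / 8 * q / d = 3 / 4 * q / d / 2 := by ring
      rw [this]
      norm_num at *
      linarith
    have h4 : d * (3.456 + (L - 2.0794415) / 2 + 3 / 8 * q / d) =
        d * (3.456 + (L - 2.0794415) / 2) + 3 / 8 * q := by field_simp
    rw [h4] at h3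
    refine h3.trans ?_
    have h5 : d * (3.456 + (L - 2.0794415) / 2) ≤ 3 / 4 * q * (3.456 + (L - 2.0794415) / 2) := by
      refine mul_le_mul_of_nonneg_right (by linarith) ?_
      norm_num at *; linarith
    norm_num at *
    linarith
  have hE2 : 1.638 * L * q ≤ E := by
    refine le_trans ?_ hE
    have h2 : (N : ℝ) ≤ N' := by exact_mod_cast hN'
    have h3 : 256 * L * q ^ 2 * cx ≤ N' * cx := by
      refine mul_le_mul_of_nonneg_right (hN.trans h2) hcx.le
    have h5 : 0 ≤ L * q := by positivity
    have h4 : L * q ≤ L * q * (cx * q) := le_mul_of_one_le_right h5 hqcx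
    norm_num
    linarith
  have hfin : d * Real.log b + Real.log (1 / (δ / (8 * K))) ≤ E := by
    norm_num at hdlogb hE2 hL
    have h2 : 47 / 100 * L * q ≤ E - d * Real.log b := by
      have h3 : 0 ≤ q * (793 / 1000 * L - 2.1904) := by
        refine mul_nonneg (by linarith) ?_
        norm_num; linarith
      have h5 : 0 ≤ q := by linarith
      norm_num at h3
      linarith
    have h3 : 47 / 100 * L * (2 * K) ≤ 47 / 100 * L * q := by gcongr
    have h4 : 0 ≤ (L - 2) * (K - 2) := mul_nonneg (by linarith) (by linarith)
    linarith
  have h6 : b ^ d = Real.exp (d * Real.log b) := by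
    rw [mul_comm, Real.exp_mul, Real.exp_log hb0, Real.rpow_natCast]
  have h7 : δ / (8 * K) = Real.exp (-Real.log (1 / (δ / (8 * K)))) := by
    rw [one_div, Real.log_inv, neg_neg, Real.exp_log (by positivity)]
  rw [h6, ← Real.exp_add, h7]
  exact Real.exp_le_exp.2 (by linarith)

end Calibration

end Calibration

end UCR

namespace UCR

/-! ### Confidence radii and the final constant. -/

section Rates

/-- The squared tuning parameter, up to the factor `3 σ² / κ²`. -/
noncomputable def tuningSq (d : ℕ) (δ : ℝ) (T : ℕ) : ℝ :=
  (d + 1) * Real.log (1 + 2 * T / d) + Real.log (2 / δ)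

/-- The squared self-normalized radius of the noise, up to the factor `σ²`. -/
noncomputable def noiseSq (d K : ℕ) (δ : ℝ) (T : ℕ) : ℝ :=
  (d + 1) * Real.log (1 + T / (d + 1)) + 2 * Real.log (1 / (δ / (2 * K)))

variable {d K : ℕ} {cx c₁ δ : ℝ} {N T : ℕ}

namespace Calibration

theorem le_mul_inv (h : Calibration d K cx c₁ δ N T) : 141 ≤ c₁ * N / 20 ∧
    70 * K ≤ c₁ * N / 20 ∧ 51 * Real.log ((4 * d + 4) / δ) ≤ c₁ * N / 20 ∧
      2800 ≤ c₁ * N := by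
  obtain ⟨q, rfl, hq, hK, hn, hdq, hN⟩ := h.exists_inv
  have hL := h.log_ge
  set L := Real.log ((4 * d + 4) / δ)
  have h1 : 256 * L * q ≤ 1 / q * N := by
    rw [one_div, inv_mul_eq_div, le_div_iff₀ (by linarith)]
    linarith
  norm_num at hL
  refine ⟨?_, ?_, ?_, ?_⟩ <;> nlinarith

theorem lam_pos (h : Calibration d K cx c₁ δ N T) : 0 < c₁ * N / 20 := by
  linarith [h.le_mul_inv.1]

theorem horizon_ge (h : Calibration d K cx c₁ δ N T) :
    11000 < (T : ℝ) ∧ 1800 * K * d ≤ (T : ℝ) ∧ 700 * (d + 1) * d ≤ (T : ℝ) ∧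
      2800 * K ^ 2 ≤ (T : ℝ) := by
  obtain ⟨q, -, hq, hK, hn, hdq, hN⟩ := h.exists_inv
  have hL := h.log_ge
  have hd : (1 : ℝ) ≤ d := by exact_mod_cast h.one_le_d
  have hK2 : (2 : ℝ) ≤ K := by exact_mod_cast h.two_le_K
  have hNT : (N : ℝ) ≤ T := by exact_mod_cast (Nat.le_succ N).trans h.lt_horizon
  have hN0 := h.N_pos
  have h1 : 709 * q ^ 2 ≤ (T : ℝ) := by
    norm_num at hL
    have : 709 * q ^ 2 ≤ 256 * Real.log ((4 * d + 4) / δ) * q ^ 2 := by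
      gcongr; linarith
    linarith
  have h2 : (2 * (K : ℝ)) * (4 / 3 * d) ≤ q ^ 2 := by rw [sq]; gcongr
  have h3 : ((d : ℝ) + 1) * d ≤ q ^ 2 := by rw [sq]; gcongr; linarith
  have h4 : (2 * (K : ℝ)) ^ 2 ≤ q ^ 2 := by gcongr
  refine ⟨by linarith, by linarith, by nlinarith, by linarith⟩

theorem log_two_div_le (h : Calibration d K cx c₁ δ N T) :
    Real.log (2 / δ) ≤ Real.log ((4 * d + 4) / δ) := by
  have hδ := h.δ_pos
  have : (0 : ℝ) ≤ d := Nat.cast_nonneg _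
  refine Real.log_le_log (by positivity) ?_
  gcongr; linarith

theorem log_union (h : Calibration d K cx c₁ δ N T) :
    Real.log (1 / (δ / (2 * K))) = Real.log (2 / δ) + Real.log K := by
  have hK2 : (2 : ℝ) ≤ K := by exact_mod_cast h.two_le_K
  have hδ := h.δ_pos
  rw [← Real.log_mul (by positivity) (by positivity)]
  congr 1; field_simp

theorem noiseSq_nonneg (h : Calibration d K cx c₁ δ N T) : 0 ≤ noiseSq d K δ T := by
  have hK2 : (2 : ℝ) ≤ K := by exact_mod_cast h.two_le_K
  have hδ := h.δ_pos
  rw [noiseSq, h.log_union]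
  have h1 : 0 ≤ Real.log (1 + T / ((d : ℝ) + 1)) :=
    Real.log_nonneg (by linarith [show (0 : ℝ) ≤ T / ((d : ℝ) + 1) by positivity])
  have h2 : 0 ≤ Real.log (2 / δ) := Real.log_nonneg (by
    rw [le_div_iff₀ hδ]; linarith [h.δ_lt])
  have h3 : 0 ≤ Real.log K := Real.log_nonneg (by linarith)
  positivity

/-- The confidence radius of the estimates is below the tuning parameter. -/
theorem noiseSq_le (h : Calibration d K cx c₁ δ N T) :
    (1 + 1 / (c₁ * N / 20)) * noiseSq d K δ T ≤ 2 * tuningSq d δ T := by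
  obtain ⟨hlam1, hlamK, hlamL, -⟩ := h.le_mul_inv
  obtain ⟨-, hT, -⟩ := h.horizon_ge
  have hd : (1 : ℝ) ≤ d := by exact_mod_cast h.one_le_d
  have hK2 : (2 : ℝ) ≤ K := by exact_mod_cast h.two_le_K
  have hδ := h.δ_pos
  set lam := c₁ * N / 20
  have hD := h.log_two_div_le
  rw [noiseSq, tuningSq, h.log_union]
  have hlam0 : 0 < lam := by linarith
  have hTd : 1800 * K ≤ (T : ℝ) / d := by rw [le_div_iff₀ (by linarith)]; exact hT
  have hmon : Real.log (1 + T / ((d : ℝ) + 1)) ≤ Real.log (1 + 2 * T / d) := by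
    refine Real.log_le_log (by positivity) ?_
    have : (T : ℝ) / (d + 1) ≤ T / d := by gcongr; linarith
    rw [mul_div_assoc]; linarith
  have hX : Real.log K + 8 * Real.log 2 ≤ Real.log (1 + 2 * T / d) := by
    have h8 := log_two_pow 8
    push_cast at h8
    rw [← h8, ← Real.log_mul (by positivity) (by positivity)]
    refine Real.log_le_log (by positivity) ?_
    rw [mul_div_assoc]; linarith
  have h2 := Real.log_two_gt_d9
  norm_num at h2
  have hK1 : Real.log K ≤ K := (Real.log_le_sub_one_of_pos (by linarith)).trans (by linarith)
  have hK0 : 0 ≤ Real.log K := Real.log_nonneg (by linarith)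
  set X := ((d : ℝ) + 1) * Real.log (1 + 2 * T / d) with hXdef
  -- The factor `d + 1 ≥ 2` doubles `hX`, and `16 log 2 > 11`. This margin pays for the union over
  -- the items and for the term in `1 / lam`.
  have hX2 : 2 * Real.log K + 11 ≤ X := by nlinarith
  have hmon' : ((d : ℝ) + 1) * Real.log (1 + T / ((d : ℝ) + 1)) ≤ X := by
    rw [hXdef]; gcongr
  have h3 : X + 2 * Real.log K + 2 * Real.log (2 / δ) ≤ lam * (X - 2 * Real.log K) := by
    have h4 : 0 ≤ (lam - 1) * (X - (2 * Real.log K + 11)) :=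
      mul_nonneg (by linarith) (by linarith)
    linarith
  have h4 : (X + 2 * Real.log K + 2 * Real.log (2 / δ)) / lam ≤ X - 2 * Real.log K := by
    rw [div_le_iff₀ hlam0]; linarith
  have h5 : (1 + 1 / lam) * (((d : ℝ) + 1) * Real.log (1 + T / ((d : ℝ) + 1)) +
      2 * (Real.log (2 / δ) + Real.log K)) ≤
      (1 + 1 / lam) * (X + 2 * Real.log K + 2 * Real.log (2 / δ)) := by
    refine mul_le_mul_of_nonneg_left (by linarith) (by positivity)
  refine h5.trans ?_
  rw [add_mul, one_div_mul_eq_div]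
  linarith

theorem log_rate_eq (h : Calibration d K cx c₁ δ N T) :
    Real.log (T / (d * δ)) = Real.log (T / d) + Real.log (1 / δ) := by
  have hd : (1 : ℝ) ≤ d := by exact_mod_cast h.one_le_d
  have hT := h.horizon_ge.1
  have hδ := h.δ_pos
  rw [← Real.log_mul (by positivity) (by positivity)]
  congr 1; field_simp

theorem log_one_div_ge (h : Calibration d K cx c₁ δ N T) :
    Real.log 2 ≤ Real.log (1 / δ) := by
  have hδ := h.δ_pos
  refine Real.log_le_log (by norm_num) ?_
  rw [le_div_iff₀ hδ]; linarith [h.δ_lt]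

theorem tuningSq_le (h : Calibration d K cx c₁ δ N T) :
    tuningSq d δ T ≤ (d + 1) * Real.log (T / (d * δ)) + 3 / 2 := by
  have hd : (1 : ℝ) ≤ d := by exact_mod_cast h.one_le_d
  obtain ⟨hT0, -, hT, -⟩ := h.horizon_ge
  have hδ := h.δ_pos
  have h1 := h.log_one_div_ge
  have h2 := Real.log_two_lt_d9
  rw [tuningSq, h.log_rate_eq]
  have h3 : Real.log (1 + 2 * T / d) ≤ Real.log (T / d) + Real.log 2 + d / (2 * T) := by
    have : 1 + 2 * (T : ℝ) / d = (T / d * 2) * (1 + d / (2 * T)) := by field_simp; ring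
    rw [this, Real.log_mul (by positivity) (by positivity), Real.log_mul (by positivity) (by norm_num)]
    have := Real.log_le_sub_one_of_pos (show 0 < 1 + (d : ℝ) / (2 * T) by positivity)
    linarith
  have h4 : ((d : ℝ) + 1) * (d / (2 * T)) ≤ 1 / 1400 := by
    rw [mul_div_assoc', div_le_div_iff₀ (by positivity) (by norm_num)]
    linarith
  have h5 : Real.log (2 / δ) = Real.log 2 + Real.log (1 / δ) := by
    rw [← Real.log_mul (by norm_num) (by positivity)]; congr 1; field_simp
  have h6 : ((d : ℝ) + 1) * Real.log (1 + 2 * T / d) ≤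
      (d + 1) * (Real.log (T / d) + Real.log 2 + d / (2 * T)) := by gcongr
  rw [h5]
  norm_num at h2
  nlinarith

theorem log_rate_ge (h : Calibration d K cx c₁ δ N T) : 8 ≤ Real.log (T / (d * δ)) := by
  have hd : (1 : ℝ) ≤ d := by exact_mod_cast h.one_le_d
  have hK2 : (2 : ℝ) ≤ K := by exact_mod_cast h.two_le_K
  obtain ⟨hT0, hT, -, -⟩ := h.horizon_ge
  have h1 := h.log_one_div_ge
  have h2 := Real.log_two_gt_d9
  rw [h.log_rate_eq]
  have h3 : Real.log (2 ^ 11) ≤ Real.log (T / d) := by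
    refine Real.log_le_log (by positivity) ?_
    rw [le_div_iff₀ (by linarith)]
    nlinarith
  rw [log_two_pow] at h3
  norm_num at h2 h3
  linarith

/-- A third of the main term absorbs the union cost `2 log K`, because `T ≥ 2800 K²`. The confidence
terms are at most `4 log (1/δ)`, since `δ < 1/2`, and 4 is at most `4 (d + 1) / 3`. -/
theorem noiseSq_le_of_two_le (h : Calibration d K cx c₁ δ N T) (hd2 : 2 ≤ d) :
    noiseSq d K δ T ≤ 4 / 3 * ((d + 1) * Real.log (T / (d * δ))) := by
  have hd : (2 : ℝ) ≤ d := by exact_mod_cast hd2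
  have hK2 : (2 : ℝ) ≤ K := by exact_mod_cast h.two_le_K
  obtain ⟨hT0, hTK, hT, hTK2⟩ := h.horizon_ge
  have hδ := h.δ_pos
  have h1 := h.log_one_div_ge
  have hl2 := Real.log_two_gt_d9
  rw [noiseSq, h.log_union, h.log_rate_eq]
  have h5 : Real.log (2 / δ) = Real.log 2 + Real.log (1 / δ) := by
    rw [← Real.log_mul (by norm_num) (by positivity)]; congr 1; field_simp
  have h2 : Real.log (1 + T / ((d : ℝ) + 1)) ≤ Real.log (T / d) := by
    refine Real.log_le_log (by positivity) ?_
    have : (T : ℝ) / d - T / (d + 1) = T / ((d + 1) * d) := by field_simp; ring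
    have h3 : 1 ≤ (T : ℝ) / ((d + 1) * d) := by
      rw [le_div_iff₀ (by positivity)]
      nlinarith
    linarith
  have h2' : ((d : ℝ) + 1) * Real.log (1 + T / ((d : ℝ) + 1)) ≤ (d + 1) * Real.log (T / d) := by
    gcongr
  have h3 : 2 * Real.log K ≤ ((d : ℝ) + 1) / 3 * Real.log (T / d) := by
    rcases le_or_gt (d : ℝ) 5 with h4 | h4
    · have h6 : 2 * Real.log K ≤ Real.log (T / d) := by
        rw [← Nat.cast_two, ← Real.log_pow]
        refine Real.log_le_log (by positivity) ?_
        rw [le_div_iff₀ (by linarith)]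
        nlinarith [sq_nonneg (K : ℝ)]
      have h7 : 0 ≤ Real.log K := Real.log_nonneg (by linarith)
      nlinarith
    · have h6 : Real.log K ≤ Real.log (T / d) := by
        refine Real.log_le_log (by positivity) ?_
        rw [le_div_iff₀ (by linarith)]
        nlinarith
      have h7 : 0 ≤ Real.log K := Real.log_nonneg (by linarith)
      nlinarith
  rw [h5]
  norm_num at hl2
  nlinarith

theorem noiseSq_le_of_eq_one (h : Calibration 1 K cx c₁ δ N T) :
    noiseSq 1 K δ T ≤ 3 * Real.log (T / δ) := by
  have hK2 : (2 : ℝ) ≤ K := by exact_mod_cast h.two_le_K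
  obtain ⟨hT0, -, -, hTK2⟩ := h.horizon_ge
  have hδ := h.δ_pos
  have h1 := h.log_one_div_ge
  have hl2 := Real.log_two_gt_d9
  have hw := h.log_rate_eq
  rw [noiseSq, h.log_union]
  simp only [Nat.cast_one, one_mul, div_one] at hw ⊢
  rw [hw]
  have h5 : Real.log (2 / δ) = Real.log 2 + Real.log (1 / δ) := by
    rw [← Real.log_mul (by norm_num) (by positivity)]; congr 1; field_simp
  have h2 : Real.log (1 + T / ((1 : ℝ) + 1)) ≤ Real.log T - Real.log 2 + 1 / 1000 := by
    have : 1 + T / ((1 : ℝ) + 1) = T / 2 * (1 + 2 / T) := by field_simp; ring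
    rw [this, Real.log_mul (by positivity) (by positivity), Real.log_div (by positivity) (by norm_num)]
    have h3 := Real.log_le_sub_one_of_pos (show 0 < 1 + (2 : ℝ) / T by positivity)
    have h4 : (2 : ℝ) / T ≤ 1 / 1000 := by
      rw [div_le_div_iff₀ (by positivity) (by norm_num)]; linarith
    linarith
  have h3 : 2 * Real.log K ≤ Real.log T := by
    rw [← Nat.cast_two, ← Real.log_pow]
    refine Real.log_le_log (by positivity) ?_
    nlinarith [sq_nonneg (K : ℝ)]
  rw [h5]
  norm_num at hl2 h1 h2 ⊢
  linarith

theorem sqrt_factor_le (h : Calibration d K cx c₁ δ N T) :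
    1 + 1 / (c₁ * N / 20) ≤ 10071 / 10000 := by
  have := h.le_mul_inv.1
  have : 1 / (c₁ * N / 20) ≤ 1 / 141 := by gcongr
  norm_num at *
  linarith

/-- For `d ≥ 2`, `5 d ≥ (10/3) (d + 1)`, and the three factors multiply to about `3.22 (d + 1)`
times the logarithm. -/
theorem rate_of_two_le (h : Calibration d K cx c₁ δ N T) (hd2 : 2 ≤ d) :
    (√(3 * tuningSq d δ T) + 50 / 41 * √((1 + 1 / (c₁ * N / 20)) * noiseSq d K δ T)) *
      √((1 + 1 / (c₁ * N / 20)) * ((d + 1) * Real.log (T / (d * δ)))) ≤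
      5 * d * Real.log (T / (d * δ)) := by
  have hd : (2 : ℝ) ≤ d := by exact_mod_cast hd2
  have hs := h.sqrt_factor_le
  have hs0 : 0 ≤ 1 + 1 / (c₁ * N / 20) := by have := h.lam_pos; positivity
  have hw := h.log_rate_ge
  have hB := h.tuningSq_le
  have hQ := h.noiseSq_le_of_two_le hd2
  have hQ0 := h.noiseSq_nonneg
  set s := 1 + 1 / (c₁ * N / 20)
  set w := Real.log (T / (d * δ))
  set y := ((d : ℝ) + 1) * w with hy
  have hy24 : 24 ≤ y := by nlinarith
  have h1 : √(3 * tuningSq d δ T) ≤ 1789 / 1000 * √y := by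
    rw [Real.sqrt_le_left (by positivity), mul_pow, Real.sq_sqrt (by linarith)]
    linarith
  have h2 : √(s * noiseSq d K δ T) ≤ 1159 / 1000 * √y := by
    rw [Real.sqrt_le_left (by positivity), mul_pow, Real.sq_sqrt (by linarith)]
    have : s * noiseSq d K δ T ≤ 10071 / 10000 * (4 / 3 * y) := by gcongr
    linarith
  have h3 : √(s * y) ≤ 1004 / 1000 * √y := by
    rw [Real.sqrt_le_left (by positivity), mul_pow, Real.sq_sqrt (by linarith)]
    nlinarith
  calc (√(3 * tuningSq d δ T) + 50 / 41 * √(s * noiseSq d K δ T)) * √(s * y)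
      ≤ (1789 / 1000 * √y + 50 / 41 * (1159 / 1000 * √y)) * (1004 / 1000 * √y) := by gcongr
    _ = (1789 / 1000 + 50 / 41 * (1159 / 1000)) * (1004 / 1000) * (√y * √y) := by ring
    _ = (1789 / 1000 + 50 / 41 * (1159 / 1000)) * (1004 / 1000) * y := by
        rw [Real.mul_self_sqrt (by linarith)]
    _ ≤ 5 * d * w := by rw [hy]; nlinarith

/-- Here `d + 1 = 2 d` would leave too large a constant, so the two square roots are the
contributions of a short early block, with log-determinant growth `2 w`, and of all later rounds,
with growth `w` only. The product of the constants is about `4.92`. -/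
theorem rate_of_eq_one (h : Calibration 1 K cx c₁ δ N T) :
    (√(3 * tuningSq 1 δ T) + 50 / 41 * √((1 + 1 / (c₁ * N / 20)) * noiseSq 1 K δ T)) *
      (√((T / 1000 + 2) * ((1 + 1 / (c₁ * N / 20)) * (2 * Real.log (T / δ)))) +
        √(T * ((1 + 1 / (c₁ * N / 20)) * Real.log (T / δ)))) ≤
      5 * √T * Real.log (T / δ) := by
  have hs := h.sqrt_factor_le
  have hs0 : 0 ≤ 1 + 1 / (c₁ * N / 20) := by have := h.lam_pos; positivity
  have hδ := h.δ_pos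
  have hT := h.horizon_ge.1
  have hw : 97 / 10 ≤ Real.log (T / δ) := by
    have h3 : Real.log (2 ^ 14) ≤ Real.log (T / δ) := by
      refine Real.log_le_log (by positivity) ?_
      rw [le_div_iff₀ hδ]
      nlinarith [h.δ_lt]
    rw [log_two_pow] at h3
    have h2 := Real.log_two_gt_d9
    norm_num at h2 h3 ⊢
    linarith
  have hB := h.tuningSq_le
  have hQ := h.noiseSq_le_of_eq_one
  have hQ0 := h.noiseSq_nonneg
  simp only [Nat.cast_one, one_mul] at hB
  set s := 1 + 1 / (c₁ * N / 20)
  set w := Real.log (T / δ)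
  have hw0 : 0 ≤ w := by linarith
  have h1 : √(3 * tuningSq 1 δ T) ≤ 2544 / 1000 * √w := by
    rw [Real.sqrt_le_left (by positivity), mul_pow, Real.sq_sqrt hw0]
    linarith
  have h2 : √(s * noiseSq 1 K δ T) ≤ 1739 / 1000 * √w := by
    rw [Real.sqrt_le_left (by positivity), mul_pow, Real.sq_sqrt hw0]
    have : s * noiseSq 1 K δ T ≤ 10071 / 10000 * (3 * w) := by gcongr
    linarith
  have h3 : √(T * (s * w)) ≤ 1004 / 1000 * (√T * √w) := by
    rw [Real.sqrt_le_left (by positivity), mul_pow, mul_pow, Real.sq_sqrt hw0,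
      Real.sq_sqrt (by linarith)]
    have : T * (s * w) ≤ T * (10071 / 10000 * w) := by gcongr
    have : 0 ≤ T * w := by positivity
    linarith
  have h4 : √((T / 1000 + 2) * (s * (2 * w))) ≤ 50 / 1000 * (√T * √w) := by
    rw [Real.sqrt_le_left (by positivity), mul_pow, mul_pow, Real.sq_sqrt hw0,
      Real.sq_sqrt (by linarith)]
    have : (T / 1000 + 2) * (s * (2 * w)) ≤ (12 / 10000 * T) * (10071 / 10000 * (2 * w)) := by
      gcongr; linarith
    have : 0 ≤ T * w := by positivity
    linarith
  calc _ ≤ (2544 / 1000 * √w + 50 / 41 * (1739 / 1000 * √w)) *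
        (50 / 1000 * (√T * √w) + 1004 / 1000 * (√T * √w)) := by gcongr
    _ = (2544 / 1000 + 50 / 41 * (1739 / 1000)) * (1054 / 1000) * (√T * (√w * √w)) := by ring
    _ = (2544 / 1000 + 50 / 41 * (1739 / 1000)) * (1054 / 1000) * (√T * w) := by
        rw [Real.mul_self_sqrt hw0]
    _ ≤ 5 * √T * w := by
        have : 0 ≤ √T * w := by positivity
        linarith

/-- In dimension one, the log-determinant grows by at most the logarithmic rate in the late
rounds. -/
theorem log_det_late (h : Calibration 1 K cx c₁ δ N T) {v t D₀ D₁ : ℝ} (hv : 1 / 16 ≤ v)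
    (ht : T ≤ 1000 * t) (hD₁ : 0 < D₁) (hD₁' : D₁ ≤ T / 4 * (3 / 4 * T))
    (hD₀ : 91 / 100 * (v * N) * (82 / 100 * t * cx) ≤ D₀) :
    Real.log D₁ - Real.log D₀ ≤ Real.log (T / δ) := by
  have hδ := h.δ_pos
  have hT := h.horizon_ge.1
  have hcN : 2800 ≤ cx * N := by
    have := h.le_mul_inv.2.2.2
    have h2 := h.c₁_le_cx
    have : c₁ * N ≤ cx * N := by gcongr
    linarith
  have ht0 : 0 < t := by linarith
  have h1 : 1 / 16 * 2800 ≤ v * (cx * N) := by gcongr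
  have h2 : 1 / 16 * 2800 * t ≤ v * (cx * N) * t := by gcongr
  have h3 : 130 * t ≤ D₀ := by linarith
  have hD₀0 : 0 < D₀ := by linarith
  -- `D₁` is of order `T²`, `D₀` at least `130 t` with `t ≥ T / 1000`; using `δ < 1/2`, the
  -- comparison is `93.75 ≤ 130`.
  have h4 : D₁ ≤ D₀ * (T / δ) := by
    refine hD₁'.trans ?_
    rw [mul_div_assoc', le_div_iff₀ hδ]
    have h5 : T / 4 * (3 / 4 * T) * δ ≤ T / 4 * (3 / 4 * (1000 * t)) * (1 / 2) := by
      gcongr; exact h.δ_lt.le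
    have h6 : 130 * t * T ≤ D₀ * T := by gcongr
    have : 0 ≤ (T : ℝ) * t := by positivity
    linarith
  have := Real.log_le_log hD₁ h4
  rw [Real.log_mul (by positivity) (by positivity)] at this
  linarith

end Calibration

end Rates

end UCR

namespace UCR

/-! ### Position and context components of features and parameters. -/

section Features

variable {d K : ℕ}

/-- The encoding `k / K - 1 / 2` of the position `k`. -/
noncomputable def posn (k : Fin K) : ℝ := ((k : ℕ) + 1 : ℝ) / (K : ℝ) - 1 / 2

/-- The context part of a parameter. -/
noncomputable def ctxPart (a : EuclideanSpace ℝ (Fin (d + 1))) : EuclideanSpace ℝ (Fin d) :=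
  WithLp.toLp 2 fun i => a i.succ

/-- The parameter with position part `α` and context part `b`. -/
noncomputable def join (α : ℝ) (b : EuclideanSpace ℝ (Fin d)) : EuclideanSpace ℝ (Fin (d + 1)) :=
  WithLp.toLp 2 (Fin.cons α fun i => b i)

theorem join_eta (a : EuclideanSpace ℝ (Fin (d + 1))) : join (a 0) (ctxPart a) = a := by
  ext i
  refine Fin.cases ?_ (fun i => ?_) i <;> simp [join, ctxPart]

theorem feature_eq_join (k : Fin K) (x : EuclideanSpace ℝ (Fin d)) :
    feature k x = join (posn k) x := rfl

theorem inner_join (α β : ℝ) (b x : EuclideanSpace ℝ (Fin d)) :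
    inner ℝ (join α b) (join β x) = α * β + inner ℝ b x := by
  simp [join, PiLp.inner_apply, Fin.sum_univ_succ, mul_comm]

theorem inner_feature (a : EuclideanSpace ℝ (Fin (d + 1))) (k : Fin K)
    (x : EuclideanSpace ℝ (Fin d)) :
    inner ℝ a (feature k x) = a 0 * posn k + inner ℝ (ctxPart a) x := by
  rw [feature_eq_join]
  conv_lhs => rw [← join_eta a]
  rw [inner_join]

theorem norm_join_sq (α : ℝ) (b : EuclideanSpace ℝ (Fin d)) :
    ‖join α b‖ ^ 2 = α ^ 2 + ‖b‖ ^ 2 := by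
  rw [← real_inner_self_eq_norm_sq, inner_join, real_inner_self_eq_norm_sq, ← sq]

theorem norm_sq_eq (a : EuclideanSpace ℝ (Fin (d + 1))) :
    ‖a‖ ^ 2 = a 0 ^ 2 + ‖ctxPart a‖ ^ 2 := by
  conv_lhs => rw [← join_eta a]
  rw [norm_join_sq]

theorem abs_posn_le (k : Fin K) : |posn k| ≤ 1 / 2 := by
  have hk : (k : ℝ) + 1 ≤ K := by exact_mod_cast k.2
  have hK : (0 : ℝ) < K := by linarith [show (0 : ℝ) ≤ (k : ℕ) from Nat.cast_nonneg _]
  have h1 : ((k : ℕ) + 1 : ℝ) / K ≤ 1 := by rw [div_le_one hK]; exact hk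
  have h2 : 0 ≤ ((k : ℕ) + 1 : ℝ) / K := by positivity
  rw [posn, abs_le]
  constructor <;> linarith

theorem norm_feature_le (k : Fin K) {x : EuclideanSpace ℝ (Fin d)} (hx : ‖x‖ ≤ √3 / 2) :
    ‖feature k x‖ ≤ 1 := by
  rw [feature_eq_join, ← abs_of_nonneg (norm_nonneg (join (posn k) x)), ← sq_le_one_iff_abs_le_one,
    norm_join_sq]
  have h1 : posn k ^ 2 ≤ (1 / 2) ^ 2 := sq_le_sq.2 (by simpa using abs_posn_le k)
  have h2 : ‖x‖ ^ 2 ≤ (√3 / 2) ^ 2 := by gcongr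
  rw [div_pow, Real.sq_sqrt (by norm_num)] at h2
  linarith

end Features

/-! ### Consequences of representative randomized rounds for one item. -/

section Item

variable {d K : ℕ}

/-- The variance of the position of an item in a uniform ranking. -/
noncomputable def posVar (K : ℕ) : ℝ := ((K : ℝ) ^ 2 - 1) / (12 * K ^ 2)

theorem posVar_ge (hK : 2 ≤ K) : 1 / 16 ≤ posVar K := by
  have h : (2 : ℝ) ≤ K := by exact_mod_cast hK
  rw [posVar, div_le_div_iff₀ (by norm_num) (by positivity)]
  nlinarith

theorem posVar_ge_of_three_le (hK : 3 ≤ K) : 2 / 27 ≤ posVar K := by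
  have h : (3 : ℝ) ≤ K := by exact_mod_cast hK
  rw [posVar, div_le_div_iff₀ (by norm_num) (by positivity)]
  nlinarith

theorem sq_posMean_le (hK : 2 ≤ K) : (1 / (2 * (K : ℝ))) ^ 2 ≤ posVar K := by
  have h : (2 : ℝ) ≤ K := by exact_mod_cast hK
  rw [posVar, div_pow, div_le_div_iff₀ (by positivity) (by positivity)]
  have : 4 ≤ (K : ℝ) ^ 2 := by nlinarith
  have h2 : 0 ≤ (K : ℝ) ^ 2 := by positivity
  nlinarith

/-- The rounds `1, …, N` of randomized positions `k` and contexts `x` of one item are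
representative. -/
structure GoodExploration (k : ℕ → Fin K) (x : ℕ → EuclideanSpace ℝ (Fin d)) (cx c₁ : ℝ)
    (N : ℕ) : Prop where
  cross : ∀ (α : ℝ) (b : EuclideanSpace ℝ (Fin d)),
    (∑ s ∈ Finset.Ico 1 (N + 1), (inner ℝ b (x s) + α * (1 / (2 * (K : ℝ)))) *
      (posn (k s) - 1 / (2 * (K : ℝ)))) ^ 2 ≤
    31 / 10000 * (posVar K * N) *
      (∑ s ∈ Finset.Ico 1 (N + 1), (inner ℝ b (x s) + α * (1 / (2 * (K : ℝ)))) ^ 2 +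
        5 / 2 / c₁ * (α ^ 2 + ‖b‖ ^ 2))
  variance : 97 / 100 * (posVar K * N) ≤
    ∑ s ∈ Finset.Ico 1 (N + 1), (posn (k s) - 1 / (2 * (K : ℝ))) ^ 2
  context : 3 ≤ K → ∀ b : EuclideanSpace ℝ (Fin d),
    82 / 100 * N * cx * ‖b‖ ^ 2 ≤ ∑ s ∈ Finset.Ico 1 (N + 1), (inner ℝ b (x s)) ^ 2
  context_two : K = 2 → ∀ b : EuclideanSpace ℝ (Fin d),
    38 / 100 * N * cx * ‖b‖ ^ 2 ≤
      ∑ s ∈ Finset.Ico 1 (N + 1) with posn (k s) = 0, (inner ℝ b (x s)) ^ 2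

namespace GoodExploration

variable {k : ℕ → Fin K} {x : ℕ → EuclideanSpace ℝ (Fin d)} {cx c₁ δ : ℝ} {N T : ℕ}

theorem context_le (h : GoodExploration k x cx c₁ N) (hcal : Calibration d K cx c₁ δ N T)
    (b : EuclideanSpace ℝ (Fin d)) :
    38 / 100 * N * cx * ‖b‖ ^ 2 ≤ ∑ s ∈ Finset.Ico 1 (N + 1), (inner ℝ b (x s)) ^ 2 := by
  have hcx : 0 < cx := hcal.c₁_pos.trans_le hcal.c₁_le_cx
  rcases hcal.two_le_K.eq_or_lt with h2 | h3
  · refine (h.context_two h2.symm b).trans ?_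
    exact Finset.sum_le_sum_of_subset_of_nonneg (Finset.filter_subset _ _)
      fun _ _ _ => sq_nonneg _
  · refine le_trans ?_ (h.context h3 b)
    gcongr; norm_num

theorem cx_le (hcal : Calibration d K cx c₁ δ N T) : cx ≤ 3 / 4 := by
  have hcx : 0 < cx := hcal.c₁_pos.trans_le hcal.c₁_le_cx
  have hd : (1 : ℝ) ≤ d := by exact_mod_cast hcal.one_le_d
  nlinarith [hcal.cx_mul_le]

theorem card_pos (hcal : Calibration d K cx c₁ δ N T) : 0 < (Finset.Ico 1 (N + 1)).card := by
  have := hcal.N_pos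
  rw [Nat.card_Ico, Nat.add_sub_cancel]
  have : (0 : ℝ) < N := by linarith
  exact_mod_cast this

theorem energy_le (h : GoodExploration k x cx c₁ N) (hcal : Calibration d K cx c₁ δ N T)
    (a : EuclideanSpace ℝ (Fin (d + 1))) :
    91 / 100 * energy (Finset.Ico 1 (N + 1)) (posVar K) (1 / (2 * (K : ℝ))) (a 0)
      (fun s => inner ℝ (ctxPart a) (x s)) ≤
    ∑ s ∈ Finset.Ico 1 (N + 1), (inner ℝ a (feature (k s) (x s))) ^ 2 := by
  have hcx : 0 < cx := hcal.c₁_pos.trans_le hcal.c₁_le_cx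
  have hcard : ((Finset.Ico 1 (N + 1)).card : ℝ) = N := by simp
  have := energy_le_gram (I := Finset.Ico 1 (N + 1)) (card_pos hcal) (α := a 0)
    (posVar_ge hcal.two_le_K) (sq_posMean_le hcal.two_le_K) hcx (cx_le hcal)
    (lam := 5 / 2 / c₁) (by have := hcal.c₁_pos; positivity) (sq_nonneg ‖ctxPart a‖)
    (fun s => posn (k s)) (fun s => inner ℝ (ctxPart a) (x s))
    (by rw [hcard]; exact h.context_le hcal _) (by rw [hcard]; exact hcal.regularizer)
    (x := 31 / 10000 * (posVar K * N)) (by rw [hcard]) (h.cross _ _)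
    (by rw [hcard]; exact h.variance)
  simpa only [inner_feature] using this

/-- Energy dominates both the norm and, up to 91/100, is dominated by the Gram form; `0.91 / 17.3 >
1/20`. -/
theorem norm_sq_le (h : GoodExploration k x cx c₁ N) (hcal : Calibration d K cx c₁ δ N T)
    (a : EuclideanSpace ℝ (Fin (d + 1))) :
    c₁ * N / 20 * ‖a‖ ^ 2 ≤
      ∑ s ∈ Finset.Ico 1 (N + 1), (inner ℝ a (feature (k s) (x s))) ^ 2 := by
  have hcard : ((Finset.Ico 1 (N + 1)).card : ℝ) = N := by simp
  have h1 := h.energy_le hcal a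
  have h2 := norm_sq_le_energy (I := Finset.Ico 1 (N + 1)) (card_pos hcal) (α := a 0)
    (posVar_ge hcal.two_le_K) (sq_posMean_le hcal.two_le_K) (cx_le hcal) (B := ‖ctxPart a‖ ^ 2)
    (fun s => inner ℝ (ctxPart a) (x s)) (by rw [hcard]; exact h.context_le hcal _)
  rw [hcard, ← norm_sq_eq] at h2
  have h3 : ‖a‖ ^ 2 * (c₁ * N) ≤ ‖a‖ ^ 2 * (cx * N) := by
    have := hcal.c₁_le_cx; gcongr
  have h4 : 0 ≤ ‖a‖ ^ 2 * (c₁ * N) := by have := hcal.c₁_pos; positivity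
  linarith

theorem gram_mono {z : ℕ → EuclideanSpace ℝ (Fin (d + 1))} {t₀ t₁ : ℕ} (h : t₀ ≤ t₁)
    (a : EuclideanSpace ℝ (Fin (d + 1))) :
    ∑ s ∈ Finset.Ico 1 t₀, (inner ℝ a (z s)) ^ 2 ≤ ∑ s ∈ Finset.Ico 1 t₁, (inner ℝ a (z s)) ^ 2 :=
  Finset.sum_le_sum_of_subset_of_nonneg (Finset.Ico_subset_Ico_right h) fun _ _ _ => sq_nonneg _

/-- On features of norm at most one, a parameter `(α, b)` takes values up to `|α|/2 + (√3/2)‖b‖`.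
For `K ≥ 3`, `c₁ ≤ 1/6` pushes this below `50/41`. For `K = 2` only `c₁ ≤ 1/4` holds, and the rounds
at the position encoded by zero, where `α` plays no role, make up for it. -/
theorem huber (h : GoodExploration k x cx c₁ N) (hcal : Calibration d K cx c₁ δ N T) {t : ℕ}
    (ht : N + 1 ≤ t) (hx : ∀ s ∈ Finset.Ico 1 t, ‖x s‖ ≤ √3 / 2) {ξ : ℝ}
    (hξ : ξ ^ 2 ≤ 5005 / 10000 * c₁ * N) (a : EuclideanSpace ℝ (Fin (d + 1)))
    (ha : ∑ s ∈ Finset.Ico 1 t, (inner ℝ a (feature (k s) (x s))) ^ 2 ≤ ξ ^ 2) :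
    41 / 50 * ∑ s ∈ Finset.Ico 1 t, (inner ℝ a (feature (k s) (x s))) ^ 2 ≤
      ∑ s ∈ Finset.Ico 1 t, min ((inner ℝ a (feature (k s) (x s))) ^ 2)
        |inner ℝ a (feature (k s) (x s))| := by
  have hcard : ((Finset.Ico 1 (N + 1)).card : ℝ) = N := by simp
  have hU := (h.energy_le hcal a).trans ((gram_mono ht a).trans ha)
  have hctx : ∀ s ∈ Finset.Ico 1 t, |inner ℝ (ctxPart a) (x s)| ≤ √3 / 2 * ‖ctxPart a‖ := by
    intro s hs
    refine (abs_real_inner_le_norm _ _).trans ?_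
    rw [mul_comm]
    exact mul_le_mul_of_nonneg_right (hx s hs) (norm_nonneg _)
  have hy : ∀ s ∈ Finset.Ico 1 t, |inner ℝ a (feature (k s) (x s))| ≤
      |a 0| / 2 + √3 / 2 * ‖ctxPart a‖ := by
    intro s hs
    rw [inner_feature]
    refine (abs_add_le _ _).trans (add_le_add ?_ (hctx s hs))
    rw [abs_mul]
    have := mul_le_mul_of_nonneg_left (abs_posn_le (k s)) (abs_nonneg (a 0))
    linarith
  rcases hcal.two_le_K.eq_or_lt with h2 | h3
  · have hc₁ : c₁ ≤ 1 / 4 := by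
      have := hcal.c₁_le
      rw [← h2] at this
      norm_num at this ⊢
      linarith
    refine huber_of_two_items (I := Finset.Ico 1 (N + 1))
      (I₀ := {s ∈ Finset.Ico 1 (N + 1) | posn (k s) = 0}) (card_pos hcal)
      (Finset.Ico_subset_Ico_right ht) (Finset.filter_subset _ _) (posVar_ge hcal.two_le_K)
      hcal.c₁_pos hc₁ hcal.c₁_le_cx _ (fun s => inner ℝ (ctxPart a) (x s)) (by rw [hcard]; exact hξ)
      hU hy ?_ ?_ ha
    · intro s hs
      have hs' := Finset.mem_filter.1 hs
      rw [inner_feature, hs'.2, mul_zero, zero_add]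
      exact hctx s (Finset.Ico_subset_Ico_right ht hs'.1)
    · rw [hcard]
      refine (h.context_two h2.symm _).trans (le_of_eq ?_)
      refine Finset.sum_congr rfl fun s hs => ?_
      rw [inner_feature, (Finset.mem_filter.1 hs).2, mul_zero, zero_add]
  · have hK3 : (3 : ℝ) ≤ K := by exact_mod_cast h3
    have hm : 1 / (2 * (K : ℝ)) ≤ 1 / 6 := by
      rw [div_le_div_iff₀ (by positivity) (by norm_num)]; linarith
    refine huber_of_abs_le _ fun s hs => (hy s hs).trans ?_
    exact abs_le_of_energy_le (card_pos hcal) (posVar_ge_of_three_le h3) (by positivity) hm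
      hcal.c₁_pos (hcal.c₁_le.trans hm) hcal.c₁_le_cx (norm_nonneg _) _
      (by rw [hcard]; exact h.context h3 _) (by rw [hcard]; exact hξ) hU

end GoodExploration

end Item

end UCR

namespace UCR

open Matrix

/-! ### Gram matrices, growth of determinants and sums of confidence widths. -/

section Gram

variable {d K : ℕ}

theorem inner_eq_dotProduct {n : ℕ} (a z : EuclideanSpace ℝ (Fin n)) :
    inner ℝ a z = a.ofLp ⬝ᵥ z.ofLp := by
  simp [PiLp.inner_apply, dotProduct, mul_comm]

/-- The Gram matrix of the vectors `z 1, …, z (t - 1)`. -/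
noncomputable def gram (z : ℕ → EuclideanSpace ℝ (Fin (d + 1))) (t : ℕ) :
    Matrix (Fin (d + 1)) (Fin (d + 1)) ℝ :=
  ∑ s ∈ Finset.Ico 1 t, vecMulVec (z s).ofLp (z s).ofLp

theorem gram_eq_regGram (z : ℕ → EuclideanSpace ℝ (Fin (d + 1))) (t : ℕ) :
    gram z t = regGram 0 (Finset.Ico 1 t) fun s => (z s).ofLp := by
  simp [gram, regGram]

theorem gram_form (z : ℕ → EuclideanSpace ℝ (Fin (d + 1))) (t : ℕ) (a : Fin (d + 1) → ℝ) :
    a ⬝ᵥ gram z t *ᵥ a = ∑ s ∈ Finset.Ico 1 t, (inner ℝ (WithLp.toLp 2 a) (z s)) ^ 2 := by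
  rw [gram_eq_regGram, regGram_form, zero_mul, zero_add]
  simp only [inner_eq_dotProduct]

theorem gram_succ (z : ℕ → EuclideanSpace ℝ (Fin (d + 1))) {t : ℕ} (ht : 1 ≤ t) :
    gram z (t + 1) = gram z t + vecMulVec (z t).ofLp (z t).ofLp :=
  Finset.sum_Ico_succ_top ht _

theorem gram_isHermitian (z : ℕ → EuclideanSpace ℝ (Fin (d + 1))) (t : ℕ) :
    (gram z t).IsHermitian := by
  rw [gram_eq_regGram]; exact regGram_isHermitian _ _ _

theorem gram_posDef {z : ℕ → EuclideanSpace ℝ (Fin (d + 1))} {t : ℕ} {lam : ℝ} (hlam : 0 < lam)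
    (h : ∀ a, lam * ‖a‖ ^ 2 ≤ ∑ s ∈ Finset.Ico 1 t, (inner ℝ a (z s)) ^ 2) :
    (gram z t).PosDef := by
  refine PosDef.of_dotProduct_mulVec_pos (gram_isHermitian z t) fun a ha => ?_
  rw [star_trivial, gram_form]
  refine lt_of_lt_of_le ?_ (h _)
  have : WithLp.toLp 2 a ≠ 0 := by simpa using ha
  have := norm_pos_iff.2 this
  positivity

/-- Duality between the Gram form and its inverse: an error inside the ellipsoid of radius `β`
shifts the predictor of `y` by at most `β` widths. -/
theorem abs_inner_le_invNorm {z : ℕ → EuclideanSpace ℝ (Fin (d + 1))} {t : ℕ}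
    (h : (gram z t).PosDef) (a y : EuclideanSpace ℝ (Fin (d + 1))) {β : ℝ} (hβ : 0 ≤ β)
    (ha : ∑ s ∈ Finset.Ico 1 t, (inner ℝ a (z s)) ^ 2 ≤ β ^ 2) :
    |inner ℝ a y| ≤ β * invNorm (gram z t) y := by
  have h1 := dotProduct_sq_le_of_posDef h a.ofLp y.ofLp
  rw [gram_form, ← inner_eq_dotProduct, WithLp.toLp_ofLp] at h1
  have h0 := inv_form_nonneg h y.ofLp
  have h2 : 0 ≤ invNorm (gram z t) y := Real.sqrt_nonneg _
  refine abs_le_of_sq_le_sq ?_ (by positivity)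
  rw [mul_pow, invNorm, Real.sq_sqrt h0]
  exact h1.trans (by gcongr)

variable {k : ℕ → Fin K} {x : ℕ → EuclideanSpace ℝ (Fin d)} {cx c₁ δ : ℝ} {N T : ℕ}

namespace GoodExploration

theorem norm_sq_le_of_le (h : GoodExploration k x cx c₁ N) (hcal : Calibration d K cx c₁ δ N T)
    {t : ℕ} (ht : N + 1 ≤ t) (a : EuclideanSpace ℝ (Fin (d + 1))) :
    c₁ * N / 20 * ‖a‖ ^ 2 ≤ ∑ s ∈ Finset.Ico 1 t, (inner ℝ a (feature (k s) (x s))) ^ 2 :=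
  (h.norm_sq_le hcal a).trans (gram_mono ht a)

theorem gram_posDef (h : GoodExploration k x cx c₁ N) (hcal : Calibration d K cx c₁ δ N T)
    {t : ℕ} (ht : N + 1 ≤ t) : (gram (fun s => feature (k s) (x s)) t).PosDef :=
  UCR.gram_posDef hcal.lam_pos (h.norm_sq_le_of_le hcal ht)

/-- Elliptical potential over a block of rounds after the exploration. -/
theorem sum_block_le (h : GoodExploration k x cx c₁ N) (hcal : Calibration d K cx c₁ δ N T)
    (hx : ∀ s ∈ Finset.Icc 1 T, ‖x s‖ ≤ √3 / 2) {t₀ t₁ : ℕ} (h0 : N + 1 ≤ t₀) (h01 : t₀ ≤ t₁)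
    (h1 : t₁ ≤ T + 1) {S c : ℝ} (hc : (t₁ : ℝ) - t₀ ≤ c)
    (hS : Real.log (gram (fun s => feature (k s) (x s)) t₁).det -
      Real.log (gram (fun s => feature (k s) (x s)) t₀).det ≤ S) :
    ∑ t ∈ Finset.Ico t₀ t₁, invNorm (gram (fun s => feature (k s) (x s)) t)
      (feature (k t) (x t)) ≤ √(c * ((1 + 1 / (c₁ * N / 20)) * S)) := by
  have hpd : ∀ t ∈ Finset.Ico t₀ t₁, (gram (fun s => feature (k s) (x s)) t).PosDef :=
    fun t ht => h.gram_posDef hcal (h0.trans (Finset.mem_Ico.1 ht).1)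
  refine sum_sqrt_le (fun t ht => inv_form_nonneg (hpd t ht) _) ?_ ?_
  · rw [Nat.card_Ico, Nat.cast_sub h01]; exact hc
  · refine (sum_inv_form_le h01 (W := gram fun s => feature (k s) (x s))
      (z := fun t => (feature (k t) (x t)).ofLp) (C := 1 / (c₁ * N / 20)) ?_ hpd ?_).trans ?_
    · intro t ht
      exact gram_succ _ (by have := (Finset.mem_Ico.1 ht).1; omega)
    · intro t ht
      have ht' := Finset.mem_Ico.1 ht
      refine inv_form_le_of_le (hpd t ht) hcal.lam_pos (fun a => ?_) ?_
      · rw [gram_form]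
        have := h.norm_sq_le_of_le hcal (h0.trans ht'.1) (WithLp.toLp 2 a)
        rwa [← real_inner_self_eq_norm_sq, inner_eq_dotProduct] at this
      · rw [← inner_eq_dotProduct, real_inner_self_eq_norm_sq]
        have := norm_feature_le (k t) (hx t (Finset.mem_Icc.2 ⟨by omega, by omega⟩))
        exact pow_le_one₀ (norm_nonneg _) this
    · have := hcal.lam_pos
      gcongr

/-- The trace bounds the final determinant by `(T / (d + 1))^(d + 1)`, the exploration bounds the
initial one below by `(c₁ N / 20)^(d + 1)`, and `c₁ N / 20 ≥ δ`. -/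
theorem log_det_diff_le (h : GoodExploration k x cx c₁ N) (hcal : Calibration d K cx c₁ δ N T)
    (hx : ∀ s ∈ Finset.Icc 1 T, ‖x s‖ ≤ √3 / 2) {t₁ : ℕ} (h01 : N + 1 ≤ t₁)
    (h1 : t₁ ≤ T + 1) :
    Real.log (gram (fun s => feature (k s) (x s)) t₁).det -
      Real.log (gram (fun s => feature (k s) (x s)) (N + 1)).det ≤
      (d + 1) * Real.log (T / (d * δ)) := by
  have hd : (1 : ℝ) ≤ d := by exact_mod_cast hcal.one_le_d
  have hT0 := hcal.horizon_ge.1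
  have hlam := hcal.lam_pos
  have hlam1 := hcal.le_mul_inv.1
  have hδ := hcal.δ_pos
  have hpd₁ := h.gram_posDef hcal h01
  have hpd₀ := h.gram_posDef hcal le_rfl
  have hup := log_det_le_of_posDef (Nat.succ_pos d) hpd₁
  have hlo := le_log_det_of_le hpd₀ hlam fun a => by
    rw [gram_form]
    have := h.norm_sq_le hcal (WithLp.toLp 2 a)
    rwa [← real_inner_self_eq_norm_sq, inner_eq_dotProduct] at this
  have htr0 : 0 < (gram (fun s => feature (k s) (x s)) t₁).trace := hpd₁.trace_pos
  have htr : (gram (fun s => feature (k s) (x s)) t₁).trace ≤ T := by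
    rw [gram_eq_regGram, regGram_trace, zero_mul, zero_add]
    calc _ ≤ ∑ s ∈ Finset.Ico 1 t₁, (1 : ℝ) := by
          refine Finset.sum_le_sum fun s hs => ?_
          have hs' := Finset.mem_Ico.1 hs
          rw [← inner_eq_dotProduct, real_inner_self_eq_norm_sq]
          exact pow_le_one₀ (norm_nonneg _)
            (norm_feature_le (k s) (hx s (Finset.mem_Icc.2 ⟨by omega, by omega⟩)))
      _ ≤ T := by
          rw [Finset.sum_const, Nat.card_Ico, nsmul_eq_mul, mul_one]
          exact_mod_cast (by omega)
  push_cast at hup hlo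
  have h2 : Real.log ((gram (fun s => feature (k s) (x s)) t₁).trace / (d + 1)) -
      Real.log (c₁ * N / 20) ≤ Real.log (T / (d * δ)) := by
    rw [← Real.log_div (by positivity) (by positivity)]
    refine Real.log_le_log (by positivity) ?_
    rw [div_div]
    have h3 : δ ≤ c₁ * N / 20 := by linarith [hcal.δ_lt]
    have h4 : (d : ℝ) ≤ d + 1 := by linarith
    gcongr
  have h3 : ((d : ℝ) + 1) * (Real.log ((gram (fun s => feature (k s) (x s)) t₁).trace / (d + 1)) -
      Real.log (c₁ * N / 20)) ≤ (d + 1) * Real.log (T / (d * δ)) := by gcongr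
  linarith

end GoodExploration

theorem gram_apply (z : ℕ → EuclideanSpace ℝ (Fin (d + 1))) (t : ℕ) (i j : Fin (d + 1)) :
    gram z t i j = ∑ s ∈ Finset.Ico 1 t, z s i * z s j := by
  simp [gram, Matrix.sum_apply, vecMulVec_apply]

/-- The last round of the early block of rounds in dimension one. -/
def earlyEnd (N T : ℕ) : ℕ := max N (T / 1000 + 1)

theorem GoodExploration.log_det_late {k : ℕ → Fin K} {x : ℕ → EuclideanSpace ℝ (Fin 1)}
    {cx c₁ δ : ℝ} {N T : ℕ}
    (h : GoodExploration k x cx c₁ N) (hcal : Calibration 1 K cx c₁ δ N T)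
    (hx : ∀ s ∈ Finset.Icc 1 T, ‖x s‖ ≤ √3 / 2)
    (hlate : ∀ b : EuclideanSpace ℝ (Fin 1), 82 / 100 * (earlyEnd N T) * cx * ‖b‖ ^ 2 ≤
      ∑ s ∈ Finset.Ico 1 (earlyEnd N T + 1), (inner ℝ b (x s)) ^ 2) :
    Real.log (gram (fun s => feature (k s) (x s)) (T + 1)).det -
      Real.log (gram (fun s => feature (k s) (x s)) (earlyEnd N T + 1)).det ≤
      Real.log (T / δ) := by
  have hNe : N ≤ earlyEnd N T := le_max_left _ _
  have hTe : T / 1000 + 1 ≤ earlyEnd N T := le_max_right _ _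
  -- The `+ 1` in `earlyEnd` compensates for the rounding down in `T / 1000`.
  have hTe' : (T : ℝ) ≤ 1000 * (earlyEnd N T) := by
    have : T ≤ 1000 * earlyEnd N T := by omega
    exact_mod_cast this
  have hT0 := hcal.horizon_ge.1
  have hcx : 0 < cx := hcal.c₁_pos.trans_le hcal.c₁_le_cx
  have hNT := hcal.lt_horizon
  have h00 : ∀ s, feature (k s) (x s) 0 = posn (k s) := fun s => rfl
  have h11 : ∀ s, feature (k s) (x s) 1 = x s 0 := fun s => rfl
  have hV11 : ∀ t, gram (fun s => feature (k s) (x s)) t 1 1 = ∑ s ∈ Finset.Ico 1 t, x s 0 ^ 2 := by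
    intro t
    rw [gram_apply]
    exact Finset.sum_congr rfl fun s _ => by rw [h11, sq]
  have hxs : ∀ s ∈ Finset.Icc 1 T, x s 0 ^ 2 ≤ 3 / 4 := by
    intro s hs
    have h1 : ‖x s‖ ^ 2 ≤ (√3 / 2) ^ 2 := by have := hx s hs; gcongr
    rw [div_pow, Real.sq_sqrt (by norm_num), EuclideanSpace.norm_sq_eq] at h1
    simp at h1
    linarith
  -- Above, the product of the diagonal entries bounds the determinant. Below, the energy bounds the
  -- Schur complement of the position direction, and the contexts alone bound the other diagonal
  -- entry.
  refine hcal.log_det_late (posVar_ge hcal.two_le_K) hTe'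
    (h.gram_posDef hcal (by omega)).det_pos ?_ ?_
  · refine (det_fin_two_le_mul (gram_isHermitian _ _)).trans ?_
    have hc : ∀ r : ℝ, ∑ s ∈ Finset.Ico 1 (T + 1), r = T * r := by
      intro r; simp
    have h1 : gram (fun s => feature (k s) (x s)) (T + 1) 0 0 ≤ T / 4 := by
      rw [gram_apply]
      refine (Finset.sum_le_sum (g := fun _ => (1 / 4 : ℝ)) fun s _ => ?_).trans
        (by rw [hc]; linarith)
      rw [h00, ← sq, ← sq_abs]
      have := abs_posn_le (k s)
      have h2 := abs_nonneg (posn (k s))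
      nlinarith
    have h2 : gram (fun s => feature (k s) (x s)) (T + 1) 1 1 ≤ 3 / 4 * T := by
      rw [hV11]
      refine (Finset.sum_le_sum (g := fun _ => (3 / 4 : ℝ)) fun s hs => hxs s ?_).trans
        (by rw [hc]; linarith)
      have := Finset.mem_Ico.1 hs
      exact Finset.mem_Icc.2 ⟨this.1, by omega⟩
    have h3 : 0 ≤ gram (fun s => feature (k s) (x s)) (T + 1) 1 1 := by
      rw [hV11]; exact Finset.sum_nonneg fun _ _ => sq_nonneg _
    gcongr
  · have h1 : 82 / 100 * (earlyEnd N T) * cx ≤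
        gram (fun s => feature (k s) (x s)) (earlyEnd N T + 1) 1 1 := by
      have := hlate (EuclideanSpace.single 0 1)
      rw [hV11]
      simpa [PiLp.inner_apply] using this
    have hv : 0 < posVar K := by linarith [posVar_ge hcal.two_le_K]
    have he : 0 < (earlyEnd N T : ℝ) := by linarith
    have hN0 : 0 < (N : ℝ) := by linarith [hcal.N_pos]
    have h2 := mul_le_det_fin_two (gram_isHermitian (fun s => feature (k s) (x s)) (earlyEnd N T + 1))
      (lt_of_lt_of_le (by positivity) h1) (r := 91 / 100 * (posVar K * N)) fun b => by
        rw [gram_form]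
        refine le_trans ?_ (gram_mono (show N + 1 ≤ earlyEnd N T + 1 by omega) _)
        refine le_trans ?_ (h.energy_le hcal _)
        have h3 : 0 ≤ ∑ s ∈ Finset.Ico 1 (N + 1), (inner ℝ (ctxPart (WithLp.toLp 2 ![1, b])) (x s) +
          (WithLp.toLp 2 ![1, b] : EuclideanSpace ℝ (Fin 2)) 0 * (1 / (2 * (K : ℝ)))) ^ 2 :=
          Finset.sum_nonneg fun _ _ => sq_nonneg _
        rw [energy]
        simp at h3 ⊢
        linarith
    refine le_trans ?_ h2
    gcongr

/-- The confidence widths of one item sum up to the announced rate. -/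
theorem GoodExploration.sum_invNorm_le (h : GoodExploration k x cx c₁ N)
    (hcal : Calibration d K cx c₁ δ N T) (hx : ∀ s ∈ Finset.Icc 1 T, ‖x s‖ ≤ √3 / 2)
    (hlate : ∀ b : EuclideanSpace ℝ (Fin d), 82 / 100 * (earlyEnd N T) * cx * ‖b‖ ^ 2 ≤
      ∑ s ∈ Finset.Ico 1 (earlyEnd N T + 1), (inner ℝ b (x s)) ^ 2) :
    (√(3 * tuningSq d δ T) + 50 / 41 * √((1 + 1 / (c₁ * N / 20)) * noiseSq d K δ T)) *
      ∑ t ∈ Finset.Ico (N + 1) (T + 1), invNorm (gram (fun s => feature (k s) (x s)) t)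
        (feature (k t) (x t)) ≤ 5 * d * √T * Real.log (T / (d * δ)) := by
  have hNT := hcal.lt_horizon
  have hN0 : (0 : ℝ) ≤ N := Nat.cast_nonneg _
  have hf0 : 0 ≤ √(3 * tuningSq d δ T) +
      50 / 41 * √((1 + 1 / (c₁ * N / 20)) * noiseSq d K δ T) := by positivity
  -- For `d = 1` the rounds are split at `earlyEnd N T` and the sharper determinant bound serves
  -- after it; for `d ≥ 2` one block suffices.
  rcases hcal.one_le_d.eq_or_lt with h1 | h2
  · subst h1
    have hT0 := hcal.horizon_ge.1
    have he : earlyEnd N T ≤ T := by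
      have : 11000 < T := by exact_mod_cast hT0
      exact max_le (by omega) (by omega)
    have he' : N ≤ earlyEnd N T := le_max_left _ _
    have he0 : (0 : ℝ) ≤ earlyEnd N T := Nat.cast_nonneg _
    have hearly := h.sum_block_le hcal hx le_rfl (show N + 1 ≤ earlyEnd N T + 1 by omega)
      (by omega) (c := T / 1000 + 2) ?_ (h.log_det_diff_le hcal hx (by omega) (by omega))
    · have hlate' := h.sum_block_le hcal hx (show N + 1 ≤ earlyEnd N T + 1 by omega)
        (show earlyEnd N T + 1 ≤ T + 1 by omega) le_rfl (c := T) (by push_cast; linarith [he0]) (h.log_det_late hcal hx hlate)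
      have hr := hcal.rate_of_eq_one
      rw [← Finset.sum_Ico_consecutive _ (show N + 1 ≤ earlyEnd N T + 1 by omega)
        (show earlyEnd N T + 1 ≤ T + 1 by omega)]
      simp only [Nat.cast_one, one_mul, one_add_one_eq_two, mul_one] at hearly hlate' ⊢
      refine le_trans ?_ hr
      gcongr
    · have h3 : earlyEnd N T ≤ N + (T / 1000 + 1) := max_le (by omega) (by omega)
      have h4 : (earlyEnd N T : ℝ) ≤ N + ((T / 1000 : ℕ) + 1) := by exact_mod_cast h3
      have h5 : ((T / 1000 : ℕ) : ℝ) ≤ T / 1000 := by exact_mod_cast Nat.cast_div_le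
      push_cast
      linarith
  · have h3 := h.sum_block_le hcal hx le_rfl (show N + 1 ≤ T + 1 by omega) le_rfl (c := T)
      (by push_cast; linarith) (h.log_det_diff_le hcal hx (by omega) le_rfl)
    rw [Real.sqrt_mul (Nat.cast_nonneg _)] at h3
    calc _ ≤ (√(3 * tuningSq d δ T) + 50 / 41 * √((1 + 1 / (c₁ * N / 20)) * noiseSq d K δ T)) *
          (√T * √((1 + 1 / (c₁ * N / 20)) * ((d + 1) * Real.log (T / (d * δ))))) := by gcongr
      _ = √T * ((√(3 * tuningSq d δ T) + 50 / 41 * √((1 + 1 / (c₁ * N / 20)) * noiseSq d K δ T)) *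
          √((1 + 1 / (c₁ * N / 20)) * ((d + 1) * Real.log (T / (d * δ))))) := by ring
      _ ≤ √T * (5 * d * Real.log (T / (d * δ))) := by
          exact mul_le_mul_of_nonneg_left (hcal.rate_of_two_le h2) (Real.sqrt_nonneg _)
      _ = _ := by ring

end Gram

end UCR

namespace UCR

/-! ### Accuracy of the estimates after the exploration. -/

section Accuracy

variable {d K : ℕ} {k : ℕ → Fin K} {x : ℕ → EuclideanSpace ℝ (Fin d)} {cx c₁ δ : ℝ} {N T : ℕ}

/-- The radius of the confidence ellipsoids. -/
noncomputable def radius (d K : ℕ) (c₁ σ κ δ : ℝ) (N T : ℕ) : ℝ :=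
  σ / κ * (50 / 41 * √((1 + 1 / (c₁ * N / 20)) * noiseSq d K δ T))

theorem tuning_eq (d : ℕ) {σ κ : ℝ} (δ : ℝ) (T : ℕ) :
    tuning d σ κ δ T = σ / κ * √(3 * tuningSq d δ T) := by
  rw [tuning, Real.sqrt_mul (by norm_num), tuningSq]; ring

theorem Calibration.tuningSq_pos (h : Calibration d K cx c₁ δ N T) : 0 < tuningSq d δ T := by
  have hδ := h.δ_pos
  rw [tuningSq]
  have h1 : 0 ≤ Real.log (1 + 2 * T / d) :=
    Real.log_nonneg (by linarith [show (0 : ℝ) ≤ 2 * T / d by positivity])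
  have h2 : 0 < Real.log (2 / δ) := Real.log_pos (by
    rw [lt_div_iff₀ hδ]; linarith [h.δ_lt])
  positivity

/-- By `noiseSq_le` the squared radius is at most `2 (50/41)² < 3` in the units in which the squared
tuning parameter is 3. -/
theorem Calibration.radius_lt (h : Calibration d K cx c₁ δ N T) {σ κ : ℝ} (hσ : 0 < σ)
    (hκ : 0 < κ) : radius d K c₁ σ κ δ N T < tuning d σ κ δ T := by
  have hB := h.tuningSq_pos
  have hQ := h.noiseSq_le
  rw [tuning_eq, radius]
  refine mul_lt_mul_of_pos_left ?_ (by positivity)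
  refine Real.lt_sqrt_of_sq_lt ?_
  have hlam := h.lam_pos
  have hQ0 := h.noiseSq_nonneg
  rw [mul_pow, Real.sq_sqrt (by positivity)]
  linarith

/-- Maximum likelihood estimates exist and are accurate after the exploration. -/
theorem GoodExploration.mle (h : GoodExploration k x cx c₁ N)
    (hcal : Calibration d K cx c₁ δ N T) {A : ℝ → ℝ} (hA : Differentiable ℝ A)
    (hA' : Differentiable ℝ (deriv A)) (hmono : Monotone (deriv A)) {κ σ : ℝ} (hκ0 : 0 < κ)
    (hσ : 0 < σ) {θ : EuclideanSpace ℝ (Fin (d + 1))}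
    (hκ : ∀ ϑ z : EuclideanSpace ℝ (Fin (d + 1)), ‖z‖ ≤ 1 → ‖ϑ - θ‖ ≤ 1 →
      κ ≤ deriv (deriv A) (inner ℝ ϑ z)) {t : ℕ} (ht : N + 1 ≤ t)
    (hx : ∀ s ∈ Finset.Ico 1 t, ‖x s‖ ≤ √3 / 2)
    (hξ : tuning d σ κ δ T ^ 2 ≤ 5005 / 10000 * c₁ * N) (Y : ℕ → ℝ)
    (hnoise : ∀ a : EuclideanSpace ℝ (Fin (d + 1)),
      (∑ s ∈ Finset.Ico 1 t, inner ℝ a (feature (k s) (x s)) *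
        (Y s - deriv A (inner ℝ θ (feature (k s) (x s))))) ^ 2 ≤
      σ ^ 2 * (∑ s ∈ Finset.Ico 1 t, (inner ℝ a (feature (k s) (x s))) ^ 2 + ‖a‖ ^ 2) *
        noiseSq d K δ T) :
    (∃ ϑ, IsMaxOn (fun ϑ => ∑ s ∈ Finset.Ico 1 t, (Y s * inner ℝ ϑ (feature (k s) (x s)) -
      A (inner ℝ ϑ (feature (k s) (x s))))) Set.univ ϑ) ∧
    ∀ ϑ, IsMaxOn (fun ϑ => ∑ s ∈ Finset.Ico 1 t, (Y s * inner ℝ ϑ (feature (k s) (x s)) -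
      A (inner ℝ ϑ (feature (k s) (x s))))) Set.univ ϑ →
      ∑ s ∈ Finset.Ico 1 t, (inner ℝ (ϑ - θ) (feature (k s) (x s))) ^ 2 ≤
        radius d K c₁ σ κ δ N T ^ 2 := by
  have hlam := hcal.lam_pos
  have hQ0 := hcal.noiseSq_nonneg
  have hrad := hcal.radius_lt hσ hκ0
  have hrad0 : 0 ≤ radius d K c₁ σ κ δ N T := by rw [radius]; positivity
  -- The unit regularizer `‖a‖²` of the noise bound is absorbed by the Gram form, whose smallest
  -- eigenvalue is at least `c₁ N / 20`.
  set C := σ * √((1 + 1 / (c₁ * N / 20)) * noiseSq d K δ T) with hC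
  have hCr : C / (41 / 50 * κ) = radius d K c₁ σ κ δ N T := by
    rw [hC, radius]; field_simp
  rw [← hCr] at hrad ⊢
  refine mle_accuracy hA hA' hmono hκ0 (fun u hu => le_deriv_deriv_of_abs_le hκ hu)
    (Finset.Ico 1 t) (fun s => feature (k s) (x s)) Y
    (fun s hs => norm_feature_le (k s) (hx s hs)) hlam (hrad0.trans_lt (hCr ▸ hrad))
    (by positivity) (by norm_num) (h.norm_sq_le_of_le hcal ht)
    (fun a ha => h.huber hcal ht hx hξ a ha) (fun a => (hnoise a).trans ?_) ?_
  · rw [hC, mul_pow, Real.sq_sqrt (by positivity)]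
    have h1 := h.norm_sq_le_of_le hcal ht a
    set q := ∑ s ∈ Finset.Ico 1 t, (inner ℝ a (feature (k s) (x s))) ^ 2
    have h2 : ‖a‖ ^ 2 ≤ 1 / (c₁ * N / 20) * q := by
      rw [one_div_mul_eq_div, le_div_iff₀ hlam]; linarith
    have h3 : σ ^ 2 * (q + ‖a‖ ^ 2) * noiseSq d K δ T ≤
        σ ^ 2 * (q + 1 / (c₁ * N / 20) * q) * noiseSq d K δ T := by gcongr
    refine h3.trans (le_of_eq (by ring))
  · rw [div_lt_iff₀ (by positivity)] at hrad
    linarith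

end Accuracy

/-! ### Regret of a single round. -/

section Regret

variable {d K : ℕ}

/-- A function that is Lipschitz in each coordinate separately on a product of copies of `S`. -/
theorem abs_sub_le_of_coordinatewise {F : (Fin K → ℝ) → ℝ} {S : Set ℝ} {c : Fin K → NNReal}
    (h : ∀ (k : Fin K) (u : Fin K → ℝ), (∀ i, u i ∈ S) →
      LipschitzOnWith (c k) (fun v => F (Function.update u k v)) S)
    {u w : Fin K → ℝ} (hu : ∀ i, u i ∈ S) (hw : ∀ i, w i ∈ S) :
    |F u - F w| ≤ ∑ k, (c k : ℝ) * |u k - w k| := by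
  -- Coordinates are exchanged one at a time, so that all intermediate points stay in the product
  -- set.
  have key : ∀ I : Finset (Fin K), |F (I.piecewise u w) - F w| ≤ ∑ k ∈ I, (c k : ℝ) * |u k - w k| := by
    intro I
    induction I using Finset.induction_on with
    | empty => simp
    | insert j I hj ih =>
      rw [Finset.sum_insert hj, Finset.piecewise_insert]
      have hmem : ∀ i, I.piecewise u w i ∈ S := fun i => by
        by_cases hi : i ∈ I
        · rw [Finset.piecewise_eq_of_mem _ _ _ hi]; exact hu i
        · rw [Finset.piecewise_eq_of_notMem _ _ _ hi]; exact hw i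
      have h1 := (h j _ hmem).dist_le_mul (u j) (hu j) (w j) (hw j)
      have h2 : Function.update (I.piecewise u w) j (w j) = I.piecewise u w := by
        rw [← Finset.piecewise_eq_of_notMem I u w hj, Function.update_eq_self]
      simp only [h2, Real.dist_eq] at h1
      refine (abs_sub_le _ (F (I.piecewise u w)) _).trans (add_le_add h1 ih)
  simpa using key Finset.univ

variable {M : Model d K} {M₁ M₂ κ : ℝ} {c : Fin K → NNReal}

theorem Model.Regular.reward_sub_le (hreg : M.Regular M₁ M₂ κ c) {u w : Fin K → ℝ}
    (hu : ∀ i, u i ∈ Set.range (deriv M.A) ∩ Set.Ici 0)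
    (hw : ∀ i, w i ∈ Set.range (deriv M.A) ∩ Set.Ici 0) :
    M.H (∑ j, M.g j (u j)) - M.H (∑ j, M.g j (w j)) ≤ ∑ k, (c k : ℝ) * |u k - w k| :=
  (le_abs_self _).trans (abs_sub_le_of_coordinatewise (F := fun u => M.H (∑ j, M.g j (u j)))
    hreg.lipschitz hu hw)

theorem Model.Regular.M₁_pos (hreg : M.Regular M₁ M₂ κ c) (hK : 1 ≤ K) : 0 < M₁ := by
  have := hreg.κ_le ⟨0, hK⟩ (M.θ ⟨0, hK⟩) 0 (by simp) (by simp)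
  exact hreg.κ_pos.trans_le (this.trans (hreg.A''_le _))

theorem Model.Regular.deriv_sub_le (hreg : M.Regular M₁ M₂ κ c) {a b : ℝ} (hab : a ≤ b) :
    deriv M.A b - deriv M.A a ≤ M₁ * (b - a) :=
  image_sub_le_mul_sub_of_deriv_le hreg.differentiable_A' hreg.A''_le hab

/-- Per-round regret without any information. -/
theorem Model.Regular.reward_sub_le_of_range (hreg : M.Regular M₁ M₂ κ c) {R₀ : ℝ}
    {x : EuclideanSpace ℝ (Fin d)} (h : ∀ j k, M.mean j k x ∈ Set.Icc 0 R₀)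
    (π π' : Equiv.Perm (Fin K)) : M.reward x π - M.reward x π' ≤ (∑ k, (c k : ℝ)) * R₀ := by
  have hmem : ∀ j k, M.mean j k x ∈ Set.range (deriv M.A) ∩ Set.Ici 0 :=
    fun j k => ⟨⟨_, rfl⟩, (h j k).1⟩
  refine (hreg.reward_sub_le (u := fun j => M.mean j (π j) x) (w := fun j => M.mean j (π' j) x)
    (fun j => hmem j _) (fun j => hmem j _)).trans ?_
  rw [Finset.sum_mul]
  refine Finset.sum_le_sum fun j _ => mul_le_mul_of_nonneg_left ?_ (c j).2
  have h1 := h j (π j)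
  have h2 := h j (π' j)
  rw [abs_le]
  constructor <;> linarith [h1.1, h1.2, h2.1, h2.2]

/-- Per-round regret of an optimistic ranking. -/
theorem Model.Regular.optimistic_regret_le (hreg : M.Regular M₁ M₂ κ c) (hK : 1 ≤ K)
    {x : EuclideanSpace ℝ (Fin d)} (h0 : ∀ j k, 0 ≤ M.mean j k x) {e b : Fin K → Fin K → ℝ}
    {ξ β : ℝ} (hβξ : β ≤ ξ) (hb : ∀ j k, 0 ≤ b j k)
    (herr : ∀ j k, |e j k - inner ℝ (M.θ j) (feature k x)| ≤ β * b j k)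
    {ρ : Equiv.Perm (Fin K)}
    (hopt : ∀ π : Equiv.Perm (Fin K),
      M.H (∑ j, M.g j (deriv M.A (e j (π j) + ξ * b j (π j)))) ≤
      M.H (∑ j, M.g j (deriv M.A (e j (ρ j) + ξ * b j (ρ j))))) (π : Equiv.Perm (Fin K)) :
    M.reward x π - M.reward x ρ ≤ ∑ j, (c j : ℝ) * (M₁ * ((ξ + β) * b j (ρ j))) := by
  have hle : ∀ j k, inner ℝ (M.θ j) (feature k x) ≤ e j k + ξ * b j k := fun j k => by
    have h1 := (abs_le.1 (herr j k)).1
    have h2 : β * b j k ≤ ξ * b j k := mul_le_mul_of_nonneg_right hβξ (hb j k)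
    linarith
  have h1 : M.reward x π ≤ M.H (∑ j, M.g j (deriv M.A (e j (π j) + ξ * b j (π j)))) :=
    hreg.monotone_H (Finset.sum_le_sum fun j _ => hreg.monotone_g j ⟨_, rfl⟩ ⟨_, rfl⟩
      (hreg.monotone_A' (hle j _)))
  have hmean : ∀ j k, M.mean j k x ≤ deriv M.A (e j k + ξ * b j k) :=
    fun j k => hreg.monotone_A' (hle j k)
  have h2 := hreg.reward_sub_le (u := fun j => deriv M.A (e j (ρ j) + ξ * b j (ρ j)))
    (w := fun j => M.mean j (ρ j) x) (fun j => ⟨⟨_, rfl⟩, (h0 j _).trans (hmean j _)⟩)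
    (fun j => ⟨⟨_, rfl⟩, h0 j _⟩)
  -- Optimism: the index of the unknown competitor `π` is replaced by the larger index of the
  -- displayed `ρ`, and only widths at displayed features remain.
  have h3 : M.reward x π - M.reward x ρ ≤
      M.H (∑ j, M.g j (deriv M.A (e j (ρ j) + ξ * b j (ρ j)))) -
        M.H (∑ j, M.g j (M.mean j (ρ j) x)) := sub_le_sub_right (h1.trans (hopt π)) _
  refine h3.trans (h2.trans (Finset.sum_le_sum fun j _ => ?_))
  refine mul_le_mul_of_nonneg_left ?_ (c j).2
  rw [abs_of_nonneg (sub_nonneg.2 (hmean j _))]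
  refine (hreg.deriv_sub_le (hle j _)).trans (mul_le_mul_of_nonneg_left ?_ (hreg.M₁_pos hK).le)
  have := (abs_le.1 (herr j (ρ j))).2
  linarith

end Regret

end UCR

namespace UCR

/-! ### The regret bound on the good event. -/

section RegretBound

variable {d K : ℕ} {Ω : Type*}

/-- The outcomes `ω` for which the regret bound holds. -/
structure GoodOutcome (S : Run d K Ω) (M : Model d K)
    (θhat : ℕ → Fin K → Ω → EuclideanSpace ℝ (Fin (d + 1))) (R₀ σ κ cx c₁ δ : ℝ) (N T : ℕ)
    (ω : Ω) : Prop where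
  norm_X : ∀ s ∈ Finset.Icc 1 T, ‖S.X s ω‖ ≤ √3 / 2
  mean_mem : ∀ t ∈ Finset.Icc 1 T, ∀ j k, M.mean j k (S.X t ω) ∈ Set.Icc 0 R₀
  mle : ∀ t ∈ Finset.Icc (N + 1) T, ∀ j, (∃ ϑ, IsMaxOn (S.logLik M.A t j ω) Set.univ ϑ) →
    IsMaxOn (S.logLik M.A t j ω) Set.univ (θhat t j ω)
  optimistic : ∀ t ∈ Finset.Icc (N + 1) T, ∀ π,
    S.upper M θhat (tuning d σ κ δ T) t ω (S.X t ω) π ≤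
      S.upper M θhat (tuning d σ κ δ T) t ω (S.X t ω) (S.ρ t ω)
  exploration : ∀ j, GoodExploration (fun s => S.ρ s ω j) (fun s => S.X s ω) cx c₁ N
  late : ∀ b : EuclideanSpace ℝ (Fin d), 82 / 100 * (earlyEnd N T) * cx * ‖b‖ ^ 2 ≤
    ∑ s ∈ Finset.Ico 1 (earlyEnd N T + 1), (inner ℝ b (S.X s ω)) ^ 2
  noise : ∀ j, ∀ t ∈ Finset.Icc (N + 1) T, ∀ a : EuclideanSpace ℝ (Fin (d + 1)),
    (∑ s ∈ Finset.Ico 1 t, inner ℝ a (S.Z s j ω) *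
      (S.obs s j ω - deriv M.A (inner ℝ (M.θ j) (S.Z s j ω)))) ^ 2 ≤
    σ ^ 2 * (∑ s ∈ Finset.Ico 1 t, (inner ℝ a (S.Z s j ω)) ^ 2 + ‖a‖ ^ 2) * noiseSq d K δ T

theorem GoodOutcome.regret_le {S : Run d K Ω} {M : Model d K}
    {θhat : ℕ → Fin K → Ω → EuclideanSpace ℝ (Fin (d + 1))} {R₀ σ κ cx c₁ δ M₁ M₂ D : ℝ}
    {c : Fin K → NNReal} {N T : ℕ} {ω : Ω}
    (h : GoodOutcome S M θhat R₀ σ κ cx c₁ δ N T ω) (hcal : Calibration d K cx c₁ δ N T)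
    (hreg : M.Regular M₁ M₂ κ c) (hσ : 0 < σ)
    (hξ : tuning d σ κ δ T ^ 2 ≤ 5005 / 10000 * c₁ * N)
    (hD : ∀ t ∈ Finset.Ico 1 (N + 1), ∀ π π', M.reward (S.X t ω) π - M.reward (S.X t ω) π' ≤ D) :
    S.regret M T ω ≤ N * D +
      5 * σ / κ * M₁ * (∑ k, (c k : ℝ)) * d * √T * Real.log (T / (d * δ)) := by
  have hK : 1 ≤ K := one_le_two.trans hcal.two_le_K
  have hκ := hreg.κ_pos
  have hM₁ := hreg.M₁_pos hK
  have hNT := hcal.lt_horizon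
  have hrad := hcal.radius_lt hσ hκ
  have hrad0 : 0 ≤ radius d K c₁ σ κ δ N T := by rw [radius]; positivity
  set ξ := tuning d σ κ δ T with hξdef
  set β := radius d K c₁ σ κ δ N T with hβdef
  have hround : ∀ t ∈ Finset.Ico (N + 1) (T + 1), ∀ π,
      M.reward (S.X t ω) π - M.reward (S.X t ω) (S.ρ t ω) ≤
        ∑ j, (c j : ℝ) * (M₁ * ((ξ + β) * invNorm (S.V t j ω) (S.Z t j ω))) := by
    intro t ht π
    have ht' := Finset.mem_Ico.1 ht
    have htI : t ∈ Finset.Icc (N + 1) T := Finset.mem_Icc.2 ⟨ht'.1, by omega⟩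
    have htI' : t ∈ Finset.Icc 1 T := Finset.mem_Icc.2 ⟨by omega, by omega⟩
    refine hreg.optimistic_regret_le hK (fun j k => (h.mean_mem t htI' j k).1)
      (e := fun j k => inner ℝ (θhat t j ω) (feature k (S.X t ω)))
      (b := fun j k => invNorm (S.V t j ω) (feature k (S.X t ω))) hrad.le
      (fun j k => Real.sqrt_nonneg _) (fun j k => ?_) (h.optimistic t htI) π
    have hm := (h.exploration j).mle hcal hreg.differentiable_A hreg.differentiable_A'
      hreg.monotone_A' hκ hσ (hreg.κ_le j) ht'.1
      (fun s hs => h.norm_X s (Finset.mem_Icc.2 ⟨(Finset.mem_Ico.1 hs).1, by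
        have := (Finset.mem_Ico.1 hs).2; omega⟩)) hξ (fun s => S.obs s j ω) (h.noise j t htI)
    rw [← inner_sub_left]
    exact abs_inner_le_invNorm ((h.exploration j).gram_posDef hcal ht'.1) _ _ hrad0
      (hm.2 _ (h.mle t htI j hm.1))
  have hsum : S.regret M T ω ≤ ∑ t ∈ Finset.Ico 1 (N + 1), D +
      ∑ t ∈ Finset.Ico (N + 1) (T + 1),
        ∑ j, (c j : ℝ) * (M₁ * ((ξ + β) * invNorm (S.V t j ω) (S.Z t j ω))) := by
    rw [Run.regret, ← Finset.Ico_add_one_right_eq_Icc,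
      ← Finset.sum_Ico_consecutive _ (show 1 ≤ N + 1 by omega) (show N + 1 ≤ T + 1 by omega)]
    refine add_le_add (Finset.sum_le_sum fun t ht => ?_) (Finset.sum_le_sum fun t ht => ?_)
    · rw [sub_le_iff_le_add]
      exact Finset.sup'_le _ _ fun π _ => by linarith [hD t ht π (S.ρ t ω)]
    · rw [sub_le_iff_le_add]
      exact Finset.sup'_le _ _ fun π _ => by linarith [hround t ht π]
  refine hsum.trans (add_le_add (by simp) ?_)
  rw [Finset.sum_comm]
  have hitem : ∀ j, ∑ t ∈ Finset.Ico (N + 1) (T + 1),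
      (c j : ℝ) * (M₁ * ((ξ + β) * invNorm (S.V t j ω) (S.Z t j ω))) ≤
      (c j : ℝ) * (5 * σ / κ * M₁ * d * √T * Real.log (T / (d * δ))) := by
    intro j
    have h1 := (h.exploration j).sum_invNorm_le hcal h.norm_X h.late
    have h2 : ξ + β = σ / κ * (√(3 * tuningSq d δ T) +
        50 / 41 * √((1 + 1 / (c₁ * N / 20)) * noiseSq d K δ T)) := by
      rw [hξdef, hβdef, tuning_eq, radius]; ring
    rw [← Finset.mul_sum, ← Finset.mul_sum, ← Finset.mul_sum]
    refine mul_le_mul_of_nonneg_left ?_ (c j).2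
    rw [h2, mul_assoc (σ / κ)]
    refine (mul_le_mul_of_nonneg_left (mul_le_mul_of_nonneg_left h1 (by positivity))
      hM₁.le).trans (le_of_eq ?_)
    ring
  refine (Finset.sum_le_sum fun j _ => hitem j).trans (le_of_eq ?_)
  rw [← Finset.sum_mul]
  ring

end RegretBound

end UCR

namespace UCR

/-! ### Information available in each round, and the noise of the observed outcomes. -/

section Filtration

variable {d K : ℕ} {Ω : Type*}

namespace Run

variable (S : Run d K Ω)

theorem history_mono {s t : ℕ} (h : s ≤ t) : S.history s ≤ S.history t :=
  biSup_mono fun _ hr => Finset.Ico_subset_Ico_right h hr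

theorem history_le_contextInfo (t : ℕ) : S.history t ≤ S.contextInfo t := le_sup_left

theorem contextInfo_le_decisionInfo (t : ℕ) : S.contextInfo t ≤ S.decisionInfo t := le_sup_left

theorem round_le_history {t : ℕ} (ht : 1 ≤ t) :
    (MeasurableSpace.comap (S.X t) inferInstance ⊔ MeasurableSpace.comap (S.ρ t) ⊤ ⊔
      ⨆ j, MeasurableSpace.comap (S.obs t j) inferInstance) ≤ S.history (t + 1) :=
  le_biSup (fun s => MeasurableSpace.comap (S.X s) inferInstance ⊔ MeasurableSpace.comap (S.ρ s) ⊤ ⊔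
      ⨆ j, MeasurableSpace.comap (S.obs s j) inferInstance) (Finset.mem_Ico.2 ⟨ht, t.lt_succ_self⟩)

theorem decisionInfo_le_history {t : ℕ} (ht : 1 ≤ t) : S.decisionInfo t ≤ S.history (t + 1) :=
  sup_le (sup_le (S.history_mono t.le_succ) ((le_sup_left.trans le_sup_left).trans
    (S.round_le_history ht))) ((le_sup_right.trans le_sup_left).trans (S.round_le_history ht))

theorem decisionInfo_mono {s t : ℕ} (hs : 1 ≤ s) (h : s ≤ t) :
    S.decisionInfo s ≤ S.decisionInfo t := by
  rcases h.eq_or_lt with rfl | h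
  · exact le_rfl
  · exact (S.decisionInfo_le_history hs).trans ((S.history_mono h).trans
      ((S.history_le_contextInfo t).trans (S.contextInfo_le_decisionInfo t)))

theorem contextInfo_mono {s t : ℕ} (hs : 1 ≤ s) (h : s ≤ t) :
    S.contextInfo s ≤ S.contextInfo t := by
  rcases h.eq_or_lt with rfl | h
  · exact le_rfl
  · exact (S.contextInfo_le_decisionInfo s).trans ((S.decisionInfo_le_history hs).trans
      ((S.history_mono h).trans (S.history_le_contextInfo t)))

theorem measurable_X_history {t : ℕ} (ht : 1 ≤ t) : Measurable[S.history (t + 1)] (S.X t) :=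
  measurable_iff_comap_le.2 ((le_sup_left.trans le_sup_left).trans (S.round_le_history ht))

theorem measurable_obs_history {t : ℕ} (ht : 1 ≤ t) (j : Fin K) :
    Measurable[S.history (t + 1)] (S.obs t j) :=
  measurable_iff_comap_le.2 (((le_iSup (fun j => MeasurableSpace.comap (S.obs t j) inferInstance)
    j).trans le_sup_right).trans (S.round_le_history ht))

theorem measurable_X_contextInfo (t : ℕ) : Measurable[S.contextInfo t] (S.X t) :=
  measurable_iff_comap_le.2 le_sup_right

theorem measurableSet_ρ_decisionInfo (t : ℕ) (B : Set (Equiv.Perm (Fin K))) :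
    MeasurableSet[S.decisionInfo t] (S.ρ t ⁻¹' B) :=
  (le_sup_right : MeasurableSpace.comap (S.ρ t) ⊤ ≤ S.decisionInfo t) _ ⟨B, trivial, rfl⟩

theorem measurable_ρ_decisionInfo {α : Type*} [MeasurableSpace α] (t : ℕ)
    (f : Equiv.Perm (Fin K) → α) : Measurable[S.decisionInfo t] fun ω => f (S.ρ t ω) :=
  fun B _ => S.measurableSet_ρ_decisionInfo t (f ⁻¹' B)

end Run

/-- A filtration given on `1, …, T`, continued by the whole `σ`-algebra. -/
@[reducible]
def capped (m0 : MeasurableSpace Ω) (T : ℕ) (G : ℕ → MeasurableSpace Ω) (t : ℕ) :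
    MeasurableSpace Ω :=
  -- Round 0 is not part of the run and its data need not enter later histories; nothing is assumed
  -- to be measurable after round `T`. Both ends are therefore replaced.
  if t = 0 then ⊥ else if t ≤ T then G t else m0

theorem capped_of_mem {m0 : MeasurableSpace Ω} {T : ℕ} {G : ℕ → MeasurableSpace Ω} {t : ℕ}
    (h : t ∈ Finset.Icc 1 T) : capped m0 T G t = G t := by
  have := Finset.mem_Icc.1 h
  rw [capped, if_neg (by omega), if_pos this.2]

theorem capped_le {m0 : MeasurableSpace Ω} {T : ℕ} {G : ℕ → MeasurableSpace Ω}
    (hG : ∀ t ∈ Finset.Icc 1 T, G t ≤ m0) (t : ℕ) : capped m0 T G t ≤ m0 := by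
  unfold capped
  split_ifs with h1 h2
  · exact bot_le
  · exact hG t (Finset.mem_Icc.2 ⟨by omega, h2⟩)
  · exact le_rfl

theorem capped_mono {m0 : MeasurableSpace Ω} {T : ℕ} {G : ℕ → MeasurableSpace Ω}
    (hG : ∀ t ∈ Finset.Icc 1 T, G t ≤ m0) (hmono : ∀ s t, 1 ≤ s → s ≤ t → G s ≤ G t) (s t : ℕ)
    (hst : s ≤ t) : capped m0 T G s ≤ capped m0 T G t := by
  unfold capped
  split_ifs with h1 h2 h3 h4 h5 h6 h7
  any_goals first
    | exact bot_le
    | exact le_rfl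
    | omega
  · exact hmono s t (by omega) hst
  · exact hG s (Finset.mem_Icc.2 ⟨by omega, by assumption⟩)

theorem le_capped_succ {m0 : MeasurableSpace Ω} {T : ℕ} {G : ℕ → MeasurableSpace Ω}
    {m : MeasurableSpace Ω} (hm : m ≤ m0) {t : ℕ} (h : m ≤ G (t + 1)) :
    m ≤ capped m0 T G (t + 1) := by
  rw [capped, if_neg (by omega)]
  split_ifs
  · exact h
  · exact hm

variable [m0 : MeasurableSpace Ω] {P : Measure Ω} {S : Run d K Ω} {M : Model d K}
  {PX : Measure (EuclideanSpace ℝ (Fin d))} {R₀ σ : ℝ} {T : ℕ}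

namespace Run.InEnvironment

theorem measurableSet_ρ (h : S.InEnvironment P M PX R₀ σ T) {t : ℕ} (ht : t ∈ Finset.Icc 1 T)
    (B : Set (Equiv.Perm (Fin K))) : MeasurableSet (S.ρ t ⁻¹' B) := by
  have : S.ρ t ⁻¹' B = ⋃ π ∈ B, {ω | S.ρ t ω = π} := by ext ω; simp
  rw [this]
  exact MeasurableSet.biUnion (Set.to_countable _) fun π _ => h.measurable_ρ t ht π

theorem measurable_obs (h : S.InEnvironment P M PX R₀ σ T) {t : ℕ} (ht : t ∈ Finset.Icc 1 T)
    (j : Fin K) : Measurable (S.obs t j) := by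
  intro B hB
  have : S.obs t j ⁻¹' B = ⋃ k, (S.ρ t ⁻¹' {π | π j = k} ∩ S.Y t j k ⁻¹' B) := by
    ext ω; simp [Run.obs]
  rw [this]
  exact MeasurableSet.iUnion fun k => (h.measurableSet_ρ ht _).inter (h.measurable_Y t ht j k hB)

theorem history_le (h : S.InEnvironment P M PX R₀ σ T) {t : ℕ} (ht : t ≤ T + 1) :
    S.history t ≤ m0 := by
  refine iSup₂_le fun s hs => ?_
  have hs' : s ∈ Finset.Icc 1 T := by
    have := Finset.mem_Ico.1 hs
    exact Finset.mem_Icc.2 ⟨this.1, by omega⟩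
  refine sup_le (sup_le (h.measurable_X s hs').comap_le ?_) (iSup_le fun j =>
    (h.measurable_obs hs' j).comap_le)
  rintro _ ⟨B, -, rfl⟩
  exact h.measurableSet_ρ hs' B

theorem decisionInfo_le (h : S.InEnvironment P M PX R₀ σ T) {t : ℕ} (ht : t ∈ Finset.Icc 1 T) :
    S.decisionInfo t ≤ m0 :=
  (S.decisionInfo_le_history (Finset.mem_Icc.1 ht).1).trans
    (h.history_le (Nat.succ_le_succ (Finset.mem_Icc.1 ht).2))

theorem contextInfo_le (h : S.InEnvironment P M PX R₀ σ T) {t : ℕ} (ht : t ∈ Finset.Icc 1 T) :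
    S.contextInfo t ≤ m0 :=
  (S.contextInfo_le_decisionInfo t).trans (h.decisionInfo_le ht)

theorem measurable_mean (hA : Continuous (deriv M.A)) (j k : Fin K) :
    Measurable fun x => M.mean j k x := by
  refine hA.measurable.comp ?_
  simp only [inner_feature]
  fun_prop

/-- The mean is a conditional expectation of an outcome in `[0, R₀]`. -/
theorem mean_mem [IsProbabilityMeasure P] (h : S.InEnvironment P M PX R₀ σ T) {t : ℕ}
    (ht : t ∈ Finset.Icc 1 T) (j k : Fin K) :
    ∀ᵐ ω ∂P, M.mean j k (S.X t ω) ∈ Set.Icc 0 R₀ := by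
  have hle := h.decisionInfo_le ht
  have hb := h.bounded_Y t ht j k
  have hint : Integrable (S.Y t j k) P := by
    refine Integrable.of_bound (h.measurable_Y t ht j k).aestronglyMeasurable R₀ ?_
    filter_upwards [hb] with ω hω
    rw [Real.norm_eq_abs, abs_of_nonneg hω.1]; exact hω.2
  have h1 : (0 : Ω → ℝ) ≤ᵐ[P] P[S.Y t j k | S.decisionInfo t] :=
    condExp_nonneg (hb.mono fun ω hω => hω.1)
  have h2 : P[S.Y t j k | S.decisionInfo t] ≤ᵐ[P] P[fun _ => R₀ | S.decisionInfo t] :=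
    condExp_mono hint (integrable_const R₀) (hb.mono fun ω hω => hω.2)
  rw [condExp_const hle] at h2
  filter_upwards [h1, h2, h.mean_Y t ht j k] with ω h1 h2 h3
  rw [h3] at h1 h2
  exact ⟨h1, h2⟩

theorem ae_of_ae (h : S.InEnvironment P M PX R₀ σ T) {t : ℕ}
    (ht : t ∈ Finset.Icc 1 T) {p : EuclideanSpace ℝ (Fin d) → Prop} (hp : ∀ᵐ x ∂PX, p x) :
    ∀ᵐ ω ∂P, p (S.X t ω) := by
  rw [← h.law_X t ht] at hp
  exact ae_of_ae_map (h.measurable_X t ht).aemeasurable hp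

/-- The noise of an item is conditionally sub-Gaussian given the decision. -/
theorem condLeOne_noise [IsProbabilityMeasure P] (h : S.InEnvironment P M PX R₀ σ T)
    (hA : Continuous (deriv M.A)) {t : ℕ} (ht : t ∈ Finset.Icc 1 T) (j : Fin K) (l : ℝ) :
    CondLeOne (S.decisionInfo t) P fun ω => ENNReal.ofReal (Real.exp
      (l * (S.obs t j ω - deriv M.A (inner ℝ (M.θ j) (S.Z t j ω))) - σ ^ 2 / 2 * l ^ 2)) := by
  have hle := h.decisionInfo_le ht
  have hX := h.measurable_X t ht
  have hmean : ∀ k, Measurable fun ω => M.mean j k (S.X t ω) :=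
    fun k => (measurable_mean hA j k).comp hX
  set D : Fin K → Ω → ℝ := fun k ω => Real.exp (l * (S.Y t j k ω - M.mean j k (S.X t ω))) with hD
  have hDm : ∀ k, Measurable (D k) := fun k =>
    (((h.measurable_Y t ht j k).sub (hmean k)).const_mul l).exp
  have hDint : ∀ k, Integrable (D k) P := by
    intro k
    refine Integrable.of_bound (hDm k).aestronglyMeasurable (Real.exp (|l| * R₀)) ?_
    filter_upwards [h.bounded_Y t ht j k, h.mean_mem ht j k] with ω h1 h2
    rw [Real.norm_eq_abs, abs_of_nonneg (Real.exp_pos _).le]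
    refine Real.exp_le_exp.2 ((le_abs_self _).trans ?_)
    rw [abs_mul]
    refine mul_le_mul_of_nonneg_left ?_ (abs_nonneg _)
    rw [abs_le]
    constructor <;> linarith [h1.1, h1.2, h2.1, h2.2]
  have hk : ∀ k, ∀ B, MeasurableSet[S.decisionInfo t] B →
      ∫⁻ ω in B, ENNReal.ofReal (D k ω * Real.exp (-(σ ^ 2 / 2 * l ^ 2))) ∂P ≤ P B := by
    intro k B hB
    rw [← ofReal_integral_eq_lintegral_ofReal (((hDint k).mul_const _).integrableOn)
      (ae_of_all _ fun ω => by positivity), integral_mul_const,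
      ← setIntegral_condExp hle (hDint k) hB]
    have h1 : ∫ ω in B, (P[D k | S.decisionInfo t]) ω ∂P ≤
        ∫ ω in B, Real.exp (σ ^ 2 * l ^ 2 / 2) ∂P :=
      integral_mono_ae integrable_condExp.integrableOn (integrable_const _).integrableOn
        (ae_restrict_of_ae (h.subgaussian_Y t ht j k l))
    rw [setIntegral_const, smul_eq_mul] at h1
    calc _ ≤ ENNReal.ofReal (P.real B * Real.exp (σ ^ 2 * l ^ 2 / 2) *
            Real.exp (-(σ ^ 2 / 2 * l ^ 2))) := by gcongr
      _ = ENNReal.ofReal (P.real B) := by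
          rw [mul_assoc, ← Real.exp_add, show σ ^ 2 * l ^ 2 / 2 + -(σ ^ 2 / 2 * l ^ 2) = 0 by ring,
            Real.exp_zero, mul_one]
      _ = P B := ofReal_measureReal
  have hmeas : Measurable fun ω => ENNReal.ofReal (Real.exp
      (l * (S.obs t j ω - deriv M.A (inner ℝ (M.θ j) (S.Z t j ω))) - σ ^ 2 / 2 * l ^ 2)) := by
    have hz : Measurable fun ω => deriv M.A (inner ℝ (M.θ j) (S.Z t j ω)) := by
      refine hA.measurable.comp ?_
      simp only [Run.Z, inner_feature]
      have h1 : Measurable fun ω => posn (S.ρ t ω j) := fun B _ =>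
        h.measurableSet_ρ ht {π | posn (π j) ∈ B}
      fun_prop
    exact ((((h.measurable_obs ht j).sub hz).const_mul l).sub_const _).exp.ennreal_ofReal
  refine CondLeOne.of_setLIntegral_le hle hmeas fun A hAm => ?_
  -- The displayed position is known to the decision, so the event splits into pieces on which the
  -- observed outcome is one fixed potential outcome.
  have hpart : A = ⋃ k, A ∩ S.ρ t ⁻¹' {π | π j = k} := by
    ext ω; simp
  have hset : ∀ k, MeasurableSet[S.decisionInfo t] (A ∩ S.ρ t ⁻¹' {π | π j = k}) := fun k =>
    hAm.inter (S.measurableSet_ρ_decisionInfo t _)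
  have hdisj : Pairwise (Function.onFun Disjoint fun k => A ∩ S.ρ t ⁻¹' {π | π j = k}) := by
    intro k k' hkk'
    refine Set.disjoint_left.2 fun ω h1 h2 => hkk' ?_
    exact h1.2.symm.trans h2.2
  rw [hpart, lintegral_iUnion (fun k => hle _ (hset k)) hdisj,
    measure_iUnion hdisj (fun k => hle _ (hset k))]
  refine ENNReal.tsum_le_tsum fun k => ?_
  refine le_trans (le_of_eq ?_) (hk k _ (hset k))
  refine setLIntegral_congr_fun (hle _ (hset k)) fun ω hω => ?_
  have hρ : S.ρ t ω j = k := hω.2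
  simp only [hD, Run.obs, Run.Z, hρ, ← Real.exp_add, Model.mean]
  congr 2

end Run.InEnvironment

end Filtration

end UCR

namespace UCR

open scoped ENNReal

/-! ### Conditional moments under uniform rankings and fresh contexts. -/

section Randomization

variable {d K : ℕ} {Ω : Type*}

/-- Composition with a transposition maps the permutations sending `j` to `k` onto those sending it
to `k'`, so the `K` fibres have equal size. -/
theorem card_perm_apply_eq (j k : Fin K) :
    (Finset.univ.filter fun π : Equiv.Perm (Fin K) => π j = k).card * K = K.factorial := by
  have h1 : ∀ k', (Finset.univ.filter fun π : Equiv.Perm (Fin K) => π j = k').card =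
      (Finset.univ.filter fun π : Equiv.Perm (Fin K) => π j = k).card := by
    intro k'
    refine Finset.card_equiv (Equiv.mulLeft (Equiv.swap k k')) fun π => ?_
    simp only [Finset.mem_filter, Finset.mem_univ, true_and, Equiv.coe_mulLeft,
      Equiv.Perm.mul_apply]
    rw [Equiv.swap_apply_eq_iff, Equiv.swap_apply_left]
  have h2 := Finset.card_eq_sum_card_fiberwise (s := Finset.univ) (t := Finset.univ)
    (f := fun π : Equiv.Perm (Fin K) => π j) fun _ _ => Finset.mem_coe.2 (Finset.mem_univ _)
  rw [Finset.sum_congr rfl fun k' _ => h1 k', Finset.sum_const, Finset.card_univ, Finset.card_univ,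
    Fintype.card_perm, Fintype.card_fin, smul_eq_mul] at h2
  rw [h2, mul_comm]

variable [m0 : MeasurableSpace Ω] {P : Measure Ω} [IsProbabilityMeasure P] {S : Run d K Ω}
  {M : Model d K} {PX : Measure (EuclideanSpace ℝ (Fin d))} {R₀ σ ξ : ℝ} {T₀ T : ℕ}
  {θhat : ℕ → Fin K → Ω → EuclideanSpace ℝ (Fin (d + 1))}

theorem measure_position_eq (henv : S.InEnvironment P M PX R₀ σ T)
    (hucr : S.FollowsUCR P M θhat ξ T₀ T) {t : ℕ} (ht : t ∈ Finset.Icc 1 T)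
    (ht' : t ∈ Finset.Ico 1 T₀) (j k : Fin K) :
    P (S.ρ t ⁻¹' {π | π j = k}) = (K : ℝ≥0∞)⁻¹ := by
  have hset : S.ρ t ⁻¹' {π | π j = k} =
      ⋃ π ∈ Finset.univ.filter fun π : Equiv.Perm (Fin K) => π j = k, {ω | S.ρ t ω = π} := by
    ext ω; simp
  have hK : 0 < K := j.pos
  have h1 : ∀ π, P {ω | S.ρ t ω = π} = (K.factorial : ℝ≥0∞)⁻¹ := by
    intro π
    have h2 := hucr.uniform t ht' π
    rw [← ofReal_measureReal, h2, one_div, ENNReal.ofReal_inv_of_pos (by positivity),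
      ENNReal.ofReal_natCast]
  rw [hset, measure_biUnion_finset ?_ fun π _ => henv.measurable_ρ t ht π,
    Finset.sum_congr rfl fun π _ => h1 π, Finset.sum_const, nsmul_eq_mul, ← card_perm_apply_eq j k]
  · have hc : (Finset.univ.filter fun π : Equiv.Perm (Fin K) => π j = k).card ≠ 0 := by
      intro h0
      have := card_perm_apply_eq j k
      rw [h0, zero_mul] at this
      exact Nat.factorial_ne_zero K this.symm
    push_cast
    rw [ENNReal.mul_inv (Or.inr (by simp)) (Or.inr (by simpa using hK.ne')), ← mul_assoc,
      ENNReal.mul_inv_cancel (by simpa using hc) (by simp), one_mul]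
  · intro π _ π' _ hne
    exact Set.disjoint_left.2 fun ω h1 h2 => hne (h1.symm.trans h2)

theorem lintegral_position (henv : S.InEnvironment P M PX R₀ σ T)
    (hucr : S.FollowsUCR P M θhat ξ T₀ T) {t : ℕ} (ht : t ∈ Finset.Icc 1 T)
    (ht' : t ∈ Finset.Ico 1 T₀) (j : Fin K) {F : Fin K → Ω → ℝ≥0∞}
    (hF : ∀ k, Measurable[S.contextInfo t] (F k)) :
    ∫⁻ ω, F (S.ρ t ω j) ω ∂P = (K : ℝ≥0∞)⁻¹ * ∑ k, ∫⁻ ω, F k ω ∂P := by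
  have hle := henv.contextInfo_le ht
  have hρ : MeasurableSpace.comap (S.ρ t) ⊤ ≤ m0 := by
    rintro _ ⟨B, -, rfl⟩
    exact henv.measurableSet_ρ ht B
  have hset : ∀ k, MeasurableSet[MeasurableSpace.comap (S.ρ t) ⊤] (S.ρ t ⁻¹' {π | π j = k}) :=
    fun k => ⟨_, trivial, rfl⟩
  -- Once split by position, each term is a function of the ranking times a function of past and
  -- context, and these are independent.
  have h1 : ∀ ω, F (S.ρ t ω j) ω =
      ∑ k, (S.ρ t ⁻¹' {π | π j = k}).indicator (fun _ => (1 : ℝ≥0∞)) ω * F k ω := by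
    intro ω
    rw [Finset.sum_eq_single (S.ρ t ω j)]
    · simp
    · intro k _ hk
      rw [Set.indicator_of_notMem, zero_mul]
      exact fun h => hk h.symm
    · simp
  simp only [h1]
  have hm : ∀ k ∈ Finset.univ, Measurable fun ω =>
      (S.ρ t ⁻¹' {π | π j = k}).indicator (fun _ => (1 : ℝ≥0∞)) ω * F k ω := fun k _ =>
    (measurable_const.indicator (hρ _ (hset k))).mul ((hF k).mono hle le_rfl)
  rw [lintegral_finsetSum _ hm, Finset.mul_sum]
  refine Finset.sum_congr rfl fun k _ => ?_
  have hi : Measurable[MeasurableSpace.comap (S.ρ t) ⊤]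
      ((S.ρ t ⁻¹' {π | π j = k}).indicator fun _ => (1 : ℝ≥0∞)) :=
    measurable_const.indicator (hset k)
  rw [lintegral_mul_eq_lintegral_mul_lintegral_of_independent_measurableSpace hρ hle
    (hucr.indep t ht') hi (hF k), lintegral_indicator_const (hρ _ (hset k)), one_mul,
    measure_position_eq henv hucr ht ht' j k]

/-- A function of the randomized position of an item, of mean at most one. -/
theorem condLeOne_position (henv : S.InEnvironment P M PX R₀ σ T)
    (hucr : S.FollowsUCR P M θhat ξ T₀ T) {t : ℕ} (ht : t ∈ Finset.Icc 1 T)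
    (ht' : t ∈ Finset.Ico 1 T₀) (j : Fin K) {φ : Fin K → ℝ}
    (hφ : ∑ k, Real.exp (φ k) ≤ K) :
    CondLeOne (S.contextInfo t) P fun ω => ENNReal.ofReal (Real.exp (φ (S.ρ t ω j))) := by
  intro f hf
  have hle := henv.contextInfo_le ht
  have hK : (K : ℝ≥0∞) ≠ 0 := by simpa using j.pos.ne'
  have := lintegral_position henv hucr ht ht' j
    (F := fun k ω => f ω * ENNReal.ofReal (Real.exp (φ k))) fun k => hf.mul_const _
  rw [this]
  simp only [lintegral_mul_const _ (hf.mono hle le_rfl)]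
  rw [← Finset.mul_sum, ← ENNReal.ofReal_sum_of_nonneg fun k _ => (Real.exp_pos _).le]
  calc (K : ℝ≥0∞)⁻¹ * ((∫⁻ ω, f ω ∂P) * ENNReal.ofReal (∑ k, Real.exp (φ k)))
      ≤ (K : ℝ≥0∞)⁻¹ * ((∫⁻ ω, f ω ∂P) * ENNReal.ofReal (K : ℝ)) := by gcongr
    _ = ∫⁻ ω, f ω ∂P := by
        rw [ENNReal.ofReal_natCast, mul_comm (∫⁻ ω, f ω ∂P), ← mul_assoc,
          ENNReal.inv_mul_cancel hK (by simp), one_mul]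

/-- A function of the randomized position of an item and of the context, of mean at most one. -/
theorem condLeOne_exploration (henv : S.InEnvironment P M PX R₀ σ T)
    (hucr : S.FollowsUCR P M θhat ξ T₀ T) {t : ℕ} (ht : t ∈ Finset.Icc 1 T)
    (ht' : t ∈ Finset.Ico 1 T₀) (j : Fin K) {h : Fin K → EuclideanSpace ℝ (Fin d) → ℝ≥0∞}
    (hm : ∀ k, Measurable (h k)) (hh : ∑ k, ∫⁻ x, h k x ∂PX ≤ K) :
    CondLeOne (S.history t) P fun ω => h (S.ρ t ω j) (S.X t ω) := by
  intro f hf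
  have hle := henv.contextInfo_le ht
  have hK : (K : ℝ≥0∞) ≠ 0 := by simpa using j.pos.ne'
  have hX := henv.measurable_X t ht
  have := lintegral_position henv hucr ht ht' j
    (F := fun k ω => f ω * h k (S.X t ω)) fun k =>
      (hf.mono (S.history_le_contextInfo t) le_rfl).mul ((hm k).comp (S.measurable_X_contextInfo t))
  rw [this]
  have h1 : ∀ k, ∫⁻ ω, f ω * h k (S.X t ω) ∂P = (∫⁻ ω, f ω ∂P) * ∫⁻ x, h k x ∂PX := by
    intro k
    have hmk : Measurable[MeasurableSpace.comap (S.X t) inferInstance] fun ω => h k (S.X t ω) :=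
      (hm k).comp (comap_measurable (S.X t))
    rw [lintegral_mul_eq_lintegral_mul_lintegral_of_independent_measurableSpace
      ((S.history_le_contextInfo t).trans hle) hX.comap_le (henv.indep_X t ht).symm hf hmk,
      ← henv.law_X t ht, lintegral_map (hm k) hX]
  simp only [h1]
  rw [← Finset.mul_sum]
  calc (K : ℝ≥0∞)⁻¹ * ((∫⁻ ω, f ω ∂P) * ∑ k, ∫⁻ x, h k x ∂PX)
      ≤ (K : ℝ≥0∞)⁻¹ * ((∫⁻ ω, f ω ∂P) * K) := by gcongr
    _ = ∫⁻ ω, f ω ∂P := by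
        rw [mul_comm (∫⁻ ω, f ω ∂P), ← mul_assoc,
          ENNReal.inv_mul_cancel hK (by simp), one_mul]

/-- A function of the context, of mean at most one. -/
theorem condLeOne_context (henv : S.InEnvironment P M PX R₀ σ T) {t : ℕ}
    (ht : t ∈ Finset.Icc 1 T) {h : EuclideanSpace ℝ (Fin d) → ℝ≥0∞}
    (hm : Measurable h) (hh : ∫⁻ x, h x ∂PX ≤ 1) :
    CondLeOne (S.history t) P fun ω => h (S.X t ω) := by
  have hX := henv.measurable_X t ht
  refine CondLeOne.of_indep ((S.history_le_contextInfo t).trans (henv.contextInfo_le ht))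
    hX.comap_le (henv.indep_X t ht).symm (hm.comp (comap_measurable (S.X t))) ?_
  rwa [← lintegral_map hm hX, henv.law_X t ht]

end Randomization

/-! ### Moments of a uniform position. -/

section Moments

variable {K : ℕ}

/-- `(1 + y + y²/2)(1 - y + y²/2) = 1 + y⁴/4 ≥ 1`, and the first factor is at most `exp y`. -/
theorem exp_neg_le_quadratic {y : ℝ} (hy : 0 ≤ y) : Real.exp (-y) ≤ 1 - y + y ^ 2 / 2 := by
  have h1 := Real.quadratic_le_exp_of_nonneg hy
  rw [Real.exp_neg, inv_le_comm₀ (Real.exp_pos _) (by nlinarith [sq_nonneg (y - 1)])]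
  refine le_trans ?_ h1
  rw [inv_le_comm₀ (by nlinarith [sq_nonneg (y - 1)]) (by positivity),
    inv_le_iff_one_le_mul₀ (by positivity)]
  nlinarith [sq_nonneg (y ^ 2)]

/-- The half-range of the centred position. -/
noncomputable def posRange (K : ℕ) : ℝ := ((K : ℝ) - 1) / (2 * K)

/-- The centred position. -/
noncomputable def cposn (k : Fin K) : ℝ := posn k - 1 / (2 * (K : ℝ))

theorem cposn_eq (k : Fin K) : cposn k = (2 * (k : ℕ) - ((K : ℝ) - 1)) / (2 * K) := by
  have hK : (K : ℝ) ≠ 0 := by have := k.pos; positivity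
  rw [cposn, posn]
  field_simp
  ring

theorem abs_cposn_le (k : Fin K) : |cposn k| ≤ posRange K := by
  have hk : (k : ℝ) + 1 ≤ K := by exact_mod_cast k.2
  have hk0 : (0 : ℝ) ≤ (k : ℕ) := Nat.cast_nonneg _
  have hK : (0 : ℝ) < K := by linarith
  rw [cposn_eq, posRange, abs_div, abs_of_pos (show (0 : ℝ) < 2 * K by positivity)]
  gcongr
  rw [abs_le]
  constructor <;> linarith

theorem sum_val (K : ℕ) : ∑ k : Fin K, ((k : ℕ) : ℝ) = K * (K - 1) / 2 := by
  rw [Fin.sum_univ_eq_sum_range (fun i => (i : ℝ)) K]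
  induction K with
  | zero => simp
  | succ n ih => rw [Finset.sum_range_succ, ih]; push_cast; ring

theorem sum_val_sq (K : ℕ) :
    ∑ k : Fin K, ((k : ℕ) : ℝ) ^ 2 = K * (K - 1) * (2 * K - 1) / 6 := by
  rw [Fin.sum_univ_eq_sum_range (fun i => (i : ℝ) ^ 2) K]
  induction K with
  | zero => simp
  | succ n ih => rw [Finset.sum_range_succ, ih]; push_cast; ring

theorem sum_cposn : ∑ k : Fin K, cposn k = 0 := by
  simp only [cposn_eq, ← Finset.sum_div, Finset.sum_sub_distrib, ← Finset.mul_sum, sum_val]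
  simp
  left; ring

theorem sum_cposn_sq : ∑ k : Fin K, cposn k ^ 2 = K * posVar K := by
  rcases Nat.eq_zero_or_pos K with rfl | hK
  · simp
  have hK' : (K : ℝ) ≠ 0 := by positivity
  have h1 : ∀ k : Fin K, cposn k ^ 2 = (4 * ((k : ℕ) : ℝ) ^ 2 - 4 * ((K : ℝ) - 1) * (k : ℕ) +
      ((K : ℝ) - 1) ^ 2) / (4 * (K : ℝ) ^ 2) := fun k => by rw [cposn_eq, div_pow]; ring
  simp only [h1, ← Finset.sum_div, Finset.sum_sub_distrib, Finset.sum_add_distrib, ← Finset.mul_sum,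
    sum_val, sum_val_sq, Finset.sum_const, Finset.card_univ, Fintype.card_fin, nsmul_eq_mul, posVar]
  field_simp
  ring

/-- Clearing denominators leaves `(K - 2)(K - 3) ≥ 0`, true because `K` is an integer; equality
holds at 2 and 3. -/
theorem posRange_sq_le (hK : 2 ≤ K) : posRange K ^ 2 ≤ K / 2 * posVar K := by
  have h : (2 : ℝ) ≤ K := by exact_mod_cast hK
  rw [posRange, posVar, div_pow, div_mul_div_comm, div_le_div_iff₀ (by positivity) (by positivity)]
  have h1 : 0 ≤ ((K : ℝ) - 1) * (((K : ℝ) - 2) * (K - 3)) := by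
    refine mul_nonneg (by linarith) ?_
    rcases hK.eq_or_lt with h2 | h3
    · rw [← h2]; norm_num
    · have : (3 : ℝ) ≤ K := by exact_mod_cast h3
      exact mul_nonneg (by linarith) (by linarith)
  have h2 := mul_nonneg (sq_nonneg (K : ℝ)) h1
  linarith

theorem posRange_pos (hK : 2 ≤ K) : 0 < posRange K := by
  have h : (2 : ℝ) ≤ K := by exact_mod_cast hK
  have : 0 < (K : ℝ) - 1 := by linarith
  rw [posRange]; positivity

/-- The centred position is sub-Gaussian. -/
theorem sum_exp_mul_cposn_le (hK : 2 ≤ K) (l : ℝ) :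
    ∑ k : Fin K, Real.exp (l * cposn k - posRange K ^ 2 / 2 * l ^ 2) ≤ K := by
  have hr := posRange_pos hK
  set r := posRange K
  -- Hoeffding's argument: on `[-r, r]` the exponential lies below its chord, whose linear part
  -- averages to zero, and `cosh x ≤ exp (x²/2)`.
  have h1 : ∀ k : Fin K, Real.exp (l * cposn k) ≤
      Real.cosh (l * r) + cposn k / r * Real.sinh (l * r) := by
    intro k
    have hc := abs_le.1 (abs_cposn_le k)
    have h2 : 0 ≤ (1 + cposn k / r) / 2 := by
      have : -1 ≤ cposn k / r := by rw [le_div_iff₀ hr]; linarith [hc.1]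
      linarith
    have h3 : 0 ≤ (1 - cposn k / r) / 2 := by
      have : cposn k / r ≤ 1 := by rw [div_le_one hr]; exact hc.2
      linarith
    have := convexOn_exp.2 (Set.mem_univ (l * r)) (Set.mem_univ (-(l * r))) h2 h3 (by ring)
    simp only [smul_eq_mul] at this
    rw [show (1 + cposn k / r) / 2 * (l * r) + (1 - cposn k / r) / 2 * -(l * r) = l * cposn k by
      field_simp; ring] at this
    rw [Real.cosh_eq, Real.sinh_eq]
    linarith
  have h2 : ∑ k : Fin K, Real.exp (l * cposn k) ≤ K * Real.cosh (l * r) := by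
    refine (Finset.sum_le_sum fun k _ => h1 k).trans (le_of_eq ?_)
    rw [Finset.sum_add_distrib, ← Finset.sum_mul, ← Finset.sum_div, sum_cposn]
    simp
  have h3 := Real.cosh_le_exp_half_sq (l * r)
  simp only [Real.exp_sub, ← Finset.sum_div]
  rw [div_le_iff₀ (Real.exp_pos _)]
  refine h2.trans (mul_le_mul_of_nonneg_left (h3.trans (le_of_eq ?_)) (Nat.cast_nonneg _))
  congr 1; ring

/-- The squared centred position has a sub-Gaussian lower tail. -/
theorem sum_exp_neg_cposn_sq_le {t : ℝ} (ht : 0 ≤ t) :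
    ∑ k : Fin K, Real.exp (t * posVar K - t ^ 2 * posRange K ^ 2 * posVar K / 2 -
      t * cposn k ^ 2) ≤ K := by
  have h1 : ∀ k : Fin K, Real.exp (-(t * cposn k ^ 2)) ≤
      1 - t * cposn k ^ 2 + t ^ 2 * posRange K ^ 2 * cposn k ^ 2 / 2 := by
    intro k
    refine (exp_neg_le_quadratic (by positivity)).trans ?_
    have h2 : cposn k ^ 2 ≤ posRange K ^ 2 := by
      rw [← sq_abs]; exact pow_le_pow_left₀ (abs_nonneg _) (abs_cposn_le k) 2
    have h3 : t ^ 2 * cposn k ^ 2 * cposn k ^ 2 ≤ t ^ 2 * cposn k ^ 2 * posRange K ^ 2 := by gcongr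
    nlinarith
  have h2 : ∑ k : Fin K, Real.exp (-(t * cposn k ^ 2)) ≤
      K * Real.exp (-(t * posVar K - t ^ 2 * posRange K ^ 2 * posVar K / 2)) := by
    refine (Finset.sum_le_sum fun k _ => h1 k).trans ?_
    rw [Finset.sum_add_distrib, Finset.sum_sub_distrib, ← Finset.sum_div, ← Finset.mul_sum,
      ← Finset.mul_sum, sum_cposn_sq]
    have h3 := Real.add_one_le_exp (-(t * posVar K - t ^ 2 * posRange K ^ 2 * posVar K / 2))
    have h4 := mul_le_mul_of_nonneg_left h3 (Nat.cast_nonneg (α := ℝ) K)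
    refine le_trans (le_of_eq ?_) h4
    simp
    ring
  have h3 : ∀ k : Fin K, Real.exp (t * posVar K - t ^ 2 * posRange K ^ 2 * posVar K / 2 -
      t * cposn k ^ 2) = Real.exp (t * posVar K - t ^ 2 * posRange K ^ 2 * posVar K / 2) *
        Real.exp (-(t * cposn k ^ 2)) := fun k => by rw [← Real.exp_add]; congr 1
  simp only [h3, ← Finset.mul_sum]
  refine (mul_le_mul_of_nonneg_left h2 (Real.exp_pos _).le).trans (le_of_eq ?_)
  rw [mul_left_comm, ← Real.exp_add, add_neg_cancel, Real.exp_zero, mul_one]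

end Moments

end UCR

namespace UCR

open scoped ENNReal

/-! ### Moments of the contexts. -/

section Contexts

variable {d : ℕ} {PX : Measure (EuclideanSpace ℝ (Fin d))} {cx : ℝ}

theorem ContextVariation.integrable_mul [IsFiniteMeasure PX] (h : ContextVariation PX cx)
    (i j : Fin d) : Integrable (fun x : EuclideanSpace ℝ (Fin d) => x i * x j) PX := by
  refine Integrable.of_bound (by fun_prop) (1 : ℝ) ?_
  filter_upwards [h.norm_le] with x hx
  have h1 : ‖x‖ ≤ 1 := by
    have : √3 ≤ 2 := Real.sqrt_le_iff.2 ⟨by norm_num, by norm_num⟩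
    linarith
  rw [norm_mul]
  exact mul_le_one₀ ((PiLp.norm_apply_le x i).trans h1) (norm_nonneg _)
    ((PiLp.norm_apply_le x j).trans h1)

theorem ContextVariation.integrable_inner_sq [IsFiniteMeasure PX] (h : ContextVariation PX cx)
    (b : EuclideanSpace ℝ (Fin d)) :
    Integrable (fun x : EuclideanSpace ℝ (Fin d) => (inner ℝ b x) ^ 2) PX := by
  refine Integrable.of_bound (by fun_prop) (‖b‖ ^ 2) ?_
  filter_upwards [h.norm_le] with x hx
  have h1 : ‖x‖ ≤ 1 := by
    have : √3 ≤ 2 := Real.sqrt_le_iff.2 ⟨by norm_num, by norm_num⟩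
    linarith
  rw [Real.norm_eq_abs, abs_pow]
  refine pow_le_pow_left₀ (abs_nonneg _) ((abs_real_inner_le_norm b x).trans ?_) 2
  exact mul_le_of_le_one_right (norm_nonneg _) h1

theorem ContextVariation.le_integral_inner_sq [IsFiniteMeasure PX] (h : ContextVariation PX cx)
    (b : EuclideanSpace ℝ (Fin d)) : cx * ‖b‖ ^ 2 ≤ ∫ x, (inner ℝ b x) ^ 2 ∂PX := by
  have h1 := h.posSemidef.dotProduct_mulVec_nonneg b.ofLp
  rw [star_trivial, Matrix.sub_mulVec, dotProduct_sub, sub_nonneg, Matrix.smul_mulVec,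
    Matrix.one_mulVec, dotProduct_smul, ← inner_eq_dotProduct, real_inner_self_eq_norm_sq,
    smul_eq_mul] at h1
  refine h1.trans (le_of_eq ?_)
  have h2 : ∀ x : EuclideanSpace ℝ (Fin d),
      (inner ℝ b x) ^ 2 = ∑ i, ∑ j, b i * b j * (x i * x j) := by
    intro x
    rw [inner_eq_dotProduct, dotProduct, sq, Finset.sum_mul_sum]
    exact Finset.sum_congr rfl fun i _ => Finset.sum_congr rfl fun j _ => by ring
  simp only [h2]
  rw [integral_finsetSum _ fun i _ => integrable_finsetSum _ fun j _ =>
    (h.integrable_mul i j).const_mul _]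
  rw [dotProduct]
  refine Finset.sum_congr rfl fun i _ => ?_
  rw [integral_finsetSum _ fun j _ => (h.integrable_mul i j).const_mul _, Matrix.mulVec, dotProduct,
    Finset.mul_sum]
  refine Finset.sum_congr rfl fun j _ => ?_
  rw [integral_const_mul, Matrix.of_apply]
  ring

/-- Compare traces: `cx d ≤ E‖X‖² ≤ 3/4`. -/
theorem ContextVariation.mul_le [IsProbabilityMeasure PX] (h : ContextVariation PX cx) :
    cx * d ≤ 3 / 4 := by
  have h1 : ∀ i : Fin d, cx ≤ ∫ x : EuclideanSpace ℝ (Fin d), x i ^ 2 ∂PX := by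
    intro i
    have := h.le_integral_inner_sq (EuclideanSpace.single i 1)
    simpa [EuclideanSpace.inner_single_left] using this
  have h2 : ∫ x : EuclideanSpace ℝ (Fin d), ∑ i, x i ^ 2 ∂PX ≤ ∫ x, (3 / 4 : ℝ) ∂PX := by
    refine integral_mono_ae (integrable_finsetSum _ fun i _ => ?_) (integrable_const _) ?_
    · simpa only [sq] using h.integrable_mul i i
    · filter_upwards [h.norm_le] with x hx
      have h3 : ‖x‖ ^ 2 ≤ (√3 / 2) ^ 2 := by gcongr
      rw [div_pow, Real.sq_sqrt (by norm_num), EuclideanSpace.norm_sq_eq] at h3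
      simp only [Real.norm_eq_abs, sq_abs] at h3
      linarith
  rw [integral_finsetSum _ fun i _ => by simpa only [sq] using h.integrable_mul i i] at h2
  have h3 := Finset.sum_le_sum fun i (_ : i ∈ Finset.univ) => h1 i
  simp at h2 h3
  linarith

/-- With `y = (u·x)² / 8 ≤ 1.02² · (3/4) / 8 < 0.0976`, `1 - y + y²/2 ≤ 1 - 0.9512 y`, and `0.9512 /
8 = 0.1189`. -/
theorem ContextVariation.integral_exp_le [IsProbabilityMeasure PX] (h : ContextVariation PX cx)
    {u : EuclideanSpace ℝ (Fin d)} (hu : ‖u‖ ≤ 102 / 100) :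
    ∫⁻ x, ENNReal.ofReal (Real.exp (-(1 / 8 * (inner ℝ u x) ^ 2))) ∂PX ≤
      ENNReal.ofReal (1 - 1189 / 10000 * cx * ‖u‖ ^ 2) := by
  have hint := h.integrable_inner_sq u
  have h1 : ∀ᵐ x ∂PX, Real.exp (-(1 / 8 * (inner ℝ u x) ^ 2)) ≤
      1 - 1189 / 10000 * (inner ℝ u x) ^ 2 := by
    filter_upwards [h.norm_le] with x hx
    refine (exp_neg_le_quadratic (by positivity)).trans ?_
    have h2 : (inner ℝ u x) ^ 2 ≤ (102 / 100) ^ 2 * (3 / 4) := by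
      have h3 := real_inner_mul_inner_self_le u x
      rw [real_inner_self_eq_norm_sq, real_inner_self_eq_norm_sq] at h3
      have h4 : ‖x‖ ^ 2 ≤ (√3 / 2) ^ 2 := by gcongr
      rw [div_pow, Real.sq_sqrt (by norm_num)] at h4
      have h5 : ‖u‖ ^ 2 ≤ (102 / 100) ^ 2 := by gcongr
      calc (inner ℝ u x) ^ 2 = inner ℝ u x * inner ℝ u x := sq _
        _ ≤ ‖u‖ ^ 2 * ‖x‖ ^ 2 := h3
        _ ≤ (102 / 100) ^ 2 * (3 / 4) := by
            have : (3 : ℝ) / 2 ^ 2 = 3 / 4 := by norm_num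
            rw [this] at h4
            gcongr
    have h3 : (inner ℝ u x) ^ 2 * (inner ℝ u x) ^ 2 ≤
        (102 / 100) ^ 2 * (3 / 4) * (inner ℝ u x) ^ 2 := by gcongr
    nlinarith [sq_nonneg (inner ℝ u x)]
  calc _ ≤ ∫⁻ x, ENNReal.ofReal (1 - 1189 / 10000 * (inner ℝ u x) ^ 2) ∂PX :=
        lintegral_mono_ae (h1.mono fun x hx => ENNReal.ofReal_le_ofReal hx)
    _ = ENNReal.ofReal (∫ x, (1 - 1189 / 10000 * (inner ℝ u x) ^ 2) ∂PX) := by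
        exact (ofReal_integral_eq_lintegral_ofReal
          (f := fun x => 1 - 1189 / 10000 * (inner ℝ u x) ^ 2)
          ((integrable_const _).sub (hint.const_mul _))
          (h1.mono fun x hx => (Real.exp_pos _).le.trans hx)).symm
    _ ≤ _ := by
        refine ENNReal.ofReal_le_ofReal ?_
        rw [integral_sub (integrable_const _) (hint.const_mul _), integral_const_mul]
        have := h.le_integral_inner_sq u
        simp
        linarith

end Contexts

/-! ### Probabilities of the exceptional events. -/

section FailureProbabilities

theorem measurable_join {d : ℕ} {Ω : Type*} {G : MeasurableSpace Ω} {f : Ω → ℝ} {X : Ω → EuclideanSpace ℝ (Fin d)}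
    (hf : Measurable[G] f) (hX : Measurable[G] X) :
    Measurable[G] fun ω => (join (f ω) (X ω)).ofLp := by
  refine measurable_pi_iff.2 fun i => ?_
  refine Fin.cases ?_ (fun i => ?_) i
  · simpa [join] using hf
  · have : Measurable fun x : EuclideanSpace ℝ (Fin d) => x i := by fun_prop
    exact this.comp hX

variable {d K : ℕ} {Ω : Type*} [m0 : MeasurableSpace Ω] {P : Measure Ω} [IsProbabilityMeasure P]
  {S : Run d K Ω} {M : Model d K} {PX : Measure (EuclideanSpace ℝ (Fin d))}
  {R₀ σ ξ cx c₁ δ : ℝ} {N T : ℕ} {θhat : ℕ → Fin K → Ω → EuclideanSpace ℝ (Fin (d + 1))}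

/-- The filtration is the information at the decision: the displayed feature is predictable for it,
and the noise of the outcome is conditionally sub-Gaussian. -/
theorem measure_noise_le (henv : S.InEnvironment P M PX R₀ σ T) (hA : Continuous (deriv M.A))
    (hσ : 0 < σ) (hX : ∀ᵐ x ∂PX, ‖x‖ ≤ √3 / 2) {δ' : ℝ} (hδ' : 0 < δ') (j : Fin K) :
    P {ω | ¬ ∀ t ∈ Finset.Icc 1 (T + 1), ∀ a : EuclideanSpace ℝ (Fin (d + 1)),
      (∑ s ∈ Finset.Ico 1 t, inner ℝ a (S.Z s j ω) *
        (S.obs s j ω - deriv M.A (inner ℝ (M.θ j) (S.Z s j ω)))) ^ 2 ≤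
      σ ^ 2 * (∑ s ∈ Finset.Ico 1 t, (inner ℝ a (S.Z s j ω)) ^ 2 + ‖a‖ ^ 2) *
        ((d + 1) * Real.log (1 + T / (d + 1)) + 2 * Real.log (1 / δ'))} ≤ ENNReal.ofReal δ' := by
  have hle : ∀ t ∈ Finset.Icc 1 T, S.decisionInfo t ≤ m0 := fun t ht => henv.decisionInfo_le ht
  have hZ : ∀ s, Measurable[S.decisionInfo s] fun ω => (S.Z s j ω).ofLp := fun s =>
    measurable_join (S.measurable_ρ_decisionInfo s fun π => posn (π j))
      ((S.measurable_X_contextInfo s).mono (S.contextInfo_le_decisionInfo s) le_rfl)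
  refine le_trans (measure_mono ?_) (self_normalized (P := P) (n := d + 1) (Nat.succ_pos d) (N := T)
    (G := capped m0 T S.decisionInfo) (fun t _ => capped_le hle t)
    (capped_mono hle fun s t => S.decisionInfo_mono) hσ one_pos hδ'
    (Φ := fun s ω => (S.Z s j ω).ofLp)
    (η := fun s ω => S.obs s j ω - deriv M.A (inner ℝ (M.θ j) (S.Z s j ω)))
    (fun s hs => ?_) (fun s hs => ?_) (fun s hs l => ?_) (fun s hs => ?_))
  · refine Set.compl_subset_compl.2 fun ω hω t ht a => ?_
    have := hω t ht a.ofLp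
    simp only [← inner_eq_dotProduct, real_inner_self_eq_norm_sq, one_mul, mul_one] at this
    push_cast at this
    exact this
  · rw [capped_of_mem hs]; exact hZ s
  · have hs1 := (Finset.mem_Icc.1 hs).1
    have hm : Measurable[S.history (s + 1)] fun ω =>
        S.obs s j ω - deriv M.A (inner ℝ (M.θ j) (S.Z s j ω)) := by
      refine (S.measurable_obs_history hs1 j).sub (hA.measurable.comp ?_)
      have h1 : Measurable fun z : Fin (d + 1) → ℝ => (M.θ j).ofLp ⬝ᵥ z := by
        simp only [dotProduct]; fun_prop
      simp only [inner_eq_dotProduct]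
      exact h1.comp ((hZ s).mono (S.decisionInfo_le_history hs1) le_rfl)
    exact hm.mono (le_capped_succ (henv.history_le (Nat.succ_le_succ (Finset.mem_Icc.1 hs).2))
      ((S.history_le_contextInfo _).trans (S.contextInfo_le_decisionInfo _))) le_rfl
  · rw [capped_of_mem hs]
    exact henv.condLeOne_noise hA hs j l
  · filter_upwards [henv.ae_of_ae hs hX] with ω hω
    rw [← inner_eq_dotProduct, real_inner_self_eq_norm_sq]
    exact pow_le_one₀ (norm_nonneg _) (norm_feature_le _ hω)

/-- Given past and context, the centred position is sub-Gaussian noise, and `(1/(2K), X)` is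
predictable. Its product with `(α, b)` is the factor `b·X + α/(2K)` of the cross term, so
`self_normalized` applies. -/
theorem measure_cross_le (henv : S.InEnvironment P M PX R₀ σ T)
    (hucr : S.FollowsUCR P M θhat ξ (N + 1) T) (hcal : Calibration d K cx c₁ δ N T)
    (hX : ∀ᵐ x ∂PX, ‖x‖ ≤ √3 / 2) (j : Fin K) :
    P {ω | ¬ ∀ (α : ℝ) (b : EuclideanSpace ℝ (Fin d)),
      (∑ s ∈ Finset.Ico 1 (N + 1), (inner ℝ b (S.X s ω) + α * (1 / (2 * (K : ℝ)))) *
        (posn (S.ρ s ω j) - 1 / (2 * (K : ℝ)))) ^ 2 ≤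
      31 / 10000 * (posVar K * N) *
        (∑ s ∈ Finset.Ico 1 (N + 1), (inner ℝ b (S.X s ω) + α * (1 / (2 * (K : ℝ)))) ^ 2 +
          5 / 2 / c₁ * (α ^ 2 + ‖b‖ ^ 2))} ≤ ENNReal.ofReal (δ / (8 * K)) := by
  have hNT := hcal.lt_horizon
  have hsub : ∀ t ∈ Finset.Icc 1 N, t ∈ Finset.Icc 1 T ∧ t ∈ Finset.Ico 1 (N + 1) := fun t ht => by
    have := Finset.mem_Icc.1 ht
    exact ⟨Finset.mem_Icc.2 ⟨by omega, by omega⟩, Finset.mem_Ico.2 ⟨by omega, by omega⟩⟩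
  have hle : ∀ t ∈ Finset.Icc 1 N, S.contextInfo t ≤ m0 :=
    fun t ht => henv.contextInfo_le (hsub t ht).1
  have hlam : 0 < 5 / 2 / c₁ := by have := hcal.c₁_pos; positivity
  have hδ' : 0 < δ / (8 * K) := by
    have := hcal.δ_pos
    have : (0 : ℝ) < K := by exact_mod_cast j.pos
    positivity
  refine le_trans (measure_mono ?_) (self_normalized (P := P) (n := d + 1) (Nat.succ_pos d) (N := N)
    (G := capped m0 N S.contextInfo) (fun t _ => capped_le hle t)
    (capped_mono hle fun s t => S.contextInfo_mono) (posRange_pos hcal.two_le_K) hlam hδ'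
    (Φ := fun s ω => (join (1 / (2 * (K : ℝ))) (S.X s ω)).ofLp)
    (η := fun s ω => cposn (S.ρ s ω j))
    (fun s hs => ?_) (fun s hs => ?_) (fun s hs l => ?_) (fun s hs => ?_))
  · refine Set.compl_subset_compl.2 fun ω hω α b => ?_
    have := hω (N + 1) (Finset.mem_Icc.2 ⟨by omega, le_rfl⟩) (join α b).ofLp
    simp only [← inner_eq_dotProduct, real_inner_self_eq_norm_sq, norm_join_sq, inner_join] at this
    simp only [add_comm (α * (1 / (2 * (K : ℝ))))] at this
    refine this.trans ?_
    push_cast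
    have h1 := hcal.cross
    have h2 := posRange_sq_le hcal.two_le_K
    have h3 : 0 ≤ posVar K := by linarith [posVar_ge hcal.two_le_K]
    set Q := ((d : ℝ) + 1) * Real.log (1 + N / (((d : ℝ) + 1) * (5 / 2 / c₁))) +
      2 * Real.log (1 / (δ / (8 * K))) with hQ
    have hQ0 : 0 ≤ Q := by
      have hK : (2 : ℝ) ≤ K := by exact_mod_cast hcal.two_le_K
      have := hcal.δ_lt
      have h4 : 0 ≤ Real.log (1 / (δ / (8 * K))) := Real.log_nonneg (by
        rw [one_div_div, le_div_iff₀ hcal.δ_pos]; linarith)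
      have h5 : 0 ≤ Real.log (1 + N / (((d : ℝ) + 1) * (5 / 2 / c₁))) := Real.log_nonneg (by
        linarith [show 0 ≤ N / (((d : ℝ) + 1) * (5 / 2 / c₁)) by positivity])
      positivity
    have h4 : posRange K ^ 2 * Q ≤ 31 / 10000 * (posVar K * N) := by
      calc posRange K ^ 2 * Q ≤ K / 2 * posVar K * Q := by gcongr
        _ = posVar K * (K / 2 * Q) := by ring
        _ ≤ posVar K * (31 / 10000 * N) := by gcongr
        _ = _ := by ring
    have h5 : 0 ≤ ∑ s ∈ Finset.Ico 1 (N + 1),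
        (inner ℝ b (S.X s ω) + α * (1 / (2 * (K : ℝ)))) ^ 2 + 5 / 2 / c₁ * (α ^ 2 + ‖b‖ ^ 2) :=
      add_nonneg (Finset.sum_nonneg fun _ _ => sq_nonneg _) (by positivity)
    calc _ = posRange K ^ 2 * Q * (∑ s ∈ Finset.Ico 1 (N + 1),
        (inner ℝ b (S.X s ω) + α * (1 / (2 * (K : ℝ)))) ^ 2 + 5 / 2 / c₁ * (α ^ 2 + ‖b‖ ^ 2)) := by
          rw [hQ]; ring
      _ ≤ _ := by gcongr
  · rw [capped_of_mem hs]
    exact measurable_join measurable_const (S.measurable_X_contextInfo s)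
  · have hs1 := (Finset.mem_Icc.1 hs).1
    have hm : Measurable[S.history (s + 1)] fun ω => cposn (S.ρ s ω j) :=
      (S.measurable_ρ_decisionInfo s fun π => cposn (π j)).mono (S.decisionInfo_le_history hs1) le_rfl
    exact hm.mono (le_capped_succ (henv.history_le (by have := Finset.mem_Icc.1 hs; omega))
      (S.history_le_contextInfo _)) le_rfl
  · rw [capped_of_mem hs]
    exact condLeOne_position henv hucr (hsub s hs).1 (hsub s hs).2 j
      (φ := fun k => l * cposn k - posRange K ^ 2 / 2 * l ^ 2)
      (sum_exp_mul_cposn_le hcal.two_le_K l)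
  · filter_upwards [henv.ae_of_ae (hsub s hs).1 hX] with ω hω
    rw [← inner_eq_dotProduct, real_inner_self_eq_norm_sq, norm_join_sq]
    have h2 : ‖S.X s ω‖ ^ 2 ≤ (√3 / 2) ^ 2 := by gcongr
    rw [div_pow, Real.sq_sqrt (by norm_num)] at h2
    have h3 : 1 / (2 * (K : ℝ)) ≤ 1 / 2 := by
      have : (2 : ℝ) ≤ K := by exact_mod_cast hcal.two_le_K
      rw [div_le_div_iff₀ (by positivity) (by norm_num)]; linarith
    have h4 : (1 / (2 * (K : ℝ))) ^ 2 ≤ (1 / 2) ^ 2 := by gcongr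
    linarith

theorem measure_variance_le (henv : S.InEnvironment P M PX R₀ σ T)
    (hucr : S.FollowsUCR P M θhat ξ (N + 1) T) (hcal : Calibration d K cx c₁ δ N T) (j : Fin K) :
    P {ω | ¬ 97 / 100 * (posVar K * N) ≤
      ∑ s ∈ Finset.Ico 1 (N + 1), (posn (S.ρ s ω j) - 1 / (2 * (K : ℝ))) ^ 2} ≤
      ENNReal.ofReal (δ / (8 * K)) := by
  have hNT := hcal.lt_horizon
  have hsub : ∀ t ∈ Finset.Icc 1 N, t ∈ Finset.Icc 1 T ∧ t ∈ Finset.Ico 1 (N + 1) := fun t ht => by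
    have := Finset.mem_Icc.1 ht
    exact ⟨Finset.mem_Icc.2 ⟨by omega, by omega⟩, Finset.mem_Ico.2 ⟨by omega, by omega⟩⟩
  have hle : ∀ t ∈ Finset.Icc 1 N, S.contextInfo t ≤ m0 :=
    fun t ht => henv.contextInfo_le (hsub t ht).1
  have hr := posRange_pos hcal.two_le_K
  have hK : (0 : ℝ) < K := by exact_mod_cast j.pos
  -- The optimal exponent for a relative deficit of 3/100. It yields the rate `0.00045 posVar /
  -- posRange²` per round, at least `0.0009 / K`.
  set t := 3 / 100 / posRange K ^ 2 with htdef
  have ht0 : 0 ≤ t := by positivity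
  refine le_trans (measure_mono ?_) ((exp_tail (P := P) (N := N) (G := capped m0 N S.contextInfo)
    (fun t _ => capped_le hle t) (capped_mono hle fun s t => S.contextInfo_mono)
    (ψ := fun s ω => t * posVar K - t ^ 2 * posRange K ^ 2 * posVar K / 2 -
      t * cposn (S.ρ s ω j) ^ 2) (fun s hs => ?_) (fun s hs => ?_) (9 / 10000 * (N / K))).trans
      (ENNReal.ofReal_le_ofReal hcal.variance))
  · intro ω hω
    simp only [Set.mem_ofPred_eq, not_le] at hω ⊢
    have hω' : ∑ s ∈ Finset.Ico 1 (N + 1), cposn (S.ρ s ω j) ^ 2 ≤ 97 / 100 * (posVar K * N) := hω.le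
    rw [Finset.sum_sub_distrib, ← Finset.mul_sum, Finset.sum_const, Nat.card_Ico, nsmul_eq_mul,
      Nat.add_sub_cancel]
    have h1 : t ^ 2 * posRange K ^ 2 * posVar K / 2 = 3 / 200 * t * posVar K := by
      rw [htdef]; field_simp; ring
    rw [h1]
    have h2 : t * ∑ s ∈ Finset.Ico 1 (N + 1), cposn (S.ρ s ω j) ^ 2 ≤
        t * (97 / 100 * (posVar K * N)) := by gcongr
    have h3 : 9 / 10000 * ((N : ℝ) / K) ≤ 3 / 200 * t * posVar K * N := by
      have h4 : 2 / (K : ℝ) ≤ posVar K / posRange K ^ 2 := by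
        rw [div_le_div_iff₀ hK (by positivity)]
        linarith [posRange_sq_le hcal.two_le_K]
      have h5 : 3 / 200 * t * posVar K * N =
          45 / 100000 * (posVar K / posRange K ^ 2) * N := by rw [htdef]; ring
      rw [h5]
      calc 9 / 10000 * ((N : ℝ) / K) = 45 / 100000 * (2 / K) * N := by ring
        _ ≤ _ := by gcongr
    linarith
  · have hs1 := (Finset.mem_Icc.1 hs).1
    exact ((S.measurable_ρ_decisionInfo s fun π => t * posVar K -
      t ^ 2 * posRange K ^ 2 * posVar K / 2 - t * cposn (π j) ^ 2).mono
      (S.decisionInfo_le_history hs1) le_rfl).mono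
      (le_capped_succ (henv.history_le (by have := Finset.mem_Icc.1 hs; omega))
      (S.history_le_contextInfo _)) le_rfl
  · rw [capped_of_mem hs]
    exact condLeOne_position henv hucr (hsub s hs).1 (hsub s hs).2 j
      (φ := fun k => t * posVar K - t ^ 2 * posRange K ^ 2 * posVar K / 2 - t * cposn k ^ 2)
      (sum_exp_neg_cposn_sq_le ht0)

/-- The exponential rate of the lower tail of the quadratic forms of the contexts. -/
theorem Calibration.tail_exponent (hcal : Calibration d K cx c₁ δ N T) {N' : ℕ} {q ϑ : ℝ}
    (hq : 0 ≤ q) (hϑ : 0 ≤ ϑ)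
    (h : 512 / 10000 + (√ϑ + 2 / 100) ^ 2 ≤ 9512 / 10000 * q * (98 / 100) ^ 2) :
    64 / 10000 * N' * cx ≤
      N' * (1189 / 10000 * q * cx) * (1 - 2 / 100 * √(cx / (3 / 4))) ^ 2 -
        1 / 8 * (√(ϑ * N' * cx) + 2 / 100 * √(cx / (3 / 4)) * (√3 / 2) * √N') ^ 2 := by
  have hcx : 0 < cx := hcal.c₁_pos.trans_le hcal.c₁_le_cx
  have hcx' := GoodExploration.cx_le hcal
  have hg : √(cx / (3 / 4)) ≤ 1 := Real.sqrt_le_one.2 (by rw [div_le_one (by norm_num)]; exact hcx')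
  have h1 : √(cx / (3 / 4)) * (√3 / 2) = √cx := by
    have : √3 / 2 = √(3 / 4) := by
      rw [Real.sqrt_div (by norm_num), show (4 : ℝ) = 2 ^ 2 by norm_num, Real.sqrt_sq (by norm_num)]
    rw [this, ← Real.sqrt_mul (by positivity), div_mul_cancel₀ _ (by norm_num)]
  have h2 : √(ϑ * N' * cx) + 2 / 100 * √(cx / (3 / 4)) * (√3 / 2) * √N' =
      (√ϑ + 2 / 100) * (√cx * √N') := by
    rw [mul_assoc (2 / 100) _ (√3 / 2), h1, Real.sqrt_mul (by positivity), Real.sqrt_mul hϑ]; ring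
  have h3 : (98 / 100 : ℝ) ^ 2 ≤ (1 - 2 / 100 * √(cx / (3 / 4))) ^ 2 := by
    refine pow_le_pow_left₀ (by norm_num) ?_ 2
    linarith
  have h4 : N' * (1189 / 10000 * q * cx) * (98 / 100 : ℝ) ^ 2 ≤
      N' * (1189 / 10000 * q * cx) * (1 - 2 / 100 * √(cx / (3 / 4))) ^ 2 := by gcongr
  rw [h2, mul_pow, mul_pow, Real.sq_sqrt hcx.le, Real.sq_sqrt (Nat.cast_nonneg _)]
  have h5 : 0 ≤ cx * N' := by positivity
  -- After division by 8 the constants of `h` become the rate `64/10000` and the moment constant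
  -- `1189/10000`.
  have h6 := mul_le_mul_of_nonneg_right h h5
  linarith

theorem measure_context_le (henv : S.InEnvironment P M PX R₀ σ T)
    (hcal : Calibration d K cx c₁ δ N T) [IsProbabilityMeasure PX] (hctx : ContextVariation PX cx)
    {N' : ℕ} (hN' : N ≤ N') (hN'T : N' ≤ T) :
    P {ω | ¬ ∀ b : EuclideanSpace ℝ (Fin d), 82 / 100 * N' * cx * ‖b‖ ^ 2 ≤
      ∑ s ∈ Finset.Ico 1 (N' + 1), (inner ℝ b (S.X s ω)) ^ 2} ≤ ENNReal.ofReal (δ / (8 * K)) := by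
  have hcx : 0 < cx := hctx.pos
  have hcx' := GoodExploration.cx_le hcal
  have hsub : ∀ t ∈ Finset.Icc 1 N', t ∈ Finset.Icc 1 T := fun t ht => by
    have := Finset.mem_Icc.1 ht
    exact Finset.mem_Icc.2 ⟨by omega, by omega⟩
  have hle : ∀ t ∈ Finset.Icc 1 N', S.history t ≤ m0 := fun t ht =>
    henv.history_le (by have := Finset.mem_Icc.1 (hsub t ht); omega)
  have hg0 : 0 < √(cx / (3 / 4)) := Real.sqrt_pos.2 (by positivity)
  have hg : √(cx / (3 / 4)) ≤ 1 := Real.sqrt_le_one.2 (by rw [div_le_one (by norm_num)]; exact hcx')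
  have hN0 : 0 < N' := by
    have h1 := hcal.N_pos
    have h2 : (N : ℝ) ≤ N' := by exact_mod_cast hN'
    exact_mod_cast (show (0 : ℝ) < N' by linarith)
  have hN0' : (0 : ℝ) < N' := by exact_mod_cast hN0
  -- The radius `τ` scales like `√cx`, so that moving a direction by `τ` changes the square root of
  -- the form by at most 2/100 of its natural size `√(cx N')`.
  refine (quadratic_lower_tail (P := P) (N := N') (G := capped m0 N' S.history)
    (fun t _ => capped_le hle t) (capped_mono hle fun s t _ => S.history_mono)
    (Ψ := S.X) (τ := 2 / 100 * √(cx / (3 / 4))) (b := √3 / 2) (r := 1189 / 10000 * 1 * cx)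
    (k := 1 / 8) (Λ := 82 / 100 * N' * cx) hN0 (by positivity) (by linarith) (by positivity)
    (by positivity) (by norm_num) (by positivity) (fun s hs => ?_)
    (fun s hs => henv.ae_of_ae (hsub s hs) hctx.norm_le) (fun s hs u hu => ?_)).trans
    (ENNReal.ofReal_le_ofReal (hcal.covering hN' (hcal.tail_exponent zero_le_one (by norm_num) ?_)))
  · have hs1 := (Finset.mem_Icc.1 hs).1
    exact (S.measurable_X_history hs1).mono
      (le_capped_succ (henv.history_le (by have := Finset.mem_Icc.1 (hsub s hs); omega)) le_rfl) le_rfl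
  · rw [capped_of_mem hs]
    refine condLeOne_context henv (hsub s hs) (h := fun x => ENNReal.ofReal
      (Real.exp (1189 / 10000 * 1 * cx * ‖u‖ ^ 2 - 1 / 8 * (inner ℝ u x) ^ 2))) (by fun_prop) ?_
    simp only [sub_eq_add_neg, Real.exp_add, ENNReal.ofReal_mul (Real.exp_pos _).le]
    rw [lintegral_const_mul _ (by fun_prop)]
    refine (mul_le_mul_right (hctx.integral_exp_le (by linarith)) _).trans ?_
    rw [← ENNReal.ofReal_mul (Real.exp_pos _).le, ← ENNReal.ofReal_one]
    refine ENNReal.ofReal_le_ofReal ?_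
    have := Real.add_one_le_exp (-(1189 / 10000 * cx * ‖u‖ ^ 2))
    calc Real.exp (1189 / 10000 * 1 * cx * ‖u‖ ^ 2) * (1 - 1189 / 10000 * cx * ‖u‖ ^ 2)
        ≤ Real.exp (1189 / 10000 * 1 * cx * ‖u‖ ^ 2) *
          Real.exp (-(1189 / 10000 * cx * ‖u‖ ^ 2)) := by gcongr; linarith
      _ = 1 := by rw [← Real.exp_add, mul_one, add_neg_cancel, Real.exp_zero]
  · have : √(82 / 100) ≤ 9056 / 10000 := Real.sqrt_le_iff.2 ⟨by norm_num, by norm_num⟩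
    have h2 : (√(82 / 100) + 2 / 100) ^ 2 ≤ (9056 / 10000 + 2 / 100) ^ 2 := by gcongr
    norm_num at h2 ⊢
    linarith

/-- With two items the position encoded by zero occurs with probability one half. Contexts are set
to zero in the other rounds, so half of the moment gain remains. -/
theorem measure_context_two_le (henv : S.InEnvironment P M PX R₀ σ T)
    (hucr : S.FollowsUCR P M θhat ξ (N + 1) T) (hcal : Calibration d K cx c₁ δ N T)
    [IsProbabilityMeasure PX] (hctx : ContextVariation PX cx) (hK : K = 2) (j : Fin K) :
    P {ω | ¬ ∀ b : EuclideanSpace ℝ (Fin d), 38 / 100 * N * cx * ‖b‖ ^ 2 ≤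
      ∑ s ∈ Finset.Ico 1 (N + 1) with posn (S.ρ s ω j) = 0, (inner ℝ b (S.X s ω)) ^ 2} ≤
      ENNReal.ofReal (δ / (8 * K)) := by
  have hcx : 0 < cx := hctx.pos
  have hcx' := GoodExploration.cx_le hcal
  have hNT := hcal.lt_horizon
  have hsub : ∀ t ∈ Finset.Icc 1 N, t ∈ Finset.Icc 1 T ∧ t ∈ Finset.Ico 1 (N + 1) := fun t ht => by
    have := Finset.mem_Icc.1 ht
    exact ⟨Finset.mem_Icc.2 ⟨by omega, by omega⟩, Finset.mem_Ico.2 ⟨by omega, by omega⟩⟩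
  have hle : ∀ t ∈ Finset.Icc 1 N, S.history t ≤ m0 := fun t ht =>
    henv.history_le (by have := Finset.mem_Icc.1 ht; omega)
  have hg0 : 0 < √(cx / (3 / 4)) := Real.sqrt_pos.2 (by positivity)
  have hg : √(cx / (3 / 4)) ≤ 1 := Real.sqrt_le_one.2 (by rw [div_le_one (by norm_num)]; exact hcx')
  have hN0' : 0 < (N : ℝ) := by linarith [hcal.N_pos]
  have hN0 : 0 < N := by exact_mod_cast hN0'
  classical
  refine (measure_mono ?_).trans ((quadratic_lower_tail (P := P) (N := N)
    (G := capped m0 N S.history)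
    (fun t _ => capped_le hle t) (capped_mono hle fun s t _ => S.history_mono)
    (Ψ := fun s ω => if posn (S.ρ s ω j) = 0 then S.X s ω else 0)
    (τ := 2 / 100 * √(cx / (3 / 4))) (b := √3 / 2) (r := 1189 / 10000 * (1 / 2) * cx)
    (k := 1 / 8) (Λ := 38 / 100 * N * cx) hN0 (by positivity) (by linarith) (by positivity)
    (by positivity) (by norm_num) (by positivity) (fun s hs => ?_)
    (fun s hs => ?_) (fun s hs u hu => ?_)).trans
    (ENNReal.ofReal_le_ofReal (hcal.covering le_rfl
      (hcal.tail_exponent (by norm_num) (by norm_num) ?_))))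
  · refine Set.compl_subset_compl.2 fun ω hω b => (hω b).trans (le_of_eq ?_)
    rw [Finset.sum_filter]
    refine Finset.sum_congr rfl fun s _ => ?_
    split_ifs <;> simp
  · have hs1 := (Finset.mem_Icc.1 hs).1
    have hset : MeasurableSet[S.history (s + 1)] {ω | posn (S.ρ s ω j) = 0} :=
      S.decisionInfo_le_history hs1 _
        (S.measurableSet_ρ_decisionInfo s {π : Equiv.Perm (Fin K) | posn (π j) = 0})
    exact (Measurable.ite hset (S.measurable_X_history hs1) measurable_const).mono
      (le_capped_succ (henv.history_le (by have := Finset.mem_Icc.1 hs; omega)) le_rfl) le_rfl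
  · filter_upwards [henv.ae_of_ae (hsub s hs).1 hctx.norm_le] with ω hω
    split_ifs
    · exact hω
    · rw [norm_zero]; positivity
  · rw [capped_of_mem hs]
    subst hK
    have hmeas : ∀ k : Fin 2, Measurable fun x : EuclideanSpace ℝ (Fin d) => ENNReal.ofReal
        (Real.exp (1189 / 10000 * (1 / 2) * cx * ‖u‖ ^ 2 -
          1 / 8 * (inner ℝ u (if posn k = 0 then x else 0)) ^ 2)) := by
      intro k
      split_ifs <;> fun_prop
    refine condLeOne_exploration henv hucr (hsub s hs).1 (hsub s hs).2 j
      (h := fun k x => ENNReal.ofReal (Real.exp (1189 / 10000 * (1 / 2) * cx * ‖u‖ ^ 2 -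
          1 / 8 * (inner ℝ u (if posn k = 0 then x else 0)) ^ 2))) hmeas ?_
    have h0 : posn (0 : Fin 2) = 0 := by simp [posn]
    have h1 : posn (1 : Fin 2) ≠ 0 := by norm_num [posn]
    have hexp := Real.add_one_le_exp (-(1189 / 10000 * (1 / 2) * cx * ‖u‖ ^ 2))
    set y := 1189 / 10000 * (1 / 2) * cx * ‖u‖ ^ 2 with hy
    have hnn : 0 ≤ 1 - 1189 / 10000 * cx * ‖u‖ ^ 2 := by
      have hu' : ‖u‖ ≤ 102 / 100 := by linarith
      have h2 : cx * ‖u‖ ^ 2 ≤ 3 / 4 * (102 / 100) ^ 2 := by gcongr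
      norm_num at h2
      linarith
    rw [Fin.sum_univ_two]
    simp only [h0, h1, if_true, if_false, inner_zero_right]
    simp only [sub_eq_add_neg, Real.exp_add, ENNReal.ofReal_mul (Real.exp_pos _).le]
    rw [lintegral_const_mul _ (by fun_prop)]
    refine (add_le_add_left (mul_le_mul_right (hctx.integral_exp_le (by linarith)) _) _).trans ?_
    simp only [ne_eq, OfNat.ofNat_ne_zero, not_false_eq_true, zero_pow, mul_zero, neg_zero,
      Real.exp_zero, ENNReal.ofReal_one, mul_one, lintegral_const, measure_univ]
    rw [← ENNReal.ofReal_mul (Real.exp_pos _).le, ← ENNReal.ofReal_add (mul_nonneg (Real.exp_pos _).le hnn)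
      (Real.exp_pos _).le]
    rw [show ((2 : ℕ) : ℝ≥0∞) = ENNReal.ofReal 2 by simp]
    refine ENNReal.ofReal_le_ofReal ?_
    have h2 : Real.exp y * (2 * (-y + 1)) ≤ Real.exp y * (2 * Real.exp (-y)) := by gcongr
    have h3 : Real.exp y * Real.exp (-y) = 1 := by
      rw [← Real.exp_add, add_neg_cancel, Real.exp_zero]
    have h4 : 1189 / 10000 * cx * ‖u‖ ^ 2 = 2 * y := by rw [hy]; ring
    rw [h4]
    linarith
  · have : √(38 / 100) ≤ 61645 / 100000 := Real.sqrt_le_iff.2 ⟨by norm_num, by norm_num⟩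
    have h2 : (√(38 / 100) + 2 / 100) ^ 2 ≤ (61645 / 100000 + 2 / 100) ^ 2 := by gcongr
    norm_num at h2 ⊢
    linarith

end FailureProbabilities

end UCR

namespace UCR

open scoped ENNReal

/-! ### Union bounds. -/

section UnionBound

variable {Ω : Type*} [MeasurableSpace Ω] {P : Measure Ω}

theorem measure_not_and_le (p q : Ω → Prop) {a b : ℝ} (ha : 0 ≤ a) (hb : 0 ≤ b)
    (hp : P {ω | ¬ p ω} ≤ ENNReal.ofReal a) (hq : P {ω | ¬ q ω} ≤ ENNReal.ofReal b) :
    P {ω | ¬ (p ω ∧ q ω)} ≤ ENNReal.ofReal (a + b) := by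
  rw [ENNReal.ofReal_add ha hb]
  refine (measure_mono fun ω (hω : ¬ (p ω ∧ q ω)) => ?_).trans
    ((measure_union_le {ω | ¬ p ω} {ω | ¬ q ω}).trans (add_le_add hp hq))
  exact not_and_or.1 hω

theorem measure_not_forall_le {K : ℕ} (p : Fin K → Ω → Prop) {r : ℝ}
    (h : ∀ j, P {ω | ¬ p j ω} ≤ ENNReal.ofReal r) :
    P {ω | ¬ ∀ j, p j ω} ≤ ENNReal.ofReal (K * r) := by
  have h1 : {ω | ¬ ∀ j, p j ω} = ⋃ j, {ω | ¬ p j ω} := by ext ω; simp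
  rw [h1]
  refine (measure_iUnion_fintype_le P _).trans ((Finset.sum_le_sum fun j _ => h j).trans ?_)
  rw [Finset.sum_const, Finset.card_univ, Fintype.card_fin, nsmul_eq_mul,
    ENNReal.ofReal_mul (Nat.cast_nonneg _), ENNReal.ofReal_natCast]

theorem le_measureReal_of_ae_imp [IsProbabilityMeasure P] {p q : Ω → Prop} {δ : ℝ} (hδ : 0 ≤ δ)
    (hp : P {ω | ¬ p ω} ≤ ENNReal.ofReal δ) (h : ∀ᵐ ω ∂P, p ω → q ω) :
    1 - δ ≤ P.real {ω | q ω} := by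
  have h1 : P Set.univ ≤ P ({ω | q ω} ∪ {ω | ¬ p ω}) := by
    refine measure_mono_ae ?_
    filter_upwards [h] with ω hω _
    by_cases hpω : p ω
    · exact Or.inl (hω hpω)
    · exact Or.inr hpω
  have h2 := h1.trans ((measure_union_le _ _).trans (add_le_add_right hp _))
  rw [measure_univ, ← ofReal_measureReal (μ := P) (s := {ω | q ω}),
    ← ENNReal.ofReal_add measureReal_nonneg hδ, ENNReal.one_le_ofReal] at h2
  linarith

end UnionBound

/-! ### Use of the lower bound on the randomization horizon. -/

section Threshold

variable {d K : ℕ} {σ κ c₁ δ : ℝ} {N T : ℕ}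

/-- The summand `32/(3 c₁)` of the threshold contributes at least one and pays for the passage from
`T₀` to `N = T₀ - 1`. -/
theorem explore_of_threshold (hδ : δ ∈ Set.Ioo (0 : ℝ) (1 / 2)) (hc : 0 < c₁)
    (hc' : c₁ ≤ 1 / 2) (h : threshold d c₁ σ κ δ T ≤ ((N + 1 : ℕ) : ℝ)) :
    256 * Real.log ((4 * d + 4) / δ) ≤ c₁ ^ 2 * N := by
  have h1 := (le_max_left _ _).trans h
  have hδ0 := hδ.1
  have hL : 1 ≤ Real.log ((4 * d + 4) / δ) := by
    rw [Real.le_log_iff_exp_le (by positivity)]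
    refine Real.exp_one_lt_d9.le.trans ?_
    rw [le_div_iff₀ hδ0]
    have : (0 : ℝ) ≤ d := Nat.cast_nonneg _
    norm_num
    nlinarith [hδ.2]
  set L := Real.log ((4 * d + 4) / δ)
  have h2 : 1 ≤ 32 / (3 * c₁) * L := by
    have : 1 ≤ 32 / (3 * c₁) := by rw [le_div_iff₀ (by positivity)]; linarith
    nlinarith
  push_cast at h1
  have h3 : 256 / c₁ ^ 2 * L ≤ N := by linarith
  rw [div_mul_eq_mul_div, div_le_iff₀ (by positivity)] at h3
  linarith

/-- The threshold says `ξ² ≤ c₁ (N + 1) / 2`, and `N > 11000` turns `(N + 1) / 2` into `0.5005 N`.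
-/
theorem Calibration.tuning_sq_le {cx : ℝ} (hcal : Calibration d K cx c₁ δ N T) (hκ : 0 < κ)
    (h : threshold d c₁ σ κ δ T ≤ ((N + 1 : ℕ) : ℝ)) :
    tuning d σ κ δ T ^ 2 ≤ 5005 / 10000 * c₁ * N := by
  have h1 := (le_max_right _ _).trans h
  have hc := hcal.c₁_pos
  have hB := hcal.tuningSq_pos
  have hN := hcal.N_pos
  rw [tuning_eq, mul_pow, Real.sq_sqrt (by linarith), div_pow]
  have h2 : 6 * σ ^ 2 / (c₁ * κ ^ 2) * tuningSq d δ T = 2 / c₁ * (σ ^ 2 / κ ^ 2 * (3 * tuningSq d δ T)) := by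
    field_simp; ring
  change 6 * σ ^ 2 / (c₁ * κ ^ 2) * tuningSq d δ T ≤ _ at h1
  rw [h2, div_mul_eq_mul_div, div_le_iff₀ hc] at h1
  push_cast at h1
  nlinarith

end Threshold

/-! ### Probability of the good event. -/

section Probability

variable {d K : ℕ} {Ω : Type*} [m0 : MeasurableSpace Ω] {P : Measure Ω} [IsProbabilityMeasure P]
  {S : Run d K Ω} {M : Model d K} {PX : Measure (EuclideanSpace ℝ (Fin d))}
  {R₀ σ κ cx c₁ δ : ℝ} {N T : ℕ} {θhat : ℕ → Fin K → Ω → EuclideanSpace ℝ (Fin (d + 1))}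

theorem measure_exploration_le (henv : S.InEnvironment P M PX R₀ σ T) {ξ : ℝ}
    (hucr : S.FollowsUCR P M θhat ξ (N + 1) T) (hcal : Calibration d K cx c₁ δ N T)
    [IsProbabilityMeasure PX] (hctx : ContextVariation PX cx) :
    P {ω | ¬ ∀ j, GoodExploration (fun s => S.ρ s ω j) (fun s => S.X s ω) cx c₁ N} ≤
      ENNReal.ofReal (K * (δ / (8 * K) + (δ / (8 * K) + δ / (8 * K)))) := by
  have hδ := hcal.δ_pos
  have hδ' : 0 ≤ δ / (8 * K) := by positivity
  have hNT : N ≤ T := (Nat.le_succ N).trans hcal.lt_horizon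
  refine measure_not_forall_le _ fun j => ?_
  have hcontext : P {ω | ¬ ((3 ≤ K → ∀ b : EuclideanSpace ℝ (Fin d),
      82 / 100 * N * cx * ‖b‖ ^ 2 ≤ ∑ s ∈ Finset.Ico 1 (N + 1), (inner ℝ b (S.X s ω)) ^ 2) ∧
      (K = 2 → ∀ b : EuclideanSpace ℝ (Fin d), 38 / 100 * N * cx * ‖b‖ ^ 2 ≤
      ∑ s ∈ Finset.Ico 1 (N + 1) with posn (S.ρ s ω j) = 0, (inner ℝ b (S.X s ω)) ^ 2))} ≤
      ENNReal.ofReal (δ / (8 * K)) := by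
    rcases hcal.two_le_K.eq_or_lt with h2 | h3
    · refine (measure_mono (Set.compl_subset_compl.2 fun ω hω => ?_)).trans
        (measure_context_two_le henv hucr hcal hctx h2.symm j)
      exact ⟨fun h => by omega, fun _ => hω⟩
    · refine (measure_mono (Set.compl_subset_compl.2 fun ω hω => ?_)).trans
        (measure_context_le henv hcal hctx le_rfl hNT)
      exact ⟨fun _ => hω, fun h => by omega⟩
  refine (measure_mono (Set.compl_subset_compl.2 fun ω hω => ?_)).trans
    (measure_not_and_le _ _ hδ' (by positivity)
      (measure_cross_le henv hucr hcal hctx.norm_le j)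
      (measure_not_and_le _ _ hδ' hδ' (measure_variance_le henv hucr hcal j) hcontext))
  exact ⟨hω.1, hω.2.1, hω.2.2.1, hω.2.2.2⟩

theorem measure_not_goodOutcome_le (henv : S.InEnvironment P M PX R₀ σ T)
    (hucr : S.FollowsUCR P M θhat (tuning d σ κ δ T) (N + 1) T)
    (hcal : Calibration d K cx c₁ δ N T) [IsProbabilityMeasure PX]
    (hctx : ContextVariation PX cx) (hσ : 0 < σ) (hA : Continuous (deriv M.A)) :
    P {ω | ¬ GoodOutcome S M θhat R₀ σ κ cx c₁ δ N T ω} ≤ ENNReal.ofReal δ := by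
  have hδ := hcal.δ_pos
  have hK2 : (2 : ℝ) ≤ K := by exact_mod_cast hcal.two_le_K
  have hδ' : 0 < δ / (8 * K) := by positivity
  have hδ'' : 0 < δ / (2 * K) := by positivity
  have hae : ∀ᵐ ω ∂P, (∀ s ∈ Finset.Icc 1 T, ‖S.X s ω‖ ≤ √3 / 2) ∧
      (∀ t ∈ Finset.Icc 1 T, ∀ j k, M.mean j k (S.X t ω) ∈ Set.Icc 0 R₀) ∧
      (∀ t ∈ Finset.Icc (N + 1) T, ∀ j, (∃ ϑ, IsMaxOn (S.logLik M.A t j ω) Set.univ ϑ) →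
        IsMaxOn (S.logLik M.A t j ω) Set.univ (θhat t j ω)) ∧
      (∀ t ∈ Finset.Icc (N + 1) T, ∀ π,
        S.upper M θhat (tuning d σ κ δ T) t ω (S.X t ω) π ≤
          S.upper M θhat (tuning d σ κ δ T) t ω (S.X t ω) (S.ρ t ω)) := by
    refine Filter.Eventually.and ?_ (Filter.Eventually.and ?_ (Filter.Eventually.and ?_ ?_))
    · exact (Finset.eventually_all _).2 fun s hs => henv.ae_of_ae hs hctx.norm_le
    · exact (Finset.eventually_all _).2 fun t ht => ae_all_iff.2 fun j => ae_all_iff.2 fun k =>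
        henv.mean_mem ht j k
    · exact (Finset.eventually_all _).2 fun t ht => ae_all_iff.2 fun j => hucr.mle t ht j
    · exact (Finset.eventually_all _).2 fun t ht => hucr.optimistic t ht
  have hnull : P {ω | ¬ ((∀ s ∈ Finset.Icc 1 T, ‖S.X s ω‖ ≤ √3 / 2) ∧
      (∀ t ∈ Finset.Icc 1 T, ∀ j k, M.mean j k (S.X t ω) ∈ Set.Icc 0 R₀) ∧
      (∀ t ∈ Finset.Icc (N + 1) T, ∀ j, (∃ ϑ, IsMaxOn (S.logLik M.A t j ω) Set.univ ϑ) →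
        IsMaxOn (S.logLik M.A t j ω) Set.univ (θhat t j ω)) ∧
      (∀ t ∈ Finset.Icc (N + 1) T, ∀ π,
        S.upper M θhat (tuning d σ κ δ T) t ω (S.X t ω) π ≤
          S.upper M θhat (tuning d σ κ δ T) t ω (S.X t ω) (S.ρ t ω)))} ≤ ENNReal.ofReal 0 := by
    rw [ENNReal.ofReal_zero]
    exact (ae_iff.1 hae).le
  have hnoise := measure_not_forall_le _
    fun j => measure_noise_le henv hA hσ hctx.norm_le hδ'' j
  have hlate := measure_context_le henv hcal hctx (N' := earlyEnd N T) (le_max_left _ _) (by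
    have h1 : 11000 < T := by exact_mod_cast hcal.horizon_ge.1
    have := hcal.lt_horizon
    exact max_le (by omega) (by omega))
  have hall := measure_not_and_le _ _ le_rfl (by positivity) hnull
    (measure_not_and_le _ _ (by positivity) (by positivity) hnoise
      (measure_not_and_le _ _ (by positivity) hδ'.le
        (measure_exploration_le henv hucr hcal hctx) hlate))
  refine (measure_mono (Set.compl_subset_compl.2 fun ω hω => ?_)).trans
    (hall.trans (ENNReal.ofReal_le_ofReal ?_))
  · obtain ⟨⟨h1, h2, h3, h4⟩, h5, h6, h7⟩ := hω
    refine ⟨h1, h2, h3, h4, h6, h7, fun j t ht a => ?_⟩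
    have ht' := Finset.mem_Icc.1 ht
    exact h5 j t (Finset.mem_Icc.2 ⟨by omega, by omega⟩) a
  -- The budget is `δ/2` for the noise, `3δ/8` for the exploration and at most `δ/8` for the late
  -- contexts.
  · have h1 : (K : ℝ) * (δ / (2 * K)) = δ / 2 := by field_simp
    have h2 : (K : ℝ) * (δ / (8 * K) + (δ / (8 * K) + δ / (8 * K))) = 3 * δ / 8 := by
      field_simp; norm_num
    have h3 : δ / (8 * K) ≤ δ / 8 := by gcongr; linarith
    rw [h1, h2]
    linarith

end Probability

end UCR

/-! ### The theorem. -/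

theorem mainTheorem3 {d K : ℕ} (hd : 1 ≤ d) (hK : 1 ≤ K)
    {Ω : Type*} [MeasurableSpace Ω] (P : Measure Ω) [IsProbabilityMeasure P]
    (M : UCR.Model d K) (S : UCR.Run d K Ω)
    (θhat : ℕ → Fin K → Ω → EuclideanSpace ℝ (Fin (d + 1)))
    (PX : Measure (EuclideanSpace ℝ (Fin d)))
    (R₀ σbar M₁ M₂ κ cx c₁ δ : ℝ) (c : Fin K → NNReal) (T₀ T : ℕ)
    (hR₀ : 0 < R₀) (hσ : 0 < σbar) (hδ : δ ∈ Set.Ioo (0 : ℝ) (1 / 2)) (hT : T₀ ≤ T)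
    (hc₁ : c₁ = min (1 / (2 * (K : ℝ))) cx)
    (hctx : UCR.ContextVariation PX cx)
    (hreg : M.Regular M₁ M₂ κ c)
    (henv : S.InEnvironment P M PX R₀ σbar T)
    (hucr : S.FollowsUCR P M θhat (UCR.tuning d σbar κ δ T) T₀ T)
    (hT₀ : UCR.threshold d c₁ σbar κ δ T ≤ T₀) :
    1 - δ ≤ P.real {ω | S.regret M T ω ≤ (∑ k, (c k : ℝ)) * R₀ * T₀ +
        5 * σbar / κ * M₁ * (∑ k, (c k : ℝ)) * d * √T * Real.log (T / (d * δ))} ∧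
    ((∀ᵐ x ∂PX, ∀ π π', M.reward x π - M.reward x π' ≤ R₀) →
      1 - δ ≤ P.real {ω | S.regret M T ω ≤ R₀ * T₀ +
        5 * σbar / κ * M₁ * (∑ k, (c k : ℝ)) * d * √T * Real.log (T / (d * δ))}) := by
  obtain ⟨hδ0, hδ1⟩ := hδ
  have hd' : (1 : ℝ) ≤ d := by exact_mod_cast hd
  have hK' : (1 : ℝ) ≤ K := by exact_mod_cast hK
  have hcx := hctx.pos
  have hc₁0 : 0 < c₁ := by rw [hc₁]; positivity
  have hc₁K : c₁ ≤ 1 / (2 * K) := hc₁.trans_le (min_le_left _ _)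
  have hc₁cx : c₁ ≤ cx := hc₁.trans_le (min_le_right _ _)
  have hc₁' : c₁ ≤ 1 / 2 := hc₁K.trans (by
    rw [div_le_div_iff₀ (by positivity) (by norm_num)]; linarith)
  have hL0 : 0 < Real.log ((4 * d + 4) / δ) := Real.log_pos (by
    rw [lt_div_iff₀ hδ0]; linarith)
  -- The rounds `t < T₀` are `1, …, N`; a positive threshold excludes `T₀ = 0`.
  obtain ⟨N, rfl⟩ : ∃ N, T₀ = N + 1 := by
    refine Nat.exists_eq_succ_of_ne_zero fun h0 => ?_
    have h1 := (le_max_left _ _).trans hT₀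
    rw [h0, Nat.cast_zero] at h1
    have : 0 < (32 / (3 * c₁) + 256 / c₁ ^ 2) * Real.log ((4 * d + 4) / δ) := by positivity
    linarith
  have hexplore := UCR.explore_of_threshold ⟨hδ0, hδ1⟩ hc₁0 hc₁' hT₀
  have hPX : IsProbabilityMeasure PX := by
    have h1 : 1 ∈ Finset.Icc 1 T := Finset.mem_Icc.2 ⟨le_rfl, by omega⟩
    rw [← henv.law_X 1 h1]
    exact Measure.isProbabilityMeasure_map (henv.measurable_X 1 h1).aemeasurable
  have hcxd := hctx.mul_le
  have hA : Continuous (deriv M.A) := hreg.differentiable_A'.continuous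
  have hM₁ := hreg.M₁_pos hK
  have hκ := hreg.κ_pos
  have hc0 : 0 ≤ ∑ k, (c k : ℝ) := Finset.sum_nonneg fun k _ => (c k).2
  rcases hK.eq_or_lt with rfl | hK2
  -- The regret is zero for one item, but the claimed bound must still be nonnegative, which
  -- requires `T ≥ d δ`.
  · have hdT : (d : ℝ) * δ ≤ T := by
      have h1 : (N : ℝ) ≤ T := by exact_mod_cast (Nat.le_succ N).trans hT
      have h2 : c₁ * d ≤ 3 / 4 := by
        have : c₁ * d ≤ cx * d := by gcongr
        linarith
      have h3 : 256 ≤ c₁ ^ 2 * N := by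
        have h4 : 1 ≤ Real.log ((4 * d + 4) / δ) := by
          rw [Real.le_log_iff_exp_le (by positivity)]
          refine Real.exp_one_lt_d9.le.trans ?_
          rw [le_div_iff₀ hδ0]
          norm_num
          nlinarith
        linarith
      have h4 : c₁ ^ 2 * d ≤ c₁ ^ 2 * N := by nlinarith
      have h5 : (d : ℝ) ≤ N := le_of_mul_le_mul_left h4 (by positivity)
      nlinarith
    have hrate : 0 ≤ 5 * σbar / κ * M₁ * (∑ k, (c k : ℝ)) * d * √T * Real.log (T / (d * δ)) := by
      have : 0 ≤ Real.log (T / (d * δ)) := Real.log_nonneg (by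
        rw [le_div_iff₀ (by positivity)]; linarith)
      positivity
    have hzero : ∀ ω, S.regret M T ω = 0 := by
      intro ω
      refine Finset.sum_eq_zero fun t _ => ?_
      rw [sub_eq_zero]
      refine le_antisymm (Finset.sup'_le _ _ fun π _ => ?_) (Finset.le_sup' _ (Finset.mem_univ _))
      rw [Subsingleton.elim π (S.ρ t ω)]
    have hall : ∀ b : ℝ, 0 ≤ b → 1 - δ ≤ P.real {ω | S.regret M T ω ≤ b} := by
      intro b hb
      have : {ω | S.regret M T ω ≤ b} = Set.univ :=
        Set.eq_univ_of_forall fun ω => (hzero ω).trans_le hb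
      rw [this, probReal_univ]
      linarith
    exact ⟨hall _ (by positivity), fun _ => hall _ (by positivity)⟩
  · have hcal : UCR.Calibration d K cx c₁ δ N T :=
      ⟨hd, hK2, hδ0, hδ1, hc₁0, hc₁K, hc₁cx, hcxd, hexplore, hT⟩
    have hξ := hcal.tuning_sq_le hκ hT₀
    have hgood := UCR.measure_not_goodOutcome_le henv hucr hcal hctx hσ hA
    push_cast
    refine ⟨UCR.le_measureReal_of_ae_imp hδ0.le hgood (ae_of_all _ fun ω hω => ?_), fun hR =>
      UCR.le_measureReal_of_ae_imp hδ0.le hgood ?_⟩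
    · have h1 := hω.regret_le hcal hreg hσ hξ (D := (∑ k, (c k : ℝ)) * R₀) fun t ht π π' =>
        hreg.reward_sub_le_of_range (hω.mean_mem t (Finset.mem_Icc.2
          ⟨(Finset.mem_Ico.1 ht).1, by have := (Finset.mem_Ico.1 ht).2; omega⟩)) π π'
      have h2 : 0 ≤ (∑ k, (c k : ℝ)) * R₀ := by positivity
      linarith
    · have hR' : ∀ᵐ ω ∂P, ∀ t ∈ Finset.Icc 1 T, ∀ π π',
          M.reward (S.X t ω) π - M.reward (S.X t ω) π' ≤ R₀ :=
        (Finset.eventually_all _).2 fun t ht => henv.ae_of_ae ht hR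
      filter_upwards [hR'] with ω hω' hω
      have h1 := hω.regret_le hcal hreg hσ hξ (D := R₀) fun t ht π π' =>
        hω' t (Finset.mem_Icc.2
          ⟨(Finset.mem_Ico.1 ht).1, by have := (Finset.mem_Ico.1 ht).2; omega⟩) π π'
      linarith
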